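/- **Formulas and structures.** Formulas are those of multiplicative linear logic, $A ::= 1\mid\bot\mid X\mid X^\perp\mid A\otimes A\mid A⅋A$, with De Morgan negation. Positive formulas are $P::=1\mid P\otimes P$, negative ones $N::=\bot\mid N⅋N$. An SMLL structure with boxes is a finite directed graph whose edges are typed by formulas, whose nodes are links, and which may have pending edges $\Gamma$ without target, its conclusions. The links are $\mathsf{ax}$ (conclusions $A,A^\perp$), $\mathsf{cut}$ (premisses $A,A^\perp$), $\otimes$ and $⅋$ (premisses $A,B$, conclusion $A\otimes B$, resp. $A⅋B$), $\mathsf{one}$ (conclusion $1$), sync links ($n\ge1$ premisses and $n$ corresponding conclusions, the $i$-th premiss and the $i$-th conclusion having the same type, which is positive or negative), and boxes of conclusions $\bot,\Delta$, which contain a structure of conclusions $\Delta$; the edge $\bot$ is the lock of the box. The in-edges of a sync link are its positive premisses and negative conclusions; its out-edges are its other edges. An *SMLL net* is a structure such that the graph of its links at depth $0$ (each box counting as a single node of conclusions $\bot,\Delta$) has no simple undirected cycle that uses at most one premiss of each $⅋$ and at most one out-edge of each sync link, and such that the content of each box is, hereditarily, correct in the same sense. **Reduction.** The steps, at depth $0$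 only and never changing the conclusions, are: * $\mathsf{ax}/\mathsf{cut}$ and $\otimes/⅋$, as in multiplicative linear logic; * a sync link whose positive premiss $A\otimes B$ is the conclusion of a $\otimes$ (or whose negative premiss $A⅋B$ is the conclusion of a $⅋$) moves above it, to its two premisses; * a sync link on the positive conclusion $P$ of an axiom moves to its conclusion $P^\perp$; * a sync link on the negative premiss $P^\perp$ of a cut moves to its premiss $P$; * a sync link whose premisses are all conclusions of $\mathsf{one}$ links is erased; * a box whose lock is cut against the conclusion of a $\mathsf{one}$ link is replaced by its content. **The machine $M_R$.** Positions are the pairs $(e,m)$ of an edge $e$ of $R$, at any depth, and an occurrence of atom $m$ in its type, together with the pairs $(e,i)$, $i\in\mathbb N$, with $e$ the lock of a box; the latter form $\mathrm{BOTBOX}(R)$. A position $(e,m)$ is positive (negative) if the occurrence $m$ is. $\mathrm{INIT}(R)$ and $\mathrm{FIN}(R)$ are the sets of negative, resp. positive, occurrences of atoms in the conclusions. A state is a function from $\mathrm{INIT}(R)\cup O$, with $O$ a set of conclusions of $\mathsf{one}$ links, to the positions; the initial state is the identity on $\mathrm{INIT}(R)$. A box is unlocked if there is a token on $(e,i)$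 for its lock $e$ and some $i$. In a transition, one of the following happens: * one token moves through an $\mathsf{ax}$, $\mathsf{cut}$, $\otimes$ or $⅋$ link, upwards from a negative and downwards from a positive position, following the occurrence of atom; * all tokens on the in-edges of a sync link cross it simultaneously, which is possible when there is a token on each position of each in-edge; * a $\mathsf{one}$ link at depth $0$ in $R$, or at depth $0$ inside an unlocked box, generates a token on its conclusion, at most once; * a token on the lock $e$ of a box moves from $(e,\varepsilon)$ to $(e,0)$; * a token crosses the border of an unlocked box through a conclusion other than the lock. A state is final if its image is $\mathrm{FIN}(R)\cup B$ for some $B\subseteq\mathrm{BOTBOX}(R)$. A run is a maximal sequence of transitions from the initial state; $M_R$ deadlocks if a run ends in a state that is not final. The interpretation $[R]$ is the symbol $\Box$ if $M_R$ deadlocks; otherwise it is the partial function $\mathrm{INIT}(R)\rightharpoonup\mathrm{FIN}(R)$ obtained by restricting the state $F$ in which the runs of $M_R$ end to those initial positions that $F$ does not send to $\mathrm{BOTBOX}(R)$. **Theorem (Soundness).** Let $R$ be an SMLL net and let $S$ be its normal form. Then $M_R$ and $M_S$ each have exactly one state in which a run ends (so that $[R]$ and $[S]$ are well defined), and $$[R]=[S].$$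 In particular, $M_R$ deadlocks if and only if $M_S$ does. (Reduction does not change the conclusions, so $\mathrm{INIT}(R)=\mathrm{INIT}(S)$ and $\mathrm{FIN}(R)=\mathrm{FIN}(S)$.) -/

import Mathlib

namespace SMLL

/-! ### Formulas -/

/-- Formulas of multiplicative linear logic with units; `covar n` is the negation of the
propositional variable `var n`. -/
inductive Formula : Type
  | one : Formula
  | bot : Formula
  | var : ℕ → Formula
  | covar : ℕ → Formula
  | tensor : Formula → Formula → Formula
  | par : Formula → Formula → Formula
  deriving DecidableEq

namespace Formula

/-- Linear negation. -/
def dual : Formula → Formula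
  | one => bot
  | bot => one
  | var n => covar n
  | covar n => var n
  | tensor A B => par A.dual B.dual
  | par A B => tensor A.dual B.dual

/-- Positive formulas `P ::= 1 | P ⊗ P`. -/
def Positive : Formula → Prop
  | one => True
  | tensor A B => A.Positive ∧ B.Positive
  | _ => False

/-- Negative formulas `N ::= ⊥ | N ⅋ N`. -/
def Negative : Formula → Prop
  | bot => True
  | par A B => A.Negative ∧ B.Negative
  | _ => False

end Formula

/-- The alphabet of addresses. -/
inductive Dir : Type
  | l : Dir
  | r : Dir
  deriving DecidableEq

/-- `A.polarity m` is `some true` (`some false`) if `m` is the address in `A` of an occurrence of a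
positive (negative) atom, and `none` if `m` is not the address of an occurrence of an atom. -/
def Formula.polarity : Formula → List Dir → Option Bool
  | .one, [] => some true
  | .var _, [] => some true
  | .bot, [] => some false
  | .covar _, [] => some false
  | .tensor A _, .l :: m => A.polarity m
  | .tensor _ B, .r :: m => B.polarity m
  | .par A _, .l :: m => A.polarity m
  | .par _ B, .r :: m => B.polarity m
  | _, _ => none

/-! ### Structures with boxes -/

/-- An edge: a name together with the formula typing the edge. -/
structure Edge : Type where
  name : ℕ
  ty : Formula
  deriving DecidableEq

/-- Links. The premisses of a link are listed before its conclusions: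
* `ax e f` has the conclusions `e`, `f`; `cut e f` has the premisses `e`, `f`;
* `tensor a b c` and `par a b c` have the premisses `a`, `b` and the conclusion `c`;
* `one e` has the conclusion `e`;
* `sync ps` has, for each pair `(a, b)` of the list `ps`, a premiss `a` with the corresponding
  conclusion `b`;
* `box e ds C` is a box with lock `e` and with content the structure whose links are `C`. Each pair
  `(i, o)` of the list `ds` stands for one place where the border of the box is crossed: `i` is a
  conclusion of the content (an edge inside the box), and `o` is the corresponding conclusion of
  the box (an edge outside). -/
inductive Link : Type
  | ax : Edge → Edge → Link
  | cut : Edge → Edge → Link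
  | tensor : Edge → Edge → Edge → Link
  | par : Edge → Edge → Edge → Link
  | one : Edge → Link
  | sync : List (Edge × Edge) → Link
  | box : Edge → List (Edge × Edge) → List Link → Link

namespace Link

/-- The premisses of a link (a box has none). -/
def prems : Link → List Edge
  | ax _ _ => []
  | cut e f => [e, f]
  | tensor a b _ => [a, b]
  | par a b _ => [a, b]
  | one _ => []
  | sync ps => ps.map Prod.fst
  | box _ _ _ => []

/-- The conclusions of a link, a box being seen as a node of conclusions `⊥, Γ`. -/
def concls : Link → List Edge
  | ax e f => [e, f]
  | cut _ _ => []
  | tensor _ _ c => [c]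
  | par _ _ c => [c]
  | one e => [e]
  | sync ps => ps.map Prod.snd
  | box e ds _ => e :: ds.map Prod.snd

/-- The constraints on the types of the edges of a link. -/
def Typed : Link → Prop
  | ax e f => f.ty = e.ty.dual
  | cut e f => f.ty = e.ty.dual
  | tensor a b c => c.ty = .tensor a.ty b.ty
  | par a b c => c.ty = .par a.ty b.ty
  | one e => e.ty = .one
  | sync ps => ps ≠ [] ∧ ∀ p ∈ ps, p.1.ty = p.2.ty ∧ (p.1.ty.Positive ∨ p.1.ty.Negative)
  | box e ds _ => e.ty = .bot ∧ ∀ p ∈ ds, p.1.ty = p.2.ty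

/-- Replacing the edges of a link at the level of the link (the inside of a box is not changed). -/
def rename (σ : Edge → Edge) : Link → Link
  | ax e f => ax (σ e) (σ f)
  | cut e f => cut (σ e) (σ f)
  | tensor a b c => tensor (σ a) (σ b) (σ c)
  | par a b c => par (σ a) (σ b) (σ c)
  | one e => one (σ e)
  | sync ps => sync (ps.map fun p => (σ p.1, σ p.2))
  | box e ds C => box (σ e) (ds.map fun p => (p.1, σ p.2)) C

end Link

/-- `(a, b)` is a pair of corresponding edges of a sync link; `InOut a b e f` says that, of these
two, `e` is the in-edge and `f` is the out-edge. -/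
def InOut (a b e f : Edge) : Prop :=
  (a.ty.Positive ∧ e = a ∧ f = b) ∨ (a.ty.Negative ∧ e = b ∧ f = a)

mutual
/-- The conclusions of a link and of all links inside it (if it is a box). -/
def Link.deepConcls : Link → List Edge
  | .ax e f => [e, f]
  | .cut _ _ => []
  | .tensor _ _ c => [c]
  | .par _ _ c => [c]
  | .one e => [e]
  | .sync ps => ps.map Prod.snd
  | .box e ds C => (e :: ds.map Prod.snd) ++ allEdges C

/-- The conclusions of all links, at all depths; in a structure, these are all its edges. -/
def allEdges : List Link → List Edge
  | [] => []
  | l :: L => l.deepConcls ++ allEdges L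
end

/-- The links `L` form, at depth 0 and hereditarily inside the boxes, a typed graph with pending
edges `Γ`: the edges occurring as a premiss or as a pending edge are exactly those occurring as a
conclusion of a link (with multiplicities). -/
inductive WellFormed : List Link → List Edge → Prop
  | mk (L : List Link) (Γ : List Edge)
      (typed : ∀ l ∈ L, l.Typed)
      (edges : (L.flatMap Link.prems ++ Γ).Perm (L.flatMap Link.concls))
      (boxes : ∀ e ds C, Link.box e ds C ∈ L → WellFormed C (ds.map Prod.fst)) :
      WellFormed L Γ

/-- `L` is the list of links of an SMLL structure with boxes, of conclusions `Γ`. All the edges, at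
all depths, are distinct, so that each edge is a conclusion of exactly one link. -/
def IsStructure (L : List Link) (Γ : List Edge) : Prop :=
  WellFormed L Γ ∧ (allEdges L).Nodup

/-! ### Correctness -/

/-- The edge `e` joins the nodes `k` and `l`. -/
def Joins (e : Edge) (k l : Link) : Prop :=
  (e ∈ k.concls ∧ e ∈ l.prems) ∨ (e ∈ l.concls ∧ e ∈ k.prems)

/-- A switching cycle in the 0-graph of `L`: a simple undirected cycle with the `n + 1` nodes
`node i` and the `n + 1` edges `edge i` (the index `i + 1` is taken modulo `n + 1`), using at most
one premiss of each par link and at most one out-edge of each sync link. -/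
structure IsSwitchingCycle (L : List Link) (n : ℕ) (node : Fin (n + 1) → Link)
    (edge : Fin (n + 1) → Edge) : Prop where
  mem : ∀ i, node i ∈ L
  node_inj : Function.Injective node
  edge_inj : Function.Injective edge
  joins : ∀ i, Joins (edge i) (node i) (node (i + 1))
  par_switch : ∀ a b c, Link.par a b c ∈ L → ∀ i j, ¬ (edge i = a ∧ edge j = b)
  sync_switch : ∀ ps, Link.sync ps ∈ L → ∀ p ∈ ps, ∀ q ∈ ps, ∀ i j e e',
    InOut p.1 p.2 e (edge i) → InOut q.1 q.2 e' (edge j) → i = j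

/-- Correctness: no switching cycle in the 0-graph, and the content of each box is correct. -/
inductive Correct : List Link → Prop
  | mk (L : List Link)
      (acyclic : ∀ n node edge, ¬ IsSwitchingCycle L n node edge)
      (boxes : ∀ e ds C, Link.box e ds C ∈ L → Correct C) :
      Correct L

/-- `R` is the list of links of an SMLL net of conclusions `Γ`. -/
def IsNet (R : List Link) (Γ : List Edge) : Prop :=
  IsStructure R Γ ∧ Correct R

/-! ### Reduction -/

/-- `x` is an axiom link of conclusions `e` and `f`, in either order. -/
def IsAx (x : Link) (e f : Edge) : Prop := x = .ax e f ∨ x = .ax f e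

/-- `x` is a cut link of premisses `e` and `f`, in either order. -/
def IsCut (x : Link) (e f : Edge) : Prop := x = .cut e f ∨ x = .cut f e

/-- `x` is a new edge of type `A`. -/
def Fresh (L : List Link) (x : Edge) (A : Formula) : Prop := x ∉ allEdges L ∧ x.ty = A

/-- The map sending each conclusion of the content of a box to the corresponding conclusion of
the box. -/
def exitDoor (ds : List (Edge × Edge)) (x : Edge) : Edge := (ds.lookup x).getD x

/-- One reduction step, at depth 0. Lists of links are considered up to the order of the links.
The conclusions of the structure are not affected: a step never changes its pending edges. -/
inductive Step : List Link → List Link → Prop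
  /-- `ax / cut`: the link of conclusion `g` now has the conclusion `e` -/
  | ax_cut {L L' K : List Link} {x y : Link} {e f g : Edge} :
      IsAx x e f → IsCut y f g →
      L.Perm (x :: y :: K) →
      L'.Perm (K.map (Link.rename fun z => if z = g then e else z)) →
      Step L L'
  | tensor_par {L L' K : List Link} {y : Link} {a b c a' b' c' : Edge} :
      IsCut y c c' →
      L.Perm (.tensor a b c :: .par a' b' c' :: y :: K) →
      L'.Perm (.cut a a' :: .cut b b' :: K) →
      Step L L'
  | sync_tensor {L L' K : List Link} {ps qs : List (Edge × Edge)} {a b c d a' b' : Edge} :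
      Fresh L a' a.ty → Fresh L b' b.ty → a' ≠ b' →
      L.Perm (.sync (ps ++ (c, d) :: qs) :: .tensor a b c :: K) →
      L'.Perm (.sync (ps ++ (a, a') :: (b, b') :: qs) :: .tensor a' b' d :: K) →
      Step L L'
  | sync_par {L L' K : List Link} {ps qs : List (Edge × Edge)} {a b c d a' b' : Edge} :
      Fresh L a' a.ty → Fresh L b' b.ty → a' ≠ b' →
      L.Perm (.sync (ps ++ (c, d) :: qs) :: .par a b c :: K) →
      L'.Perm (.sync (ps ++ (a, a') :: (b, b') :: qs) :: .par a' b' d :: K) →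
      Step L L'
  | ax_sync {L L' K : List Link} {x : Link} {ps qs : List (Edge × Edge)} {e f g f' : Edge} :
      IsAx x e f → e.ty.Positive → Fresh L f' f.ty →
      L.Perm (.sync (ps ++ (e, g) :: qs) :: x :: K) →
      L'.Perm (.sync (ps ++ (f', f) :: qs) :: .ax g f' :: K) →
      Step L L'
  | cut_sync {L L' K : List Link} {y : Link} {ps qs : List (Edge × Edge)} {c d g g' : Edge} :
      IsCut y d g → d.ty.Negative → Fresh L g' g.ty →
      L.Perm (.sync (ps ++ (c, d) :: qs) :: y :: K) →
      L'.Perm (.sync (ps ++ (g, g') :: qs) :: .cut c g' :: K) →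
      Step L L'
  /-- a sync link all of whose premisses are conclusions of `one` links is erased -/
  | sync_one {L L' K : List Link} {ps : List (Edge × Edge)} :
      L.Perm (.sync ps :: (ps.map fun p => Link.one p.1) ++ K) →
      L'.Perm ((ps.map fun p => Link.one p.2) ++ K) →
      Step L L'
  /-- `one / bot`: opening a box -/
  | box_open {L L' K C : List Link} {y : Link} {ds : List (Edge × Edge)} {e f : Edge} :
      IsCut y e f →
      L.Perm (.one e :: y :: .box f ds C :: K) →
      L'.Perm (C.map (Link.rename (exitDoor ds)) ++ K) →
      Step L L'

/-- `S` is a normal form of `R`. -/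
def IsNormalFormOf (S R : List Link) : Prop :=
  Relation.ReflTransGen Step R S ∧ ∀ S', ¬ Step S S'

/-! ### The multi-token machine -/

/-- Positions: `atom e m` is the occurrence of atom of address `m` in the type of the edge `e`;
`lock e i` is the position `(e, i)`, `i ∈ ℕ`, where `e` is the lock of a box. -/
inductive Pos : Type
  | atom : Edge → List Dir → Pos
  | lock : Edge → ℕ → Pos
  deriving DecidableEq

/-- Initial positions: negative occurrences of atoms in the conclusions. -/
def IsInit (Γ : List Edge) (p : Pos) : Prop :=
  ∃ e ∈ Γ, ∃ m, e.ty.polarity m = some false ∧ p = .atom e m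

/-- Final positions: positive occurrences of atoms in the conclusions. -/
def IsFin (Γ : List Edge) (p : Pos) : Prop :=
  ∃ e ∈ Γ, ∃ m, e.ty.polarity m = some true ∧ p = .atom e m

/-- `LinkAt R b l`: the link `l` occurs in `R`, at depth 0 if `b = none`, and at depth 0 inside the
box of lock `e` if `b = some e`. -/
inductive LinkAt (R : List Link) : Option Edge → Link → Prop
  | top {l : Link} : l ∈ R → LinkAt R none l
  | inside {b : Option Edge} {e : Edge} {ds : List (Edge × Edge)} {C : List Link} {l : Link} :
      LinkAt R b (.box e ds C) → l ∈ C → LinkAt R (some e) l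

/-- `l` is a link of `R`, at any depth. -/
def IsLink (R : List Link) (l : Link) : Prop := ∃ b, LinkAt R b l

/-- The set `BOTBOX(R)`. -/
def IsBotBox (R : List Link) (p : Pos) : Prop :=
  ∃ e ds C i, IsLink R (.box e ds C) ∧ p = .lock e i

/-- The underlying partial functions of states: `T s = some p` says that the token of origin `s` is
on the position `p`. A token is identified with its origin, an initial position or the conclusion of
a `one` link; every state reached from `initState` is defined on all initial positions, on
a set of one positions, and nowhere else. -/
abbrev State : Type := Pos → Option Pos

open Classical in
/-- The initial state: the identity on the initial positions. -/
noncomputable def initState (Γ : List Edge) : State :=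
  fun p => if IsInit Γ p then some p else none

/-- There is a token on `p`. -/
def State.Occupied (T : State) (p : Pos) : Prop := ∃ s, T s = some p

/-- The edge `e` is saturated: there is a token on each occurrence of atom of its type. -/
def State.Saturated (T : State) (e : Edge) : Prop :=
  ∀ m, e.ty.polarity m ≠ none → T.Occupied (.atom e m)

/-- The box of lock `e` is unlocked. -/
def State.Unlocked (T : State) (e : Edge) : Prop := ∃ i, T.Occupied (.lock e i)

/-- The links at depth 0 inside the box of lock `e` (if `b = some e`) or at depth 0 (if `b = none`)
are active. -/
def State.Active (T : State) (b : Option Edge) : Prop := ∀ e, b = some e → T.Unlocked e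

/-- The movements of a single token, from the first to the second position. -/
inductive Move (R : List Link) (T : State) : Pos → Pos → Prop
  | ax {x : Link} {e f : Edge} {m : List Dir} :
      IsLink R x → IsAx x e f → e.ty.polarity m = some false →
      Move R T (.atom e m) (.atom f m)
  | cut {y : Link} {e f : Edge} {m : List Dir} :
      IsLink R y → IsCut y e f → e.ty.polarity m = some true →
      Move R T (.atom e m) (.atom f m)
  | mult_left_down {x : Link} {a b c : Edge} {m : List Dir} :
      IsLink R x → x = .tensor a b c ∨ x = .par a b c → a.ty.polarity m = some true →
      Move R T (.atom a m) (.atom c (.l :: m))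
  | mult_right_down {x : Link} {a b c : Edge} {m : List Dir} :
      IsLink R x → x = .tensor a b c ∨ x = .par a b c → b.ty.polarity m = some true →
      Move R T (.atom b m) (.atom c (.r :: m))
  | mult_left_up {x : Link} {a b c : Edge} {m : List Dir} :
      IsLink R x → x = .tensor a b c ∨ x = .par a b c → c.ty.polarity (.l :: m) = some false →
      Move R T (.atom c (.l :: m)) (.atom a m)
  | mult_right_up {x : Link} {a b c : Edge} {m : List Dir} :
      IsLink R x → x = .tensor a b c ∨ x = .par a b c → c.ty.polarity (.r :: m) = some false →
      Move R T (.atom c (.r :: m)) (.atom b m)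
  | box_lock {e : Edge} {ds : List (Edge × Edge)} {C : List Link} :
      IsLink R (.box e ds C) →
      Move R T (.atom e []) (.lock e 0)
  | box_exit {e i o : Edge} {ds : List (Edge × Edge)} {C : List Link} {m : List Dir} :
      IsLink R (.box e ds C) → (i, o) ∈ ds → T.Unlocked e → i.ty.polarity m = some true →
      Move R T (.atom i m) (.atom o m)
  | box_enter {e i o : Edge} {ds : List (Edge × Edge)} {C : List Link} {m : List Dir} :
      IsLink R (.box e ds C) → (i, o) ∈ ds → T.Unlocked e → o.ty.polarity m = some false →
      Move R T (.atom o m) (.atom i m)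

/-- A token on `p` (an occurrence of atom in an in-edge of the sync link `ps`) is on `q` (the same
occurrence in the corresponding out-edge) after crossing the link. -/
def Crosses (ps : List (Edge × Edge)) (p q : Pos) : Prop :=
  ∃ a b e f m, (a, b) ∈ ps ∧ InOut a b e f ∧ p = .atom e m ∧ q = .atom f m

/-- The transition relation of the machine of `R`. -/
inductive Trans (R : List Link) : State → State → Prop
  | move {T : State} {s p q : Pos} :
      T s = some p → Move R T p q →
      Trans R T (Function.update T s (some q))
  /-- all in-edges are saturated, and all tokens on them cross the sync link simultaneously -/
  | sync {T U : State} {ps : List (Edge × Edge)} :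
      IsLink R (.sync ps) →
      (∀ a b e f, (a, b) ∈ ps → InOut a b e f → T.Saturated e) →
      (∀ s p q, T s = some p → Crosses ps p q → U s = some q) →
      (∀ s, (∀ p q, T s = some p → ¬ Crosses ps p q) → U s = T s) →
      Trans R T U
  /-- an active `one` link which has not done so yet generates a token -/
  | one {T : State} {b : Option Edge} {e : Edge} :
      LinkAt R b (.one e) → T.Active b → T (.atom e []) = none →
      Trans R T (Function.update T (.atom e []) (some (.atom e [])))

/-- `T` is the last state of a run: a maximal sequence of transitions from the initial state. -/
def IsRunEnd (Γ : List Edge) (R : List Link) (T : State) : Prop :=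
  Relation.ReflTransGen (Trans R) (initState Γ) T ∧ ∀ U, ¬ Trans R T U

/-- Final states: the image of `T` is the set of final positions together with a subset of
`BOTBOX(R)`. -/
def IsFinalState (Γ : List Edge) (R : List Link) (T : State) : Prop :=
  (∀ p, IsFin Γ p → T.Occupied p) ∧ ∀ p, T.Occupied p → IsFin Γ p ∨ IsBotBox R p

/-- The machine of `R` deadlocks: it has a run which ends in a state that is not final. -/
def Deadlocks (Γ : List Edge) (R : List Link) : Prop :=
  ∃ T, IsRunEnd Γ R T ∧ ¬ IsFinalState Γ R T

open Classical in
/-- The partial function from initial to final positions given by a state. In a final state, the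
initial positions on which it is not defined are those whose token is in `BOTBOX(R)`. -/
noncomputable def State.result (Γ : List Edge) (T : State) :
    {p // IsInit Γ p} → Option {p // IsFin Γ p} :=
  fun s => (T s.1).bind fun p => if h : IsFin Γ p then some ⟨p, h⟩ else none

open Classical in
/-- The interpretation `[R]` of a net `R` of conclusions `Γ`: `none` is the deadlock symbol `□`, and
`some f` is the partial function `f` from the initial to the final positions. -/
noncomputable def interp (Γ : List Edge) (R : List Link) :
    Option ({p // IsInit Γ p} → Option {p // IsFin Γ p}) :=
  if h : ∃ F, IsRunEnd Γ R F ∧ IsFinalState Γ R F then some (h.choose.result Γ) else none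

end SMLL

-- The end of a run can be described without runs. A structure is flattened into the list of its
-- links at all depths, each located in its box (`flatten`, `Flat`). A link has wires, along which a
-- token follows an occurrence of atom, and a movement carries a guard: the positions that must be
-- visited before it is possible, namely all entries of a sync link, or the lock of a box. `Sys.Vis
-- s p`, "the token of origin `s` visits `p`", is the least relation closed under guarded generation
-- and guarded movement. Since every edge has one source and at most one target, movements are
-- deterministic forwards and backwards and origins have no predecessor (`Flat.det`); hence two
-- tokens never visit the same position and no token loops.
--
-- Runs compute `Vis`. Every reachable state satisfies an invariant (`Inv.trans`) whose main clause
-- says that the exits of a sync link have been passed all together or not at all. Each transition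
-- passes a new position, and only finitely many can be visited, so runs end (`exists_runEnd`). When
-- the machine stops, every visited position has been passed by its token (`IsRunEnd.passed`).
-- Guards may thus ask for visited instead of occupied positions: a token that has left an entry of
-- a sync link left it together with all the others, and a token never leaves a lock. The token `s`
-- therefore ends on the last position that it visits, which gives uniqueness of the final state and
-- expresses deadlock and result through `Vis` (`IsRunEnd.isFinalState_iff`, `Equi.interp_eq`).
--
-- It remains to compare `Vis` before and after one reduction step, by simulations in both
-- directions (`Equi.of_sim`), in three patterns. Moving a sync link past another link exchanges a
-- free movement with a synchronized one (`Commute.equi`). The step tensor/par replaces three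
-- consecutive free movements by one (`Shortcut.equi`). The steps ax/cut, erasure of a sync link and
-- opening of a box contract links that tokens cross without waiting, so that several edges are
-- merged into one (`Contraction.equi`). An induction on the reduction sequence concludes.

namespace SMLL

/-! ### Located links -/

/-- A link without the content of its box. -/
def Link.shell : Link → Link
  | .box e ds _ => .box e ds []
  | l => l

mutual
/-- The links occurring in a link which is located in the box `b`. -/
def Link.flat : Link → Option Edge → List (Option Edge × Link)
  | .ax e f, b => [(b, .ax e f)]
  | .cut e f, b => [(b, .cut e f)]
  | .tensor x y z, b => [(b, .tensor x y z)]
  | .par x y z, b => [(b, .par x y z)]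
  | .one e, b => [(b, .one e)]
  | .sync ps, b => [(b, .sync ps)]
  | .box e ds C, b => (b, .box e ds []) :: flatten C (some e)

/-- The located links of a structure contained in the box `b`. -/
def flatten : List Link → Option Edge → List (Option Edge × Link)
  | [], _ => []
  | l :: L, b => l.flat b ++ flatten L b
end

theorem flatten_eq_flatMap (L : List Link) (b : Option Edge) :
    flatten L b = L.flatMap fun l => l.flat b := by
  induction L with
  | nil => rfl
  | cons l L ih => simp [flatten, ih]

theorem flatten_append (L L' : List Link) (b : Option Edge) :
    flatten (L ++ L') b = flatten L b ++ flatten L' b := by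
  simp [flatten_eq_flatMap]

theorem flatten_perm {L L' : List Link} (h : L.Perm L') (b : Option Edge) :
    (flatten L b).Perm (flatten L' b) := by
  simpa only [flatten_eq_flatMap] using h.flatMap_right _

theorem allEdges_eq_flatMap (L : List Link) : allEdges L = L.flatMap Link.deepConcls := by
  induction L with
  | nil => rfl
  | cons l L ih => simp [allEdges, ih]

theorem allEdges_append (L L' : List Link) : allEdges (L ++ L') = allEdges L ++ allEdges L' := by
  simp [allEdges_eq_flatMap]

theorem allEdges_perm {L L' : List Link} (h : L.Perm L') : (allEdges L).Perm (allEdges L') := by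
  simpa only [allEdges_eq_flatMap] using h.flatMap_right _

mutual
theorem Link.deepConcls_eq (l : Link) (b : Option Edge) :
    l.deepConcls = (l.flat b).flatMap fun x => x.2.concls := by
  cases l with
  | box e ds C => simp [Link.deepConcls, Link.flat, Link.concls, allEdges_eq_flatten C (some e)]
  | _ => simp [Link.deepConcls, Link.flat, Link.concls]

theorem allEdges_eq_flatten (L : List Link) (b : Option Edge) :
    allEdges L = (flatten L b).flatMap fun x => x.2.concls := by
  cases L with
  | nil => rfl
  | cons l L => simp [allEdges, flatten, Link.deepConcls_eq l b, allEdges_eq_flatten L b]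
end

theorem Link.shell_mem_flat (l : Link) (b : Option Edge) : (b, l.shell) ∈ l.flat b := by
  cases l <;> simp [Link.flat, Link.shell]

theorem mem_flat_box {e : Edge} {ds : List (Edge × Edge)} {C : List Link} {b : Option Edge}
    {x : Option Edge × Link} :
    x ∈ (Link.box e ds C).flat b ↔ x = (b, .box e ds []) ∨ x ∈ flatten C (some e) := by
  simp [Link.flat]

mutual
/-- Every located link of a link occurring in `R` occurs in `R`. -/
theorem Link.linkAt_of_mem_flat {R : List Link} (l : Link) {b : Option Edge} (hl : LinkAt R b l)
    {x : Option Edge × Link} (hx : x ∈ l.flat b) : ∃ l', LinkAt R x.1 l' ∧ x.2 = l'.shell := by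
  cases l with
  | box e ds C =>
    rcases mem_flat_box.1 hx with rfl | hx
    · exact ⟨_, hl, rfl⟩
    · exact linkAt_of_mem_flatten C (fun l' h' => .inside hl h') hx
  | _ =>
    simp only [Link.flat, List.mem_singleton] at hx
    subst hx
    exact ⟨_, hl, rfl⟩

theorem linkAt_of_mem_flatten {R : List Link} (L : List Link) {b : Option Edge}
    (hL : ∀ l ∈ L, LinkAt R b l) {x : Option Edge × Link} (hx : x ∈ flatten L b) :
    ∃ l', LinkAt R x.1 l' ∧ x.2 = l'.shell := by
  cases L with
  | nil => simp [flatten] at hx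
  | cons l L =>
    simp only [flatten, List.mem_append] at hx
    rcases hx with hx | hx
    · exact Link.linkAt_of_mem_flat l (hL l (by simp)) hx
    · exact linkAt_of_mem_flatten L (fun l' h' => hL l' (by simp [h'])) hx
end

theorem Link.flat_trans {R : List Link} {b : Option Edge} {l : Link} (hl : LinkAt R b l)
    {x : Option Edge × Link} (hx : x ∈ l.flat b) : x ∈ flatten R none := by
  induction hl generalizing x with
  | top h => rw [flatten_eq_flatMap]; exact List.mem_flatMap.2 ⟨_, h, hx⟩
  | inside _ h ih =>
    refine ih (mem_flat_box.2 (.inr ?_))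
    rw [flatten_eq_flatMap]; exact List.mem_flatMap.2 ⟨_, h, hx⟩

/-- The flat list knows a link only up to its shell: the content of a box is listed separately, with
the lock as its location. -/
theorem linkAt_iff {R : List Link} {b : Option Edge} {l : Link} :
    (b, l) ∈ flatten R none ↔ ∃ l', LinkAt R b l' ∧ l = l'.shell := by
  constructor
  · intro h
    exact linkAt_of_mem_flatten R (fun l h => .top h) h
  · rintro ⟨l', h, rfl⟩
    exact Link.flat_trans h (l'.shell_mem_flat b)

/-- The edges whose target is at a link: its premisses, or the conclusions of its content. -/
def Link.targets : Link → List Edge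
  | .box _ ds _ => ds.map Prod.fst
  | l => l.prems

/-- The located links `Λ` form a typed graph with distinct edges and with pending edges `Γ`. -/
structure Flat (Λ : List (Option Edge × Link)) (Γ : List Edge) : Prop where
  typed : ∀ x ∈ Λ, x.2.Typed
  edges : ((Λ.flatMap fun x => x.2.targets) ++ Γ).Perm (Λ.flatMap fun x => x.2.concls)
  nodup : (Λ.flatMap fun x => x.2.concls).Nodup
  located : ∀ x ∈ Λ, ∀ e, x.1 = some e → ∃ b ds, (b, .box e ds []) ∈ Λ

theorem Link.typed_shell {l : Link} : l.shell.Typed ↔ l.Typed := by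
  cases l <;> rfl

/-- In the flat view a box consumes its inner doors, and these are exactly the pending edges of its
content; the balance between targets and conclusions thus extends from depth 0 to all depths. -/
theorem WellFormed.flat_edges {L : List Link} {Γ : List Edge} (h : WellFormed L Γ)
    (b : Option Edge) :
    (((flatten L b).flatMap fun x => x.2.targets) ++ Γ).Perm (allEdges L) := by
  induction h generalizing b with
  | mk L Γ typed edges boxes ih =>
    -- Going from depth 0 to all depths adds the same multiset `I`, the edges inside the boxes, to
    -- the targets and to the conclusions. `M` ranges over lists of links of `L`, so that an
    -- induction on `M` can still use the hypothesis on the boxes of `L`.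
    have key : ∀ M : List Link, (∀ l ∈ M, l ∈ L) → ∃ I : List Edge,
        ((flatten M b).flatMap fun x => x.2.targets).Perm (M.flatMap Link.prems ++ I) ∧
        (allEdges M).Perm (M.flatMap Link.concls ++ I) := by
      intro M
      induction M with
      | nil => intro _; exact ⟨[], by simp [flatten], by simp [allEdges]⟩
      | cons l M ihM =>
        intro hM
        obtain ⟨I, h1, h2⟩ := ihM fun l' h' => hM l' (by simp [h'])
        have : ∃ J : List Edge, ((l.flat b).flatMap fun x => x.2.targets).Perm (l.prems ++ J) ∧
            (l.deepConcls).Perm (l.concls ++ J) := by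
          cases l with
          | box e ds C =>
            refine ⟨allEdges C, ?_, ?_⟩
            · have := ih e ds C (hM _ (by simp)) (some e)
              simpa [Link.flat, Link.targets, Link.prems] using List.perm_append_comm.trans this
            · simp [Link.deepConcls, Link.concls]
          | _ => exact ⟨[], by simp [Link.flat, Link.targets], by simp [Link.deepConcls, Link.concls]⟩
        obtain ⟨J, h3, h4⟩ := this
        refine ⟨J ++ I, ?_, ?_⟩
        · simp only [flatten, List.flatMap_append, List.flatMap_cons]
          refine (h3.append h1).trans ?_
          rw [List.perm_iff_count]; intro x; simp only [List.count_append]; omega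
        · simp only [allEdges, List.flatMap_cons]
          refine (h4.append h2).trans ?_
          rw [List.perm_iff_count]; intro x; simp only [List.count_append]; omega
    obtain ⟨I, h1, h2⟩ := key L fun _ h => h
    refine (h1.append_right Γ).trans (.trans ?_ h2.symm)
    have := edges
    rw [List.perm_iff_count] at this ⊢
    intro x; have := this x; simp only [List.count_append] at *; omega

theorem WellFormed.flat_typed {L : List Link} {Γ : List Edge} (h : WellFormed L Γ)
    {b : Option Edge} {l : Link} (hl : LinkAt L b l) : l.Typed ∧
      ∀ e ds C, l = .box e ds C → WellFormed C (ds.map Prod.fst) := by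
  induction hl with
  | top hl =>
    obtain ⟨_, _, typed, edges, boxes⟩ := h
    exact ⟨typed _ hl, fun e ds C he => boxes e ds C (he ▸ hl)⟩
  | inside _ hC ih =>
    obtain ⟨_, _, typed, edges, boxes⟩ := ih.2 _ _ _ rfl
    exact ⟨typed _ hC, fun e ds C he => boxes e ds C (he ▸ hC)⟩

theorem IsStructure.flat {L : List Link} {Γ : List Edge} (h : IsStructure L Γ) :
    Flat (flatten L none) Γ where
  typed := by
    rintro ⟨b, l⟩ hx
    obtain ⟨l', hl, rfl⟩ := linkAt_iff.1 hx
    exact Link.typed_shell.2 (h.1.flat_typed hl).1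
  edges := by rw [← allEdges_eq_flatten]; exact h.1.flat_edges none
  nodup := by rw [← allEdges_eq_flatten]; exact h.2
  located := by
    rintro ⟨b, l⟩ hx e (rfl : b = _)
    obtain ⟨l', hl, rfl⟩ := linkAt_iff.1 hx
    cases hl with
    | inside hb hl => exact ⟨_, _, linkAt_iff.2 ⟨_, hb, rfl⟩⟩

theorem Flat.targets_nodup {Λ : List (Option Edge × Link)} {Γ : List Edge} (h : Flat Λ Γ) :
    ((Λ.flatMap fun x => x.2.targets) ++ Γ).Nodup := h.edges.nodup_iff.2 h.nodup

theorem eq_of_mem_flatMap {α β : Type*} {L : List α} {f : α → List β} (h : (L.flatMap f).Nodup)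
    {x y : α} {z : β} (hx : x ∈ L) (hy : y ∈ L) (hzx : z ∈ f x) (hzy : z ∈ f y) : x = y := by
  by_contra hne
  -- Symmetry of disjointness makes the order of `x` and `y` in the list irrelevant.
  have : Std.Symm (Function.onFun List.Disjoint f) := ⟨fun _ _ h => List.Disjoint.symm h⟩
  exact (List.Pairwise.forall (List.nodup_flatMap.1 h).2 hx hy hne) hzx hzy

theorem Flat.eq_of_concls {Λ : List (Option Edge × Link)} {Γ : List Edge} (h : Flat Λ Γ)
    {x y : Option Edge × Link} {e : Edge} (hx : x ∈ Λ) (hy : y ∈ Λ) (hex : e ∈ x.2.concls)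
    (hey : e ∈ y.2.concls) : x = y := eq_of_mem_flatMap h.nodup hx hy hex hey

theorem Flat.eq_of_targets {Λ : List (Option Edge × Link)} {Γ : List Edge} (h : Flat Λ Γ)
    {x y : Option Edge × Link} {e : Edge} (hx : x ∈ Λ) (hy : y ∈ Λ) (hex : e ∈ x.2.targets)
    (hey : e ∈ y.2.targets) : x = y :=
  eq_of_mem_flatMap (List.nodup_append.1 h.targets_nodup).1 hx hy hex hey

theorem Flat.not_target {Λ : List (Option Edge × Link)} {Γ : List Edge} (h : Flat Λ Γ)
    {x : Option Edge × Link} {e : Edge} (hx : x ∈ Λ) (hex : e ∈ x.2.targets) : e ∉ Γ := by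
  intro he
  exact (List.nodup_append.1 h.targets_nodup).2.2 e (List.mem_flatMap.2 ⟨x, hx, hex⟩) e he rfl

theorem Flat.exists_source {Λ : List (Option Edge × Link)} {Γ : List Edge} (h : Flat Λ Γ)
    {e : Edge} (he : e ∈ Γ ∨ ∃ x ∈ Λ, e ∈ x.2.targets) : ∃ x ∈ Λ, e ∈ x.2.concls := by
  have : e ∈ Λ.flatMap fun x => x.2.concls := by
    rw [← h.edges.mem_iff]
    simpa [or_comm] using he
  simpa using this

theorem Flat.nodup_concls {Λ : List (Option Edge × Link)} {Γ : List Edge} (h : Flat Λ Γ)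
    {x : Option Edge × Link} (hx : x ∈ Λ) : x.2.concls.Nodup :=
  (List.nodup_flatMap.1 h.nodup).1 x hx

theorem Flat.nodup_targets {Λ : List (Option Edge × Link)} {Γ : List Edge} (h : Flat Λ Γ)
    {x : Option Edge × Link} (hx : x ∈ Λ) : x.2.targets.Nodup :=
  (List.nodup_flatMap.1 (List.nodup_append.1 h.targets_nodup).1).1 x hx

/-! ### Polarities -/

theorem Formula.dual_dual (A : Formula) : A.dual.dual = A := by
  induction A <;> simp_all [Formula.dual]

theorem Formula.polarity_dual (A : Formula) (m : List Dir) :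
    A.dual.polarity m = (A.polarity m).map not := by
  induction A generalizing m with
  | tensor A B hA hB | par A B hA hB =>
    rcases m with _ | ⟨_ | _, m⟩ <;> simp [Formula.dual, Formula.polarity, hA, hB]
  | _ => rcases m with _ | ⟨_ | _, m⟩ <;> simp [Formula.dual, Formula.polarity]

theorem Formula.Positive.polarity {A : Formula} (h : A.Positive) {m : List Dir}
    (hm : A.polarity m ≠ none) : A.polarity m = some true := by
  induction A generalizing m with
  | tensor A B hA hB =>
    rcases m with _ | ⟨_ | _, m⟩
    · simp [Formula.polarity] at hm
    · exact hA h.1 hm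
    · exact hB h.2 hm
  | one => rcases m with _ | ⟨_ | _, m⟩ <;> simp_all [Formula.polarity]
  | _ => exact h.elim

theorem Formula.Negative.polarity {A : Formula} (h : A.Negative) {m : List Dir}
    (hm : A.polarity m ≠ none) : A.polarity m = some false := by
  induction A generalizing m with
  | par A B hA hB =>
    rcases m with _ | ⟨_ | _, m⟩
    · simp [Formula.polarity] at hm
    · exact hA h.1 hm
    · exact hB h.2 hm
  | bot => rcases m with _ | ⟨_ | _, m⟩ <;> simp_all [Formula.polarity]
  | _ => exact h.elim

theorem Formula.exists_polarity (A : Formula) : ∃ m, A.polarity m ≠ none := by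
  induction A with
  | tensor A B hA hB | par A B hA hB => obtain ⟨m, hm⟩ := hA; exact ⟨.l :: m, hm⟩
  | _ => exact ⟨[], by simp [Formula.polarity]⟩

theorem Formula.finite_polarity (A : Formula) : {m | A.polarity m ≠ none}.Finite := by
  induction A with
  | tensor A B hA hB | par A B hA hB =>
    refine ((hA.image (List.cons .l)).union (hB.image (List.cons .r))).subset ?_
    rintro (_ | ⟨_ | _, m⟩) hm
    · simp [Formula.polarity] at hm
    · exact .inl ⟨m, hm, rfl⟩
    · exact .inr ⟨m, hm, rfl⟩
  | _ =>
    refine (Set.finite_singleton ([] : List Dir)).subset ?_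
    rintro (_ | ⟨_ | _, m⟩) hm <;> simp_all [Formula.polarity]

/-! ### Ports and wires -/

/-- An end of a wire inside a link: the occurrences of atoms of addresses `path ++ m` in the type
of `edge`, which is a target of the link if `side = true`, and a conclusion otherwise. -/
structure Port : Type where
  edge : Edge
  side : Bool
  path : List Dir

/-- A position at a port. -/
def Port.pos (P : Port) (m : List Dir) : Pos := .atom P.edge (P.path ++ m)

/-- A token on the position `P.pos m` enters the link of the port `P`. -/
def Port.Enters (P : Port) (m : List Dir) : Prop :=
  P.edge.ty.polarity (P.path ++ m) = some P.side

/-- The wires of a link. -/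
def Link.wires : Link → List (Port × Port)
  | .ax e f => [(⟨e, false, []⟩, ⟨f, false, []⟩)]
  | .cut e f => [(⟨e, true, []⟩, ⟨f, true, []⟩)]
  | .tensor a b c => [(⟨a, true, []⟩, ⟨c, false, [.l]⟩), (⟨b, true, []⟩, ⟨c, false, [.r]⟩)]
  | .par a b c => [(⟨a, true, []⟩, ⟨c, false, [.l]⟩), (⟨b, true, []⟩, ⟨c, false, [.r]⟩)]
  | .one _ => []
  | .sync ps => ps.map fun p => (⟨p.1, true, []⟩, ⟨p.2, false, []⟩)
  | .box _ ds _ => ds.map fun p => (⟨p.1, true, []⟩, ⟨p.2, false, []⟩)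

/-- A wire of `l`, in either direction. -/
def Link.Wire (l : Link) (P Q : Port) : Prop := (P, Q) ∈ l.wires ∨ (Q, P) ∈ l.wires

theorem Link.Wire.symm {l : Link} {P Q : Port} (h : l.Wire P Q) : l.Wire Q P := Or.symm h

/-- The positions which have to be visited before tokens can cross a link. -/
def Link.guard (l : Link) : Set Pos :=
  match l with
  | .sync ps => {p | ∃ P Q m, (Link.sync ps).Wire P Q ∧ P.Enters m ∧ p = P.pos m}
  | .box e _ _ => {.lock e 0}
  | _ => ∅

/-- The movements of tokens at a link, with the positions which have to be visited before. -/
inductive LMv (l : Link) : Pos → Pos → Set Pos → Prop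
  | wire {P Q : Port} {m : List Dir} : l.Wire P Q → P.Enters m → LMv l (P.pos m) (Q.pos m) l.guard
  | lock {e : Edge} {ds : List (Edge × Edge)} {C : List Link} :
      l = .box e ds C → LMv l (.atom e []) (.lock e 0) ∅

theorem Link.Wire.mem {l : Link} {P Q : Port} (h : l.Wire P Q) :
    (P.side = true ∧ P.edge ∈ l.targets) ∨ (P.side = false ∧ P.edge ∈ l.concls) := by
  cases l <;> rcases h with h | h <;>
    simp only [Link.wires, Link.targets, Link.prems, Link.concls, List.mem_cons, List.mem_map,
      List.not_mem_nil, Prod.mk.injEq, or_false] at h ⊢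
  all_goals first
    | (rcases h with ⟨rfl, rfl⟩ | ⟨rfl, rfl⟩ <;> simp; done)
    | (rcases h with ⟨rfl, rfl⟩; simp)
    | (rcases h with ⟨p, hp, rfl, rfl⟩; simp; done)
    | (rcases h with ⟨p, hp, rfl, rfl⟩; simp; exact ⟨_, hp⟩)
    | (rcases h with ⟨p, hp, rfl, rfl⟩; simp; exact .inr ⟨_, hp⟩)

theorem Link.Wire.mem_targets {l : Link} {P Q : Port} (h : l.Wire P Q) (hs : P.side = true) :
    P.edge ∈ l.targets := by
  rcases h.mem with h | h
  · exact h.2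
  · simp [hs] at h

theorem Link.Wire.mem_concls {l : Link} {P Q : Port} (h : l.Wire P Q) (hs : P.side = false) :
    P.edge ∈ l.concls := by
  rcases h.mem with h | h
  · simp [hs] at h
  · exact h.2

/-- An axiom or a cut joins dual occurrences on the same side of the link; every other wire joins
equal polarities on opposite sides. Either way, the polarity on arrival is the one of a token going
away from the link. -/
theorem Link.Wire.exits {l : Link} {P Q : Port} {m : List Dir} (h : l.Wire P Q) (ht : l.Typed)
    (hm : P.Enters m) : Q.edge.ty.polarity (Q.path ++ m) = some (!Q.side) := by
  cases l <;> rcases h with h | h <;>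
    simp only [Link.wires, List.mem_cons, List.mem_map,
      List.not_mem_nil, Prod.mk.injEq, or_false] at h
  all_goals first
    | (rcases h with ⟨rfl, rfl⟩
       simp only [Link.Typed] at ht
       simp only [Port.Enters, ht, Formula.polarity_dual, List.nil_append] at hm ⊢
       simp only [hm, Option.map_some])
    | (rcases h with ⟨rfl, rfl⟩
       simp only [Link.Typed] at ht
       simp only [Port.Enters, ht, Formula.polarity_dual, List.nil_append] at hm ⊢
       simpa using hm)
    | (rcases h with ⟨rfl, rfl⟩ | ⟨rfl, rfl⟩ <;> simp only [Link.Typed] at ht <;>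
       simp_all [Port.Enters, Formula.polarity]; done)
    | (rcases h with ⟨p, hp, rfl, rfl⟩; have := (ht.2 p hp); simp_all [Port.Enters])

/-- A wire determined by a pair of corresponding edges. -/
theorem pair_wire_unique {ds : List (Edge × Edge)} (h1 : (ds.map Prod.fst).Nodup)
    (h2 : (ds.map Prod.snd).Nodup) {p q : Edge × Edge} (hp : p ∈ ds) (hq : q ∈ ds)
    (h : p.1 = q.1 ∨ p.2 = q.2) : p = q := by
  rcases h with h | h
  · exact List.inj_on_of_nodup_map h1 hp hq h
  · exact List.inj_on_of_nodup_map h2 hp hq h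

theorem pairs_wire_unique {ds : List (Edge × Edge)} (h1 : (ds.map Prod.fst).Nodup)
    (h2 : (ds.map Prod.snd).Nodup) {l : Link}
    (hl : l.wires = ds.map fun p => (⟨p.1, true, []⟩, ⟨p.2, false, []⟩))
    {P Q P' Q' : Port} {m m' : List Dir} (h : l.Wire P Q) (h' : l.Wire P' Q')
    (hs : P.side = P'.side) (hp : P.pos m = P'.pos m') : P = P' ∧ Q = Q' ∧ m = m' := by
  simp only [Link.Wire, hl, List.mem_map, Prod.mk.injEq] at h h'
  rcases h with ⟨p, hp1, rfl, rfl⟩ | ⟨p, hp1, rfl, rfl⟩ <;>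
    rcases h' with ⟨q, hq1, rfl, rfl⟩ | ⟨q, hq1, rfl, rfl⟩ <;>
    simp only [Port.pos, Pos.atom.injEq, List.nil_append, reduceCtorEq] at hp hs
  · obtain rfl := pair_wire_unique h1 h2 hp1 hq1 (.inl hp.1)
    exact ⟨rfl, rfl, hp.2⟩
  · obtain rfl := pair_wire_unique h1 h2 hp1 hq1 (.inr hp.1)
    exact ⟨rfl, rfl, hp.2⟩

theorem mult_wire_unique {a b c : Edge} (hab : a ≠ b) {l : Link}
    (hl : l.wires = [(⟨a, true, []⟩, ⟨c, false, [.l]⟩), (⟨b, true, []⟩, ⟨c, false, [.r]⟩)])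
    {P Q P' Q' : Port} {m m' : List Dir} (h : l.Wire P Q) (h' : l.Wire P' Q')
    (hs : P.side = P'.side) (hp : P.pos m = P'.pos m') : P = P' ∧ Q = Q' ∧ m = m' := by
  simp only [Link.Wire, hl, List.mem_cons, List.not_mem_nil, or_false, Prod.mk.injEq] at h h'
  rcases h with (⟨rfl, rfl⟩ | ⟨rfl, rfl⟩) | (⟨rfl, rfl⟩ | ⟨rfl, rfl⟩) <;>
    rcases h' with (⟨rfl, rfl⟩ | ⟨rfl, rfl⟩) | (⟨rfl, rfl⟩ | ⟨rfl, rfl⟩) <;>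
    simp_all [Port.pos]

/-- The side must be given: typing and distinctness of the edges do not forbid that an edge is both
a target and a conclusion of one link. -/
theorem Link.wire_unique {l : Link} (hc : l.concls.Nodup) (ht : l.targets.Nodup)
    {P Q P' Q' : Port} {m m' : List Dir} (h : l.Wire P Q) (h' : l.Wire P' Q')
    (hs : P.side = P'.side) (hp : P.pos m = P'.pos m') : P = P' ∧ Q = Q' ∧ m = m' := by
  cases l with
  | ax e f =>
    simp only [Link.Wire, Link.wires, List.mem_cons, List.not_mem_nil, or_false,
      Prod.mk.injEq] at h h'
    rcases h with ⟨rfl, rfl⟩ | ⟨rfl, rfl⟩ <;> rcases h' with ⟨rfl, rfl⟩ | ⟨rfl, rfl⟩ <;>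
      simp_all [Port.pos, Link.concls]
  | cut e f =>
    simp only [Link.Wire, Link.wires, List.mem_cons, List.not_mem_nil, or_false,
      Prod.mk.injEq] at h h'
    rcases h with ⟨rfl, rfl⟩ | ⟨rfl, rfl⟩ <;> rcases h' with ⟨rfl, rfl⟩ | ⟨rfl, rfl⟩ <;>
      simp_all [Port.pos, Link.targets, Link.prems]
  | tensor a b c =>
    exact mult_wire_unique (by simpa [Link.targets, Link.prems] using ht) rfl h h' hs hp
  | par a b c =>
    exact mult_wire_unique (by simpa [Link.targets, Link.prems] using ht) rfl h h' hs hp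
  | one e => simp [Link.Wire, Link.wires] at h
  | sync ps => exact pairs_wire_unique ht hc rfl h h' hs hp
  | box e ds C => exact pairs_wire_unique ht (List.nodup_cons.1 hc).2 rfl h h' hs hp

end SMLL

namespace SMLL
open Relation

/-! ### Systems of movements -/

/-- Generation of tokens and movements of tokens, with the positions which have to be visited
before. -/
structure Sys : Type where
  Gen : Pos → Set Pos → Prop
  Mv : Pos → Pos → Set Pos → Prop

namespace Sys

/-- `Y.Vis s p`: the token of origin `s` visits the position `p`. -/
inductive Vis (Y : Sys) : Pos → Pos → Prop
  | gen_aux {p : Pos} {G : Set Pos} (o : Pos → Pos) :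
      Y.Gen p G → (∀ g ∈ G, Vis Y (o g) g) → Vis Y p p
  | mv_aux {s p q : Pos} {G : Set Pos} (o : Pos → Pos) :
      Vis Y s p → Y.Mv p q G → (∀ g ∈ G, Vis Y (o g) g) → Vis Y s q

/-- The position `p` is visited by a token. -/
def V (Y : Sys) (p : Pos) : Prop := ∃ s, Y.Vis s p

/-- A movement from `p` to `q`, regardless of its guard. -/
def Nx (Y : Sys) (p q : Pos) : Prop := ∃ G, Y.Mv p q G

/-- Movements are deterministic in both directions, and origins have no predecessor. -/
structure Det (Y : Sys) : Prop where
  func : ∀ {p q q' G G'}, Y.Mv p q G → Y.Mv p q' G' → q = q'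
  inj : ∀ {p p' q G G'}, Y.Mv p q G → Y.Mv p' q G' → p = p'
  orig : ∀ {p p' G G'}, Y.Gen p G → ¬ Y.Mv p' p G'

variable {Y : Sys}

/-- The constructors of `Vis` name, through the function `o`, a token for each guard position, which
avoids an existential around the recursive occurrence. This lemma, `Vis.mv` and `Vis.induct` hide
`o` behind `V`. -/
theorem Vis.gen {p : Pos} {G : Set Pos} (h : Y.Gen p G) (hG : ∀ g ∈ G, Y.V g) : Y.Vis p p := by
  classical
  exact .gen_aux (fun g => if hg : g ∈ G then (hG g hg).choose else g) h
    fun g hg => by simpa [hg] using (hG g hg).choose_spec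

theorem Vis.mv {s p q : Pos} {G : Set Pos} (hp : Y.Vis s p) (h : Y.Mv p q G)
    (hG : ∀ g ∈ G, Y.V g) : Y.Vis s q := by
  classical
  exact .mv_aux (fun g => if hg : g ∈ G then (hG g hg).choose else g) hp h
    fun g hg => by simpa [hg] using (hG g hg).choose_spec

@[elab_as_elim, induction_eliminator]
theorem Vis.induct {C : ∀ s p, Y.Vis s p → Prop}
    (gen : ∀ p G (h : Y.Gen p G) (hG : ∀ g ∈ G, Y.V g), (∀ g ∈ G, ∃ s, ∃ h : Y.Vis s g, C s g h) →
      C p p (.gen h hG))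
    (mv : ∀ s p q G (hp : Y.Vis s p) (h : Y.Mv p q G) (hG : ∀ g ∈ G, Y.V g), C s p hp →
      (∀ g ∈ G, ∃ s, ∃ h : Y.Vis s g, C s g h) → C s q (.mv hp h hG))
    {s p : Pos} (h : Y.Vis s p) : C s p h := by
  induction h with
  | gen_aux o h hG ih => exact gen _ _ h (fun g hg => ⟨_, hG g hg⟩) fun g hg => ⟨_, hG g hg, ih g hg⟩
  | mv_aux o hp h hG ihp ih =>
    exact mv _ _ _ _ hp h (fun g hg => ⟨_, hG g hg⟩) ihp fun g hg => ⟨_, hG g hg, ih g hg⟩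

theorem Vis.exists_gen {s p : Pos} (h : Y.Vis s p) : ∃ G, Y.Gen s G ∧ ∀ g ∈ G, Y.V g := by
  induction h with
  | gen p G h hG _ => exact ⟨G, h, hG⟩
  | mv s p q G hp h hG ih _ => exact ih

theorem Vis.origin {s p : Pos} (h : Y.Vis s p) : Y.Vis s s := by
  obtain ⟨G, h, hG⟩ := h.exists_gen
  exact .gen h hG

theorem Vis.path {s p : Pos} (h : Y.Vis s p) : ReflTransGen Y.Nx s p := by
  induction h with
  | gen p G h hG _ => exact .refl
  | mv s p q G hp h hG ih _ => exact ih.tail ⟨G, h⟩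

theorem Vis.cases_on_last {s q : Pos} (h : Y.Vis s q) :
    (s = q ∧ ∃ G, Y.Gen q G) ∨ ∃ p G, Y.Vis s p ∧ Y.Mv p q G ∧ ∀ g ∈ G, Y.V g := by
  cases h with
  | gen_aux o h hG => exact .inl ⟨rfl, _, h⟩
  | mv_aux o hp h hG => exact .inr ⟨_, _, hp, h, fun g hg => ⟨_, hG g hg⟩⟩

namespace Det
variable (hY : Y.Det)
include hY

/-- The point `q` is not an origin, as it has a predecessor, and its only predecessor is `p`; so the
last step of the token came from `p`. -/
theorem back {s p q : Pos} (h : Y.Vis s q) (hpq : Y.Nx p q) : Y.Vis s p := by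
  obtain ⟨G, hpq⟩ := hpq
  rcases h.cases_on_last with ⟨rfl, G', hg⟩ | ⟨p', G', hp, h, -⟩
  · exact (hY.orig hg hpq).elim
  · rwa [hY.inj hpq h]

theorem back_path {s p q : Pos} (h : Y.Vis s q) (hpq : ReflTransGen Y.Nx p q) : Y.Vis s p := by
  induction hpq with
  | refl => exact h
  | tail _ hbc ih => exact ih (hY.back h hbc)

theorem origin_eq {s p : Pos} {G : Set Pos} (h : Y.Vis s p) (hp : Y.Gen p G) : s = p := by
  rcases h.cases_on_last with ⟨rfl, -⟩ | ⟨p', G', -, h, -⟩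
  · rfl
  · exact (hY.orig hp h).elim

/-- Both tokens are followed backwards along the same positions until an origin is met. -/
theorem unique {s s' p : Pos} (h : Y.Vis s p) (h' : Y.Vis s' p) : s = s' := by
  induction h with
  | gen p G h hG _ => exact (hY.origin_eq h' h).symm
  | mv s p q G hp h hG ih _ => exact ih (hY.back h' ⟨G, h⟩)

/-- A cycle through a visited position also contains its predecessor, hence is carried back along
the trajectory to the origin, which has no predecessor. -/
theorem acyclic {s p : Pos} (h : Y.Vis s p) : ¬ TransGen Y.Nx p p := by
  induction h with
  | gen p G h hG _ =>
    intro hc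
    obtain ⟨q, -, G', hq⟩ := TransGen.tail'_iff.1 hc
    exact hY.orig h hq
  | mv s p q G hp h hG ih _ =>
    intro hc
    obtain ⟨p', hp', G', hq⟩ := TransGen.tail'_iff.1 hc
    obtain rfl := hY.inj h hq
    exact ih (TransGen.head' ⟨_, h⟩ hp')

theorem fwd {p q r : Pos} (h : ReflTransGen Y.Nx p r) (hne : p ≠ r) (hpq : Y.Nx p q) :
    ReflTransGen Y.Nx q r := by
  rcases h.cases_head with rfl | ⟨q', ⟨G, hq'⟩, h⟩
  · exact (hne rfl).elim
  · obtain ⟨G', hpq⟩ := hpq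
    rwa [hY.func hpq hq']

theorem path_to {x p q : Pos} (h : ReflTransGen Y.Nx x q) (hpq : Y.Nx p q) :
    x = q ∨ ReflTransGen Y.Nx x p := by
  rcases h.cases_tail with rfl | ⟨p', h, G, hp'⟩
  · exact .inl rfl
  · obtain ⟨G', hpq⟩ := hpq
    rw [hY.inj hpq hp']
    exact .inr h

end Det
end Sys

/-! ### The system of a structure -/

/-- The positions which have to be visited before the links at depth 0 in the box `b` are active. -/
def boxGuard (b : Option Edge) : Set Pos := {x | ∃ e, b = some e ∧ x = .lock e 0}

/-- The system of the located links `Λ` with pending edges `Γ`. -/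
def sys (Λ : List (Option Edge × Link)) (Γ : List Edge) : Sys where
  Gen p G := (IsInit Γ p ∧ G = ∅) ∨
    ∃ b e, (b, Link.one e) ∈ Λ ∧ p = .atom e [] ∧ G = boxGuard b
  Mv p q G := ∃ b l, (b, l) ∈ Λ ∧ LMv l p q G

section Flat
variable {Λ : List (Option Edge × Link)} {Γ : List Edge} (hF : Flat Λ Γ)
include hF

theorem Flat.port_unique {x y : Option Edge × Link} (hx : x ∈ Λ) (hy : y ∈ Λ) {P Q P' Q' : Port}
    {m m' : List Dir} (h : x.2.Wire P Q) (h' : y.2.Wire P' Q') (hs : P.side = P'.side)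
    (hp : P.pos m = P'.pos m') : x = y ∧ P = P' ∧ Q = Q' ∧ m = m' := by
  have he : P.edge = P'.edge := by
    simp only [Port.pos, Pos.atom.injEq] at hp; exact hp.1
  have hxy : x = y := by
    cases hb : P.side with
    | true => exact hF.eq_of_targets hx hy (h.mem_targets hb) (he ▸ h'.mem_targets (hs ▸ hb))
    | false => exact hF.eq_of_concls hx hy (h.mem_concls hb) (he ▸ h'.mem_concls (hs ▸ hb))
  subst hxy
  exact ⟨rfl, Link.wire_unique (hF.nodup_concls hx) (hF.nodup_targets hx) h h' hs hp⟩

theorem Flat.mv_func {x y : Option Edge × Link} (hx : x ∈ Λ) (hy : y ∈ Λ) {p q q' : Pos}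
    {G G' : Set Pos} (h : LMv x.2 p q G) (h' : LMv y.2 p q' G') : q = q' ∧ x = y := by
  -- A wire never starts at a lock: a lock has type `⊥`, so a token entering there does so from the
  -- side of the conclusions, which forces the link to be the box itself; but the wires of a box end
  -- at its doors, which differ from its lock.
  have aux : ∀ {x y : Option Edge × Link} (_ : x ∈ Λ) (_ : y ∈ Λ) {P Q : Port} {m : List Dir}
      {e : Edge} {ds C} (_ : x.2.Wire P Q) (_ : P.Enters m) (_ : y.2 = .box e ds C)
      (_ : P.pos m = .atom e []), False := by
    intro x y hx hy P Q m e ds C h hm hb hp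
    have ht := hF.typed y hy
    simp only [hb, Link.Typed] at ht
    simp only [Port.pos, Pos.atom.injEq, List.append_eq_nil_iff] at hp
    obtain ⟨he, hp, rfl⟩ := hp
    simp only [Port.Enters, he, hp, ht.1, Formula.polarity, List.append_nil, Option.some.injEq] at hm
    have hc := h.mem_concls hm.symm
    obtain rfl := hF.eq_of_concls hx hy hc (by simp [hb, Link.concls, he])
    have hn := hF.nodup_concls hx
    simp only [hb, Link.concls, List.nodup_cons, List.mem_map] at hn
    apply hn.1
    rw [hb] at h
    simp only [Link.Wire, Link.wires, List.mem_map, Prod.mk.injEq] at h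
    rcases h with ⟨p, hp', rfl, rfl⟩ | ⟨p, hp', rfl, rfl⟩
    · simp at hm
    · exact ⟨p, hp', he⟩
  generalize hp : p = p' at h'
  cases h with
  | @wire P Q m h hm =>
    cases h' with
    | @wire P' Q' m' h' hm' =>
      have hs : P.side = P'.side := by
        simp only [Port.pos, Pos.atom.injEq] at hp
        simp only [Port.Enters, hp.1, hp.2] at hm hm'
        simpa [hm] using hm'
      obtain ⟨h1, rfl, rfl, rfl⟩ := hF.port_unique hx hy h h' hs hp
      exact ⟨rfl, h1⟩
    | lock hb => exact (aux hx hy h hm hb hp).elim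
  | lock hb =>
    cases h' with
    | wire h' hm' => exact (aux hy hx h' hm' hb hp.symm).elim
    | lock hb' =>
      cases hp
      exact ⟨rfl, hF.eq_of_concls hx hy (e := _) (by rw [hb]; exact .head _)
        (by rw [hb']; exact .head _)⟩

/-- The polarity at the point of arrival tells on which side of the link the token leaves, so the
wire, read backwards, is determined. -/
theorem Flat.mv_inj {x y : Option Edge × Link} (hx : x ∈ Λ) (hy : y ∈ Λ) {p p' q : Pos}
    {G G' : Set Pos} (h : LMv x.2 p q G) (h' : LMv y.2 p' q G') : p = p' ∧ x = y := by
  generalize hq : q = q' at h'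
  cases h with
  | @wire P Q m h hm =>
    cases h' with
    | @wire P' Q' m' h' hm' =>
      have hs : Q.side = Q'.side := by
        have h1 := h.exits (hF.typed x hx) hm
        have h2 := h'.exits (hF.typed y hy) hm'
        simp only [Port.pos, Pos.atom.injEq] at hq
        simp only [hq.1, hq.2] at h1 h2
        simpa [h1] using h2
      obtain ⟨h1, rfl, rfl, rfl⟩ := hF.port_unique hx hy h.symm h'.symm hs hq
      exact ⟨rfl, h1⟩
    | lock hb => simp [Port.pos] at hq
  | lock hb =>
    cases h' with
    | wire h' hm' => simp [Port.pos] at hq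
    | lock hb' =>
      cases hq
      exact ⟨rfl, hF.eq_of_concls hx hy (e := _) (by rw [hb]; exact .head _)
        (by rw [hb']; exact .head _)⟩

theorem Flat.det : (sys Λ Γ).Det where
  func := by
    rintro p q q' G G' ⟨b, l, hl, h⟩ ⟨b', l', hl', h'⟩
    exact (hF.mv_func hl hl' h h').1
  inj := by
    rintro p q q' G G' ⟨b, l, hl, h⟩ ⟨b', l', hl', h'⟩
    exact (hF.mv_inj hl hl' h h').1
  -- An initial position is a negative occurrence in a pending edge; to arrive there a token would
  -- have to leave a link through a target. The conclusion of a `one` link is positive, so it could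
  -- only be reached through that very link, which has no wires.
  orig := by
    rintro p p' G G' hg ⟨b', l', hl', h'⟩
    cases h' with
    | lock hb =>
      rcases hg with ⟨⟨e, -, m, -, h⟩, -⟩ | ⟨b, e, -, h, -⟩ <;> cases h
    | wire h hm =>
      have h1 := h.exits (hF.typed _ hl') hm
      rcases hg with ⟨⟨e, he, m, hpm, hp⟩, -⟩ | ⟨b, e, hl, hp, -⟩
      · simp only [Port.pos, Pos.atom.injEq] at hp
        obtain ⟨rfl, rfl⟩ := hp
        rw [hpm] at h1
        have := h.symm.mem_targets (by simpa using h1)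
        exact hF.not_target hl' this he
      · simp only [Port.pos, Pos.atom.injEq] at hp
        obtain ⟨rfl, hp⟩ := hp
        have ht : _ = Formula.one := hF.typed _ hl
        rw [hp, ht] at h1
        have := h.symm.mem_concls (by simpa [Formula.polarity] using h1)
        have := hF.eq_of_concls hl hl' (by exact .head _) this
        cases this
        simp [Link.Wire, Link.wires] at h

theorem Flat.valid_atom {s : Pos} {e : Edge} {m : List Dir} (h : (sys Λ Γ).Vis s (.atom e m)) :
    e.ty.polarity m ≠ none ∧ ∃ x ∈ Λ, e ∈ x.2.concls := by
  rcases h.cases_on_last with ⟨rfl, G, ⟨⟨e, he, m, hpm, hp⟩, -⟩ | ⟨b, e, hl, hp, -⟩⟩ |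
    ⟨p, G, -, ⟨b, l, hl, hw⟩, -⟩
  · cases hp
    exact ⟨by simp [hpm], hF.exists_source (.inl he)⟩
  · cases hp
    have ht : _ = Formula.one := hF.typed _ hl
    exact ⟨by simp [ht, Formula.polarity], _, hl, .head _⟩
  · generalize hq : Pos.atom e m = q at hw
    cases hw with
    | lock => cases hq
    | wire hw hm =>
      simp only [Port.pos, Pos.atom.injEq] at hq
      obtain ⟨rfl, rfl⟩ := hq
      refine ⟨by simp [hw.exits (hF.typed _ hl) hm], ?_⟩
      rcases hw.symm.mem with h | h
      · exact hF.exists_source (.inr ⟨_, hl, h.2⟩)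
      · exact ⟨_, hl, h.2⟩

omit hF in
theorem valid_lock {s : Pos} {e : Edge} {i : ℕ} (h : (sys Λ Γ).Vis s (.lock e i)) :
    i = 0 ∧ ∃ b ds C, (b, .box e ds C) ∈ Λ := by
  rcases h.cases_on_last with ⟨rfl, G, ⟨⟨e, he, m, hpm, hp⟩, -⟩ | ⟨b, e, hl, hp, -⟩⟩ |
    ⟨p, G, -, ⟨b, l, hl, h⟩, -⟩
  · cases hp
  · cases hp
  · generalize hq : Pos.lock e i = q at h
    cases h with
    | lock hb => cases hq; exact ⟨rfl, b, _, _, hb ▸ hl⟩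
    | wire h hm => simp [Port.pos] at hq

/-- There are finitely many edges and addresses, and of the positions `(e, i)` of a lock only `i =
0` is ever reached. This bounds the length of runs. -/
theorem Flat.finite_visited : {p | (sys Λ Γ).V p}.Finite := by
  have : {p | (sys Λ Γ).V p} ⊆ ⋃ e ∈ (Λ.flatMap fun x => x.2.concls).toFinset,
      (Pos.atom e '' {m | e.ty.polarity m ≠ none} ∪ {.lock e 0}) := by
    rintro (⟨e, m⟩ | ⟨e, i⟩) ⟨s, h⟩
    · obtain ⟨hm, x, hx, he⟩ := hF.valid_atom h
      simp only [Set.mem_iUnion]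
      exact ⟨e, by simpa using ⟨_, _, hx, he⟩, .inl ⟨m, hm, rfl⟩⟩
    · obtain ⟨rfl, b, ds, C, hl⟩ := valid_lock h
      simp only [Set.mem_iUnion]
      exact ⟨e, by simpa using ⟨_, _, hl, .head _⟩, .inr rfl⟩
  refine Set.Finite.subset ?_ this
  exact Set.Finite.biUnion (Finset.finite_toSet _) fun e _ =>
    (e.ty.finite_polarity.image _).union (Set.finite_singleton _)

theorem Flat.fin_stuck {p q : Pos} {G : Set Pos} (hp : IsFin Γ p) : ¬ (sys Λ Γ).Mv p q G := by
  rintro ⟨b, l, hl, h⟩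
  obtain ⟨e, he, m, hpm, rfl⟩ := hp
  generalize hq : Pos.atom e m = q at h
  cases h with
  | lock hb =>
    cases hq
    have ht := hF.typed _ hl
    simp only [hb, Link.Typed] at ht
    simp [ht.1, Formula.polarity] at hpm
  | wire h hm =>
    simp only [Port.pos, Pos.atom.injEq] at hq
    obtain ⟨rfl, rfl⟩ := hq
    rw [Port.Enters, hpm] at hm
    exact hF.not_target hl (h.mem_targets (by simpa using hm.symm)) he

omit hF in
theorem lock_stuck {q : Pos} {G : Set Pos} {e : Edge} {i : ℕ} :
    ¬ (sys Λ Γ).Mv (.lock e i) q G := by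
  rintro ⟨b, l, hl, h⟩
  generalize hq : Pos.lock e i = q at h
  cases h with
  | lock hb => cases hq
  | wire h hm => simp [Port.pos] at hq

end Flat
end SMLL

namespace SMLL
open Relation

/-! ### The machine and the visited positions -/

theorem IsLink.mem_flatten {R : List Link} {l : Link} (h : IsLink R l) :
    ∃ b, (b, l.shell) ∈ flatten R none := by
  obtain ⟨b, h⟩ := h
  exact ⟨b, linkAt_iff.2 ⟨l, h, rfl⟩⟩

theorem isLink_of_mem {R : List Link} {b : Option Edge} {l : Link}
    (h : (b, l) ∈ flatten R none) (hl : ∀ e ds C, l ≠ .box e ds C) : IsLink R l := by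
  obtain ⟨l', h', rfl⟩ := linkAt_iff.1 h
  cases l' with
  | box e ds C => exact absurd rfl (hl e ds [])
  | _ => exact ⟨b, h'⟩

theorem isLink_box_of_mem {R : List Link} {b : Option Edge} {e : Edge} {ds : List (Edge × Edge)}
    {C : List Link} (h : (b, .box e ds C) ∈ flatten R none) : ∃ C', IsLink R (.box e ds C') := by
  obtain ⟨l', h, hl⟩ := linkAt_iff.1 h
  cases l' <;> simp only [Link.shell, reduceCtorEq, Link.box.injEq] at hl
  obtain ⟨rfl, rfl, -⟩ := hl
  exact ⟨_, b, h⟩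

/-- With the converse `move_of_mv`: the single-token movements are those of `LMv` at all links but
the sync links, and their guards contain only locks. -/
theorem Move.exists_mv {R : List Link} {T : State} {p q : Pos} (h : Move R T p q) :
    ∃ b l, (b, l) ∈ flatten R none ∧ (∀ ps, l ≠ .sync ps) ∧
      ∃ G, LMv l p q G ∧ ∀ g ∈ G, ∃ e, g = .lock e 0 ∧ T.Unlocked e := by
  cases h with
  | @ax x e f m hx h hm =>
    obtain ⟨b, hb⟩ := hx.mem_flatten
    refine ⟨b, _, hb, by rcases h with rfl | rfl <;> simp [Link.shell], _,
      .wire (P := ⟨e, false, []⟩) (Q := ⟨f, false, []⟩) (m := m) ?_ hm, ?_⟩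
    · rcases h with rfl | rfl <;> simp [Link.shell, Link.Wire, Link.wires]
    · rcases h with rfl | rfl <;> simp [Link.shell, Link.guard]
  | @cut x e f m hx h hm =>
    obtain ⟨b, hb⟩ := hx.mem_flatten
    refine ⟨b, _, hb, by rcases h with rfl | rfl <;> simp [Link.shell], _,
      .wire (P := ⟨e, true, []⟩) (Q := ⟨f, true, []⟩) (m := m) ?_ hm, ?_⟩
    · rcases h with rfl | rfl <;> simp [Link.shell, Link.Wire, Link.wires]
    · rcases h with rfl | rfl <;> simp [Link.shell, Link.guard]
  | @mult_left_down x u v c m hx h hm =>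
    obtain ⟨b, hb⟩ := hx.mem_flatten
    refine ⟨b, _, hb, by rcases h with rfl | rfl <;> simp [Link.shell], _,
      .wire (P := ⟨u, true, []⟩) (Q := ⟨c, false, [.l]⟩) (m := m) ?_ hm, ?_⟩
    · rcases h with rfl | rfl <;> simp [Link.shell, Link.Wire, Link.wires]
    · rcases h with rfl | rfl <;> simp [Link.shell, Link.guard]
  | @mult_right_down x u v c m hx h hm =>
    obtain ⟨b, hb⟩ := hx.mem_flatten
    refine ⟨b, _, hb, by rcases h with rfl | rfl <;> simp [Link.shell], _,
      .wire (P := ⟨v, true, []⟩) (Q := ⟨c, false, [.r]⟩) (m := m) ?_ hm, ?_⟩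
    · rcases h with rfl | rfl <;> simp [Link.shell, Link.Wire, Link.wires]
    · rcases h with rfl | rfl <;> simp [Link.shell, Link.guard]
  | @mult_left_up x u v c m hx h hm =>
    obtain ⟨b, hb⟩ := hx.mem_flatten
    refine ⟨b, _, hb, by rcases h with rfl | rfl <;> simp [Link.shell], _,
      .wire (Q := ⟨u, true, []⟩) (P := ⟨c, false, [.l]⟩) (m := m) ?_ hm, ?_⟩
    · rcases h with rfl | rfl <;> simp [Link.shell, Link.Wire, Link.wires]
    · rcases h with rfl | rfl <;> simp [Link.shell, Link.guard]
  | @mult_right_up x u v c m hx h hm =>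
    obtain ⟨b, hb⟩ := hx.mem_flatten
    refine ⟨b, _, hb, by rcases h with rfl | rfl <;> simp [Link.shell], _,
      .wire (Q := ⟨v, true, []⟩) (P := ⟨c, false, [.r]⟩) (m := m) ?_ hm, ?_⟩
    · rcases h with rfl | rfl <;> simp [Link.shell, Link.Wire, Link.wires]
    · rcases h with rfl | rfl <;> simp [Link.shell, Link.guard]
  | box_lock hx =>
    obtain ⟨b, hb⟩ := hx.mem_flatten
    exact ⟨b, _, hb, by simp [Link.shell], _, .lock rfl, by simp⟩
  | @box_exit e i o ds C m hx h hT hm =>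
    obtain ⟨b, hb⟩ := hx.mem_flatten
    refine ⟨b, _, hb, by simp [Link.shell], _,
      .wire (P := ⟨i, true, []⟩) (Q := ⟨o, false, []⟩) (m := m) ?_ hm, ?_⟩
    · exact .inl (List.mem_map.2 ⟨_, h, rfl⟩)
    · simpa [Link.shell, Link.guard] using hT
  | @box_enter e i o ds C m hx h hT hm =>
    obtain ⟨b, hb⟩ := hx.mem_flatten
    refine ⟨b, _, hb, by simp [Link.shell], _,
      .wire (Q := ⟨i, true, []⟩) (P := ⟨o, false, []⟩) (m := m) ?_ hm, ?_⟩
    · exact .inr (List.mem_map.2 ⟨_, h, rfl⟩)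
    · simpa [Link.shell, Link.guard] using hT

theorem move_of_mv {R : List Link} {T : State} {b : Option Edge} {l : Link} {p q : Pos}
    {G : Set Pos} (hl : (b, l) ∈ flatten R none) (hs : ∀ ps, l ≠ .sync ps) (h : LMv l p q G)
    (hG : ∀ g ∈ G, T.Occupied g) : Move R T p q := by
  cases h with
  | lock hb =>
    subst hb
    obtain ⟨C', h⟩ := isLink_box_of_mem hl
    exact .box_lock h
  | wire h hm =>
    cases l with
    | ax e f =>
      have hl := isLink_of_mem hl (by simp)
      simp only [Link.Wire, Link.wires, List.mem_cons, List.not_mem_nil, or_false,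
        Prod.mk.injEq] at h
      rcases h with ⟨rfl, rfl⟩ | ⟨rfl, rfl⟩
      · exact .ax hl (.inl rfl) hm
      · exact .ax hl (.inr rfl) hm
    | cut e f =>
      have hl := isLink_of_mem hl (by simp)
      simp only [Link.Wire, Link.wires, List.mem_cons, List.not_mem_nil, or_false,
        Prod.mk.injEq] at h
      rcases h with ⟨rfl, rfl⟩ | ⟨rfl, rfl⟩
      · exact .cut hl (.inl rfl) hm
      · exact .cut hl (.inr rfl) hm
    | tensor u v c =>
      have hl := isLink_of_mem hl (by simp)
      simp only [Link.Wire, Link.wires, List.mem_cons, List.not_mem_nil, or_false,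
        Prod.mk.injEq] at h
      rcases h with (⟨rfl, rfl⟩ | ⟨rfl, rfl⟩) | (⟨rfl, rfl⟩ | ⟨rfl, rfl⟩)
      · exact .mult_left_down hl (.inl rfl) hm
      · exact .mult_right_down hl (.inl rfl) hm
      · exact .mult_left_up hl (.inl rfl) hm
      · exact .mult_right_up hl (.inl rfl) hm
    | par u v c =>
      have hl := isLink_of_mem hl (by simp)
      simp only [Link.Wire, Link.wires, List.mem_cons, List.not_mem_nil, or_false,
        Prod.mk.injEq] at h
      rcases h with (⟨rfl, rfl⟩ | ⟨rfl, rfl⟩) | (⟨rfl, rfl⟩ | ⟨rfl, rfl⟩)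
      · exact .mult_left_down hl (.inr rfl) hm
      · exact .mult_right_down hl (.inr rfl) hm
      · exact .mult_left_up hl (.inr rfl) hm
      · exact .mult_right_up hl (.inr rfl) hm
    | one e => simp [Link.Wire, Link.wires] at h
    | sync ps => exact (hs ps rfl).elim
    | box e ds C =>
      obtain ⟨C', hl⟩ := isLink_box_of_mem hl
      have hT : T.Unlocked e := ⟨0, hG _ rfl⟩
      simp only [Link.Wire, Link.wires, List.mem_map, Prod.mk.injEq] at h
      rcases h with ⟨⟨i, o⟩, hp, rfl, rfl⟩ | ⟨⟨i, o⟩, hp, rfl, rfl⟩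
      · exact .box_exit hl hp hT hm
      · exact .box_enter hl hp hT hm

/-- The formula on a pair is positive or negative as a whole, so its sign decides at once which of
the two edges is the in-edge. Addresses need a condition because `Crosses` allows all lists. -/
theorem crosses_iff {ps : List (Edge × Edge)} (ht : (Link.sync ps).Typed) {p q : Pos} :
    (∃ G, LMv (.sync ps) p q G) ↔
      Crosses ps p q ∧ ∀ e m, p = .atom e m → e.ty.polarity m ≠ none := by
  constructor
  · rintro ⟨G, h⟩
    cases h with
    | lock hb => cases hb
    | wire h hm =>
      simp only [Link.Wire, Link.wires, List.mem_map, Prod.mk.injEq] at h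
      rcases h with ⟨⟨i, o⟩, hp, rfl, rfl⟩ | ⟨⟨i, o⟩, hp, rfl, rfl⟩
      · refine ⟨⟨i, o, i, o, _, hp, .inl ⟨?_, rfl, rfl⟩, rfl, rfl⟩, ?_⟩
        · refine ((ht.2 _ hp).2).resolve_right fun hn => ?_
          have := hn.polarity (m := _) (by rw [hm]; simp)
          rw [hm] at this; cases this
        · rintro e m ⟨⟩; rw [hm]; simp
      · refine ⟨⟨i, o, o, i, _, hp, .inr ⟨?_, rfl, rfl⟩, rfl, rfl⟩, ?_⟩
        · refine ((ht.2 _ hp).2).resolve_left fun hn => ?_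
          rw [(ht.2 _ hp).1] at hn
          have := hn.polarity (m := _) (by rw [hm]; simp)
          rw [hm] at this; cases this
        · rintro e m ⟨⟩; rw [hm]; simp
  · rintro ⟨⟨a, b, e, f, m, hp, hio, rfl, rfl⟩, hv⟩
    have hv := hv _ _ rfl
    rcases hio with ⟨hpos, rfl, rfl⟩ | ⟨hneg, rfl, rfl⟩
    · exact ⟨_, .wire (P := ⟨e, true, []⟩) (Q := ⟨f, false, []⟩)
        (.inl (List.mem_map.2 ⟨_, hp, rfl⟩)) (hpos.polarity hv)⟩
    · rw [(ht.2 _ hp).1] at hneg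
      exact ⟨_, .wire (P := ⟨e, false, []⟩) (Q := ⟨f, true, []⟩)
        (.inr (List.mem_map.2 ⟨_, hp, rfl⟩)) (hneg.polarity hv)⟩

theorem mem_sync_guard {ps : List (Edge × Edge)} {g : Pos} :
    g ∈ (Link.sync ps).guard ↔ ∃ q G, LMv (.sync ps) g q G := by
  constructor
  · rintro ⟨P, Q, m, h, hm, rfl⟩
    exact ⟨_, _, .wire h hm⟩
  · rintro ⟨q, G, h⟩
    cases h with
    | lock hb => cases hb
    | wire h hm => exact ⟨_, _, _, h, hm, rfl⟩

theorem sync_guard_eq {ps : List (Edge × Edge)} {p q : Pos} {G : Set Pos}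
    (h : LMv (.sync ps) p q G) : G = (Link.sync ps).guard := by
  cases h with
  | lock hb => cases hb
  | wire h hm => rfl

theorem saturated_iff {ps : List (Edge × Edge)} (ht : (Link.sync ps).Typed) {T : State} :
    (∀ a b e f, (a, b) ∈ ps → InOut a b e f → T.Saturated e) ↔
      ∀ g ∈ (Link.sync ps).guard, T.Occupied g := by
  constructor
  · intro h g hg
    obtain ⟨q, hq⟩ := mem_sync_guard.1 hg
    obtain ⟨⟨a, b, e, f, m, hp, hio, rfl, rfl⟩, hv⟩ := (crosses_iff ht).1 hq
    exact h a b e f hp hio m (hv _ _ rfl)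
  · intro h a b e f hp hio m hm
    refine h _ (mem_sync_guard.2 ⟨.atom f m, (crosses_iff ht).2 ⟨⟨a, b, e, f, m, hp, hio, rfl, rfl⟩, ?_⟩⟩)
    rintro e' m' ⟨⟩
    exact hm

/-- The position `q` is on the way that a token of `T` has gone or will go, up to where it is. -/
def State.Passed (Y : Sys) (T : State) (q : Pos) : Prop := ∃ s r, T s = some r ∧ ReflTransGen Y.Nx q r

/-- The invariant of the machine. -/
structure Inv (Γ : List Edge) (R : List Link) (T : State) : Prop where
  vis : ∀ {s p}, T s = some p → (sys (flatten R none) Γ).Vis s p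
  init : ∀ {s}, IsInit Γ s → T s ≠ none
  simul : ∀ {b ps p q p' q' G G'}, (b, Link.sync ps) ∈ flatten R none →
    LMv (.sync ps) p q G → LMv (.sync ps) p' q' G' →
    T.Passed (sys (flatten R none) Γ) q → T.Passed (sys (flatten R none) Γ) q'

-- The invariant of runs, and the state in which they end

section
variable {Γ : List Edge} {R : List Link} (hF : Flat (flatten R none) Γ)

local notation "Y" => sys (flatten R none) Γ

theorem vis_init {s : Pos} (h : IsInit Γ s) : (Y).Vis s s :=
  .gen (G := ∅) (.inl ⟨h, rfl⟩) (by simp)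

theorem Inv.visited {T : State} (hT : Inv Γ R T) {p : Pos} (h : T.Occupied p) : (Y).V p := by
  obtain ⟨s, h⟩ := h; exact ⟨s, hT.vis h⟩

theorem Inv.unlocked {T : State} (hT : Inv Γ R T) {e : Edge} (h : T.Unlocked e) :
    T.Occupied (.lock e 0) := by
  obtain ⟨i, s, h⟩ := h
  obtain ⟨rfl, -⟩ := valid_lock (hT.vis h)
  exact ⟨s, h⟩

theorem Inv.active {T : State} (hT : Inv Γ R T) {b : Option Edge} (h : T.Active b) :
    ∀ g ∈ boxGuard b, T.Occupied g := by
  rintro g ⟨e, rfl, rfl⟩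
  exact hT.unlocked (h e rfl)

include hF

/-- A token whose way contains `q` has come through `p`, so it is the one standing on `p`; then the
way from `q` to its place closes a cycle. -/
theorem Inv.not_passed_of_occupied {T : State} (hT : Inv Γ R T) {p q : Pos} (hp : T.Occupied p)
    (hpq : (Y).Nx p q) : ¬ T.Passed Y q := by
  rintro ⟨s, r, hr, h⟩
  obtain ⟨s', hp⟩ := hp
  have h1 := hF.det.back (hF.det.back_path (hT.vis hr) h) hpq
  obtain rfl := hF.det.unique h1 (hT.vis hp)
  rw [hr] at hp
  cases hp
  exact hF.det.acyclic (hT.vis hr) (.head' hpq h)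

theorem inv_initState : Inv Γ R (initState Γ) where
  vis := by
    intro s p h
    simp only [initState] at h
    split at h
    · next hi => cases h; exact vis_init hi
    · cases h
  init := by
    intro s h
    simp [initState, h]
  simul := by
    rintro b ps p q p' q' G G' hb h h' ⟨s, r, hr, hqr⟩
    simp only [initState] at hr
    split at hr
    · next hi =>
      cases hr
      -- Only the origins themselves are passed at the start, and an exit of a sync link has a
      -- predecessor, so the clause `simul` holds vacuously.
      rcases hqr.cases_tail with rfl | ⟨c, -, G, hc⟩
      · exact (hF.det.orig (.inl ⟨hi, rfl⟩) (p' := p) ⟨b, _, hb, h⟩).elim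
      · exact (hF.det.orig (.inl ⟨hi, rfl⟩) hc).elim
    · cases hr

-- If `N` is the set of newly passed positions, the clause `simul` survives as soon as `N` contains
-- all the exits of a given sync link or none of them.
omit hF in
theorem Inv.of_passed {T U : State} {N : Set Pos} (hT : Inv Γ R T)
    (vis : ∀ {s p}, U s = some p → (Y).Vis s p) (init : ∀ {s}, IsInit Γ s → U s ≠ none)
    (hN : ∀ q, U.Passed Y q ↔ T.Passed Y q ∨ q ∈ N)
    (hsync : ∀ b ps, (b, Link.sync ps) ∈ flatten R none →
      (∀ p q G, LMv (.sync ps) p q G → q ∈ N) ∨ (∀ p q G, LMv (.sync ps) p q G → q ∉ N)) :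
    Inv Γ R U where
  vis := vis
  init := init
  simul := by
    intro b ps p q p' q' G G' hb h h' hq
    rw [hN] at hq ⊢
    rcases hsync b ps hb with h1 | h1
    · exact .inr (h1 _ _ _ h')
    · exact .inl (hT.simul hb h h' (hq.resolve_right (h1 _ _ _ h)))

/-- A single movement or a generation passes one new position, which is no exit of a sync link; a
synchronization passes all the exits of one sync link. The last two conclusions, growth and strict
growth, serve for termination. -/
theorem Inv.trans {T U : State} (hT : Inv Γ R T) (h : Trans R T U) :
    Inv Γ R U ∧ (∀ q, T.Passed Y q → U.Passed Y q) ∧ ∃ q, U.Passed Y q ∧ ¬ T.Passed Y q := by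
  suffices H : ∃ N : Set Pos, (∀ {s p}, U s = some p → (Y).Vis s p) ∧
      (∀ {s}, IsInit Γ s → U s ≠ none) ∧ (∀ q, U.Passed Y q ↔ T.Passed Y q ∨ q ∈ N) ∧
      (∀ b ps, (b, Link.sync ps) ∈ flatten R none →
        (∀ p q G, LMv (.sync ps) p q G → q ∈ N) ∨ (∀ p q G, LMv (.sync ps) p q G → q ∉ N)) ∧
      ∃ q ∈ N, ¬ T.Passed Y q by
    obtain ⟨N, h1, h2, h3, h4, q, h5, h6⟩ := H
    exact ⟨hT.of_passed h1 h2 h3 h4, fun q hq => (h3 q).2 (.inl hq), q, (h3 q).2 (.inr h5), h6⟩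
  cases h with
  | @move s p q hs hm =>
    obtain ⟨b, l, hl, hns, G, hmv, hG⟩ := hm.exists_mv
    have hnx : (Y).Nx p q := ⟨G, b, l, hl, hmv⟩
    have hvq : (Y).Vis s q := (hT.vis hs).mv ⟨b, l, hl, hmv⟩ fun g hg => by
      obtain ⟨e, rfl, he⟩ := hG g hg
      exact hT.visited (hT.unlocked he)
    refine ⟨{q}, ?_, ?_, ?_, ?_, q, rfl, hT.not_passed_of_occupied hF ⟨s, hs⟩ hnx⟩
    · intro s' p' h
      by_cases he : s' = s
      · subst he; simp only [Function.update_self, Option.some.injEq] at h; exact h ▸ hvq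
      · rw [Function.update_of_ne he] at h; exact hT.vis h
    · intro s' h
      by_cases he : s' = s
      · subst he; simp
      · rw [Function.update_of_ne he]; exact hT.init h
    · intro x
      constructor
      · rintro ⟨s', r, hr, hx⟩
        by_cases he : s' = s
        · subst he
          simp only [Function.update_self, Option.some.injEq] at hr
          subst hr
          rcases hF.det.path_to hx hnx with rfl | hx
          · exact .inr rfl
          · exact .inl ⟨s', p, hs, hx⟩
        · rw [Function.update_of_ne he] at hr; exact .inl ⟨s', r, hr, hx⟩
      · rintro (⟨s', r, hr, hx⟩ | rfl)
        · by_cases he : s' = s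
          · subst he
            rw [hs] at hr; cases hr
            exact ⟨s', q, by simp, hx.tail hnx⟩
          · exact ⟨s', r, by rwa [Function.update_of_ne he], hx⟩
        · exact ⟨s, x, by simp, .refl⟩
    · intro b' ps hb
      refine .inr fun p' q' G' h' hq' => ?_
      obtain rfl : q' = q := hq'
      -- The point `q` is reached through the link `l`, which is not a sync link, and by backward
      -- determinism through no other link.
      obtain ⟨-, h2⟩ := hF.mv_inj hl hb hmv h'
      exact hns ps (by cases h2; rfl)
  | @sync _ ps hl hsat hc hnc =>
    have ⟨b, hb⟩ := hl.mem_flatten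
    simp only [Link.shell] at hb
    have ht := hF.typed _ hb
    rw [saturated_iff ht] at hsat
    have hcr : ∀ {s p q G}, T s = some p → LMv (.sync ps) p q G → U s = some q :=
      fun hs h => hc _ _ _ hs ((crosses_iff ht).1 ⟨_, h⟩).1
    have hval : ∀ {s p q}, T s = some p → Crosses ps p q → ∃ G, LMv (.sync ps) p q G := by
      intro s p q hs h
      refine (crosses_iff ht).2 ⟨h, ?_⟩
      rintro e m rfl
      exact (hF.valid_atom (hT.vis hs)).1
    have hcases : ∀ s r, U s = some r → T s = some r ∨
        ∃ p G, T s = some p ∧ LMv (.sync ps) p r G := by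
      intro s r hr
      by_cases h : ∀ p q, T s = some p → ¬ Crosses ps p q
      · exact .inl (hnc s h ▸ hr)
      · push Not at h
        obtain ⟨p, q, hs, h⟩ := h
        have := hc _ _ _ hs h
        rw [hr] at this; cases this
        obtain ⟨G, h⟩ := hval hs h
        exact .inr ⟨p, G, hs, h⟩
    have hmv : ∀ {s p q G}, (Y).Vis s p → LMv (.sync ps) p q G → (Y).Vis s q := by
      intro s p q G hs h
      refine hs.mv ⟨b, _, hb, h⟩ fun g hg => ?_
      rw [sync_guard_eq h] at hg
      exact hT.visited (hsat g hg)
    have hocc : ∀ {p q G}, LMv (.sync ps) p q G → T.Occupied p := fun h =>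
      hsat _ (mem_sync_guard.2 ⟨_, _, h⟩)
    refine ⟨{q | ∃ p G, LMv (.sync ps) p q G}, ?_, ?_, ?_, ?_, ?_⟩
    · intro s r hr
      rcases hcases s r hr with h | ⟨p, G, hs, h⟩
      · exact hT.vis h
      · exact hmv (hT.vis hs) h
    · intro s hs
      by_cases h : ∀ p q, T s = some p → ¬ Crosses ps p q
      · rw [hnc s h]; exact hT.init hs
      · push Not at h
        obtain ⟨p, q, hs, h⟩ := h
        simp [hc _ _ _ hs h]
    · intro x
      constructor
      · rintro ⟨s, r, hr, hx⟩
        rcases hcases s r hr with h | ⟨p, G, hs, h⟩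
        · exact .inl ⟨s, r, h, hx⟩
        · rcases hF.det.path_to hx ⟨_, b, _, hb, h⟩ with rfl | hx
          · exact .inr ⟨_, _, h⟩
          · exact .inl ⟨s, p, hs, hx⟩
      · rintro (⟨s, r, hr, hx⟩ | ⟨p, G, h⟩)
        · by_cases h : ∀ q, ¬ Crosses ps r q
          · refine ⟨s, r, ?_, hx⟩
            rw [hnc s, hr]
            intro p q hp; rw [hr] at hp; cases hp; exact h q
          · push Not at h
            obtain ⟨q, h⟩ := h
            obtain ⟨G, h'⟩ := hval hr h
            exact ⟨s, q, hc _ _ _ hr h, hx.tail ⟨_, b, _, hb, h'⟩⟩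
        · obtain ⟨s, hs⟩ := hocc h
          exact ⟨s, x, hcr hs h, .refl⟩
    · intro b' ps' hb'
      by_cases he : (b, Link.sync ps) = (b', Link.sync ps')
      · cases he
        exact .inl fun p q G h => ⟨p, G, h⟩
      · refine .inr ?_
        rintro p q G h ⟨p', G', h'⟩
        exact he (hF.mv_inj hb hb' h' h).2
    · obtain ⟨x, hx⟩ := List.exists_mem_of_ne_nil _ ht.1
      have : ∃ p q G, LMv (.sync ps) p q G := by
        obtain ⟨m, hm⟩ := x.1.ty.exists_polarity
        have h2 := (ht.2 x hx)
        rcases h2.2 with h3 | h3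
        · exact ⟨_, _, _, .wire (P := ⟨x.1, true, []⟩) (Q := ⟨x.2, false, []⟩) (m := m)
            (.inl (List.mem_map.2 ⟨_, hx, rfl⟩)) (h3.polarity hm)⟩
        · rw [h2.1] at h3 hm
          exact ⟨_, _, _, .wire (P := ⟨x.2, false, []⟩) (Q := ⟨x.1, true, []⟩) (m := m)
            (.inr (List.mem_map.2 ⟨_, hx, rfl⟩)) (h3.polarity hm)⟩
      obtain ⟨p, q, G, h⟩ := this
      exact ⟨q, ⟨p, G, h⟩, hT.not_passed_of_occupied hF (hocc h) ⟨_, b, _, hb, h⟩⟩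
  | @one b e hl hact hnone =>
    have hb := linkAt_iff.2 ⟨_, hl, rfl⟩
    have hgen : (Y).Gen (.atom e []) (boxGuard b) := .inr ⟨b, e, hb, rfl, rfl⟩
    have hve : (Y).Vis (.atom e []) (.atom e []) := .gen hgen fun g hg =>
      hT.visited (hT.active hact g hg)
    refine ⟨{.atom e []}, ?_, ?_, ?_, ?_, _, rfl, ?_⟩
    · intro s' p' h
      by_cases he : s' = .atom e []
      · subst he; simp only [Function.update_self, Option.some.injEq] at h; exact h ▸ hve
      · rw [Function.update_of_ne he] at h; exact hT.vis h
    · intro s' h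
      by_cases he : s' = .atom e []
      · subst he; simp
      · rw [Function.update_of_ne he]; exact hT.init h
    · intro x
      constructor
      · rintro ⟨s', r, hr, hx⟩
        by_cases he : s' = .atom e []
        · subst he
          simp only [Function.update_self, Option.some.injEq] at hr
          subst hr
          rcases hx.cases_tail with rfl | ⟨c, -, G, hc⟩
          · exact .inr rfl
          · exact (hF.det.orig hgen hc).elim
        · rw [Function.update_of_ne he] at hr; exact .inl ⟨s', r, hr, hx⟩
      · rintro (⟨s', r, hr, hx⟩ | rfl)
        · have he : s' ≠ .atom e [] := by rintro rfl; rw [hnone] at hr; cases hr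
          exact ⟨s', r, by rwa [Function.update_of_ne he], hx⟩
        · exact ⟨.atom e [], .atom e [], Function.update_self .., .refl⟩
    · intro b' ps hb'
      refine .inr fun p' q' G' h' hq' => ?_
      obtain rfl : q' = _ := hq'
      exact hF.det.orig hgen (p' := p') ⟨b', _, hb', h'⟩
    · rintro ⟨s, r, hr, h⟩
      obtain rfl := hF.det.origin_eq (hF.det.back_path (hT.vis hr) h) hgen
      rw [hnone] at hr; cases hr

theorem Inv.of_run {T : State} (h : ReflTransGen (Trans R) (initState Γ) T) : Inv Γ R T := by
  induction h with
  | refl => exact inv_initState hF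
  | tail _ h ih => exact (ih.trans hF h).1

theorem Inv.passed_visited {T : State} (hT : Inv Γ R T) {q : Pos} (h : T.Passed Y q) : (Y).V q := by
  obtain ⟨s, r, hr, h⟩ := h
  exact ⟨s, hF.det.back_path (hT.vis hr) h⟩

/-- The number of positions that will be visited but have not been passed decreases at each
transition. -/
theorem exists_runEnd : ∃ T, IsRunEnd Γ R T := by
  suffices H : ∀ n, ∀ T, ReflTransGen (Trans R) (initState Γ) T →
      ({p | (Y).V p} \ {p | T.Passed Y p}).ncard = n → ∃ T, IsRunEnd Γ R T from
    H _ _ .refl rfl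
  intro n
  induction n using Nat.strong_induction_on with
  | _ n ih =>
    intro T hT hn
    by_cases h : ∀ U, ¬ Trans R T U
    · exact ⟨T, hT, h⟩
    · push Not at h
      obtain ⟨U, h⟩ := h
      obtain ⟨hU, hle, q, hq, hq'⟩ := (Inv.of_run hF hT).trans hF h
      refine ih _ ?_ U (hT.tail h) rfl
      rw [← hn]
      refine Set.ncard_lt_ncard ?_ (hF.finite_visited.subset Set.sdiff_subset)
      refine ⟨fun x hx => ⟨hx.1, fun hx' => hx.2 (hle x hx')⟩, fun hsub => ?_⟩
      exact (hsub ⟨hU.passed_visited hF hq, hq'⟩).2 hq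

/-- Induction on `Vis`: if the token stopped just before `p`, the guard would have been passed by
induction, and a transition would be possible, or a sync link would have been crossed by only a part
of its tokens. -/
theorem IsRunEnd.passed {T : State} (h : IsRunEnd Γ R T) {s p : Pos} (hp : (Y).Vis s p) :
    ∃ r, T s = some r ∧ ReflTransGen (Y).Nx p r := by
  have hT := Inv.of_run hF h.1
  have hlock : ∀ e, (∃ s, ∃ r, T s = some r ∧ ReflTransGen (Y).Nx (.lock e 0) r) →
      T.Occupied (.lock e 0) := by
    rintro e ⟨s, r, hr, hp⟩
    rcases hp.cases_head with rfl | ⟨c, ⟨G, hc⟩, -⟩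
    · exact ⟨s, hr⟩
    · exact (lock_stuck hc).elim
  induction hp with
  | gen p G hg hG ih =>
    have hne : T p ≠ none := by
      rcases hg with ⟨hi, rfl⟩ | ⟨b, e, hb, rfl, rfl⟩
      · exact hT.init hi
      · intro hnone
        obtain ⟨l, hl, hl'⟩ := linkAt_iff.1 hb
        have : l = .one e := by cases l <;> simp_all [Link.shell]
        subst this
        refine h.2 _ (.one hl ?_ hnone)
        rintro e' rfl
        obtain ⟨s, -, hs⟩ := ih _ ⟨e', rfl, rfl⟩
        exact ⟨0, hlock e' ⟨s, hs⟩⟩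
    obtain ⟨r, hr⟩ := Option.ne_none_iff_exists'.1 hne
    exact ⟨r, hr, (hT.vis hr).path⟩
  | mv s p q G hp hmv hG ihp ih =>
    obtain ⟨r, hr, hpr⟩ := ihp
    -- If the token is already beyond `p`, forward determinism makes its way go through `q`. The
    -- only remaining case is a token blocked on `p`.
    by_cases hne : p = r
    swap
    · exact ⟨r, hr, hF.det.fwd hpr hne ⟨G, hmv⟩⟩
    subst hne
    exfalso
    obtain ⟨b, l, hl, hmv⟩ := hmv
    by_cases hs : ∃ ps, l = .sync ps
    · obtain ⟨ps, rfl⟩ := hs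
      have ht := hF.typed _ hl
      obtain rfl := sync_guard_eq hmv
      by_cases hocc : ∀ g ∈ (Link.sync ps).guard, T.Occupied g
      · classical
        -- All entries are occupied, so the synchronization is possible. The new position of each
        -- token is chosen, but the choice is forced by determinism.
        refine h.2 (fun s => if h : ∃ p q, T s = some p ∧ Crosses ps p q then some h.choose_spec.choose
          else T s) (.sync (isLink_of_mem hl (by simp)) ((saturated_iff ht).2 hocc) ?_ ?_)
        · intro s p q hs hpq
          have hex : ∃ p q, T s = some p ∧ Crosses ps p q := ⟨p, q, hs, hpq⟩
          rw [dif_pos hex]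
          obtain ⟨h1, h2⟩ := hex.choose_spec.choose_spec
          obtain ⟨x, hx⟩ : ∃ x, x = hex.choose_spec.choose := ⟨_, rfl⟩
          rw [← hx] at h2 ⊢
          rw [← Option.some.inj (hs.symm.trans h1)] at h2
          have hval : ∀ e m, p = .atom e m → e.ty.polarity m ≠ none := by
            rintro e m rfl
            exact (hF.valid_atom (hT.vis hs)).1
          obtain ⟨G, hG⟩ := (crosses_iff ht).2 ⟨hpq, hval⟩
          obtain ⟨G', hG'⟩ := (crosses_iff ht).2 ⟨h2, hval⟩
          rw [(hF.mv_func hl hl hG hG').1]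
        · intro s hs
          rw [dif_neg]
          rintro ⟨p, q, h1, h2⟩
          exact hs p q h1 h2
      · push Not at hocc
        obtain ⟨g, hg, hocc⟩ := hocc
        -- The entry `g` was visited and is empty, so its token has crossed the link; by `simul` the
        -- exit `q` has then been passed too, although a token still waits on `p`.
        obtain ⟨s', hs', r', hr', hgr⟩ := ih g hg
        have hgne : g ≠ r' := by rintro rfl; exact hocc ⟨s', hr'⟩
        obtain ⟨x, G', hx⟩ := mem_sync_guard.1 hg
        have hq : T.Passed Y q := hT.simul hl hx hmv
          ⟨s', r', hr', hF.det.fwd hgr hgne ⟨G', b, _, hl, hx⟩⟩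
        exact hT.not_passed_of_occupied hF ⟨s, hr⟩ ⟨_, b, _, hl, hmv⟩ hq
    · push Not at hs
      -- Away from sync links the guards are locks; a lock that has been passed is still occupied,
      -- so the movement is possible.
      refine h.2 _ (.move hr (move_of_mv hl hs hmv ?_))
      intro g hg
      obtain ⟨s', hs', hg'⟩ := ih g hg
      obtain ⟨e, rfl⟩ : ∃ e, g = .lock e 0 := by
        cases hmv with
        | lock => exact hg.elim
        | wire =>
          cases l with
          | sync ps => exact (hs ps rfl).elim
          | box e ds C => exact ⟨e, hg⟩
          | _ => exact hg.elim
      exact hlock e ⟨s', hg'⟩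

/-- The right-hand side does not mention the run: the token of `s` is on the last position that it
visits. Uniqueness of the final state is immediate from this. -/
theorem IsRunEnd.eq_some_iff {T : State} (h : IsRunEnd Γ R T) {s p : Pos} :
    T s = some p ↔ (Y).Vis s p ∧ ∀ q, (Y).Nx p q → ¬ (Y).Vis s q := by
  constructor
  · intro hs
    have hv := (Inv.of_run hF h.1).vis hs
    refine ⟨hv, fun q hpq hq => ?_⟩
    obtain ⟨r, hr, hqr⟩ := h.passed hF hq
    rw [hs] at hr; cases hr
    exact hF.det.acyclic hv (.head' hpq hqr)
  · rintro ⟨hv, hq⟩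
    obtain ⟨r, hr, hpr⟩ := h.passed hF hv
    rcases hpr.cases_head with rfl | ⟨c, hc, hcr⟩
    · exact hr
    · exact (hq c hc (hF.det.back_path ((Inv.of_run hF h.1).vis hr) hcr)).elim

theorem existsUnique_runEnd : ∃! T, IsRunEnd Γ R T := by
  obtain ⟨T, hT⟩ := exists_runEnd hF
  refine ⟨T, hT, fun U hU => ?_⟩
  funext s
  ext p
  simp only [hT.eq_some_iff hF, hU.eq_some_iff hF]

/-- Final positions of tokens: final positions and locks of boxes. -/
def Final (Γ : List Edge) (t : Pos) : Prop := IsFin Γ t ∨ ∃ e, t = .lock e 0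

/-- All final positions are visited, and all tokens reach a final position or a lock. -/
def Sys.Complete (Γ : List Edge) (Z : Sys) : Prop :=
  (∀ p, IsFin Γ p → Z.V p) ∧ ∀ s, Z.Vis s s → ∃ t, Final Γ t ∧ Z.Vis s t

theorem IsRunEnd.eq_of_stuck {T : State} (h : IsRunEnd Γ R T) {s t : Pos} (hs : (Y).Vis s t)
    (ht : Final Γ t) : T s = some t := by
  rw [h.eq_some_iff hF]
  refine ⟨hs, ?_⟩
  rintro q ⟨G, hq⟩
  rcases ht with ht | ⟨e, rfl⟩
  · exact (hF.fin_stuck ht hq).elim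
  · exact (lock_stuck hq).elim

theorem IsRunEnd.isFinalState_iff {T : State} (h : IsRunEnd Γ R T) :
    IsFinalState Γ R T ↔ (Y).Complete Γ := by
  have hT := Inv.of_run hF h.1
  constructor
  · rintro ⟨h1, h2⟩
    refine ⟨fun p hp => hT.visited (h1 p hp), fun s hs => ?_⟩
    obtain ⟨r, hr, -⟩ := h.passed hF hs
    refine ⟨r, ?_, hT.vis hr⟩
    rcases h2 r ⟨s, hr⟩ with h | ⟨e, ds, C, i, -, rfl⟩
    · exact .inl h
    · obtain ⟨rfl, -⟩ := valid_lock (hT.vis hr)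
      exact .inr ⟨e, rfl⟩
  · rintro ⟨h1, h2⟩
    constructor
    · intro p hp
      obtain ⟨s, hs⟩ := h1 p hp
      exact ⟨s, h.eq_of_stuck hF hs (.inl hp)⟩
    · rintro p ⟨s, hs⟩
      obtain ⟨t, ht, hst⟩ := h2 s (hT.vis hs).origin
      have := h.eq_of_stuck hF hst ht
      rw [hs] at this; cases this
      rcases ht with ht | ⟨e, rfl⟩
      · exact .inl ht
      · obtain ⟨-, b, ds, C, hb⟩ := valid_lock hst
        obtain ⟨C', hC⟩ := isLink_box_of_mem hb
        exact .inr ⟨e, ds, C', 0, hC, rfl⟩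

theorem deadlocks_iff : Deadlocks Γ R ↔ ¬ (Y).Complete Γ := by
  constructor
  · rintro ⟨T, hT, h⟩
    rwa [hT.isFinalState_iff hF] at h
  · intro h
    obtain ⟨T, hT⟩ := exists_runEnd hF
    exact ⟨T, hT, by rwa [hT.isFinalState_iff hF]⟩

end

-- Equivalence of systems and equality of interpretations

/-- Two systems with the same tokens reaching final positions. -/
structure Equi (Γ : List Edge) (Y Z : Sys) : Prop where
  result : ∀ s p, IsInit Γ s → IsFin Γ p → (Y.Vis s p ↔ Z.Vis s p)
  complete : Y.Complete Γ ↔ Z.Complete Γ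

theorem Equi.refl (Γ : List Edge) (Y : Sys) : Equi Γ Y Y := ⟨fun _ _ _ _ => .rfl, .rfl⟩

theorem Equi.symm {Γ : List Edge} {Y Z : Sys} (h : Equi Γ Y Z) : Equi Γ Z Y :=
  ⟨fun s p hs hp => (h.1 s p hs hp).symm, h.2.symm⟩

theorem Equi.trans {Γ : List Edge} {Y Z W : Sys} (h : Equi Γ Y Z) (h' : Equi Γ Z W) :
    Equi Γ Y W :=
  ⟨fun s p hs hp => (h.1 s p hs hp).trans (h'.1 s p hs hp), h.2.trans h'.2⟩

theorem Equi.result_eq {Γ : List Edge} {R S : List Link} (hR : Flat (flatten R none) Γ)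
    (hS : Flat (flatten S none) Γ)
    (h : Equi Γ (sys (flatten R none) Γ) (sys (flatten S none) Γ)) {T U : State}
    (hT : IsRunEnd Γ R T) (hU : IsRunEnd Γ S U) : T.result Γ = U.result Γ := by
  have key : ∀ {R : List Link} (hR : Flat (flatten R none) Γ) {T : State} (hT : IsRunEnd Γ R T)
      (s : {p // IsInit Γ p}) (p : {p // IsFin Γ p}),
      T.result Γ s = some p ↔ (sys (flatten R none) Γ).Vis s p := by
    intro R hR T hT s p
    simp only [State.result, Option.bind_eq_some_iff]
    constructor
    · rintro ⟨r, hr, h⟩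
      split at h
      · cases h; exact (Inv.of_run hR hT.1).vis hr
      · cases h
    · intro h
      exact ⟨p, hT.eq_of_stuck hR h (.inl p.2), by simp [p.2]⟩
  funext s
  ext p
  rw [key hR hT, key hS hU, h.result _ _ s.2 p.2]

/-- The interpretation is computed from some chosen final state; `result_eq` compares arbitrary ends
of runs, so the choice plays no role. -/
theorem Equi.interp_eq {Γ : List Edge} {R S : List Link} (hR : Flat (flatten R none) Γ)
    (hS : Flat (flatten S none) Γ)
    (h : Equi Γ (sys (flatten R none) Γ) (sys (flatten S none) Γ)) :
    interp Γ R = interp Γ S := by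
  have key : ∀ {R : List Link} (_ : Flat (flatten R none) Γ),
      (∃ F, IsRunEnd Γ R F ∧ IsFinalState Γ R F) ↔ (sys (flatten R none) Γ).Complete Γ := by
    intro R hR
    constructor
    · rintro ⟨F, hF, h⟩
      rwa [hF.isFinalState_iff hR] at h
    · intro h
      obtain ⟨T, hT⟩ := exists_runEnd hR
      exact ⟨T, hT, by rwa [hT.isFinalState_iff hR]⟩
  unfold interp
  by_cases hc : ∃ F, IsRunEnd Γ R F ∧ IsFinalState Γ R F
  · have hc' : ∃ F, IsRunEnd Γ S F ∧ IsFinalState Γ S F := by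
      rwa [key hS, ← h.complete, ← key hR]
    rw [dif_pos hc, dif_pos hc', h.result_eq hR hS hc.choose_spec.1 hc'.choose_spec.1]
  · have hc' : ¬ ∃ F, IsRunEnd Γ S F ∧ IsFinalState Γ S F := by
      rwa [key hS, ← h.complete, ← key hR]
    rw [dif_neg hc, dif_neg hc']

end SMLL

namespace SMLL

/-! ### Simulations -/

/-- The tokens of `Y` are simulated by those of `Z`, along a relation `ρ` of positions and a
relation `ρo` of origins. -/
structure Sim (Γ : List Edge) (Y Z : Sys) (ρ ρo : Pos → Pos → Prop) : Prop where
  gen : ∀ {p G p'}, Y.Gen p G → (∀ g ∈ G, ∀ g', ρ g g' → Z.V g') → ρ p p' →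
    ∃ s', ρo p s' ∧ Z.Vis s' p'
  mv : ∀ {p q G q'}, Y.Mv p q G → (∀ g ∈ G, ∀ g', ρ g g' → Z.V g') → ρ q q' →
    ∃ p', ρ p p' ∧ ∀ s, Z.Vis s p' → Z.Vis s q'
  origin : ∀ {s}, Y.Vis s s → (∃ s', ρ s s') ∨ ∃ t, Final Γ t ∧ Y.Vis s t
  final : ∀ {s s' t}, ρo s s' → Y.Vis s t → Final Γ t → ∃ t', Final Γ t' ∧ ρ t t'
  func : ∀ {s s' s''}, ρo s s' → ρo s s'' → s' = s''
  init : ∀ {s s'}, IsInit Γ s → ρo s s' → s' = s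
  fin : ∀ {p}, IsFin Γ p → ρ p p

/-- The clauses of `Sim` start from a position related to the point of arrival and look for one
related to the point of departure, because one movement of `Y` may correspond to none or to several
movements of `Z`. -/
theorem Sim.vis {Γ : List Edge} {Y Z : Sys} {ρ ρo : Pos → Pos → Prop} (h : Sim Γ Y Z ρ ρo)
    {s p p' : Pos} (hs : Y.Vis s p) (hp : ρ p p') : ∃ s', ρo s s' ∧ Z.Vis s' p' := by
  induction hs generalizing p' with
  | gen p G hg hG ih =>
    refine h.gen hg (fun g hg g' hgg => ?_) hp
    obtain ⟨s, hs, hC⟩ := ih g hg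
    obtain ⟨s', -, h'⟩ := hC hgg
    exact ⟨s', h'⟩
  | mv s p q G hp' hmv hG ihp ih =>
    obtain ⟨r, hr, hr'⟩ := h.mv hmv (fun g hg g' hgg => by
      obtain ⟨s, hs, hC⟩ := ih g hg
      obtain ⟨s', -, h'⟩ := hC hgg
      exact ⟨s', h'⟩) hp
    obtain ⟨s', h1, h2⟩ := ihp hr
    exact ⟨s', h1, hr' s' h2⟩

/-- A token of `Y` is sent to its counterpart in `Z`, which reaches a final place there; the reverse
simulation brings that place back, and functionality of `ρo` ensures that the token found in `Y` is
the initial one. Tokens without counterpart are those known to reach a final place by `origin`. -/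
theorem Sim.complete {Γ : List Edge} {Y Z : Sys} {ρ ρo : Pos → Pos → Prop} (h : Sim Γ Y Z ρ ρo)
    (h' : Sim Γ Z Y (fun a b => ρ b a) (fun a b => ρo b a)) (hZ : Z.Complete Γ) :
    Y.Complete Γ := by
  refine ⟨fun p hp => ?_, fun s hs => ?_⟩
  · obtain ⟨s, hs⟩ := hZ.1 p hp
    obtain ⟨s', -, h⟩ := h'.vis hs (h'.fin hp)
    exact ⟨s', h⟩
  · rcases h.origin hs with ⟨s', hss⟩ | h
    · obtain ⟨s1, h1, h2⟩ := h.vis hs hss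
      obtain ⟨t, ht, hst⟩ := hZ.2 s1 h2.origin
      obtain ⟨t', ht', htt⟩ := h'.final h1 hst ht
      obtain ⟨s2, h3, h4⟩ := h'.vis hst htt
      obtain rfl := h'.func h1 h3
      exact ⟨t', ht', h4⟩
    · exact h

theorem Equi.of_sim {Γ : List Edge} {Y Z : Sys} {ρ ρo : Pos → Pos → Prop} (h : Sim Γ Y Z ρ ρo)
    (h' : Sim Γ Z Y (fun a b => ρ b a) (fun a b => ρo b a)) : Equi Γ Y Z where
  result s p hs hp := by
    constructor
    · intro hv
      obtain ⟨s', h1, h2⟩ := h.vis hv (h.fin hp)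
      rwa [← h.init hs h1]
    · intro hv
      obtain ⟨s', h1, h2⟩ := h'.vis hv (h'.fin hp)
      rwa [← h'.init hs h1]
  complete := ⟨fun hc => h'.complete h hc, fun hc => h.complete h' hc⟩

/-- In `Y`, tokens move freely from `x i` to `y i`, and from there to `z i` through a
synchronization; in `Z`, they move from `x i` to `y' i` through the synchronization, and from
there freely to `z i`. -/
structure Commute (Γ : List Edge) (Y Z : Sys) {ι : Type} (x y y' z : ι → Pos)
    (M : Pos → Pos → Set Pos → Prop) (T : Pos → Pos → Prop) (G₀ : Set Pos) : Prop where
  detY : Y.Det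
  detZ : Z.Det
  gen : ∀ {p G}, Y.Gen p G ↔ Z.Gen p G
  mvY : ∀ {p q G}, Y.Mv p q G ↔ M p q G ∨ (∃ i, p = x i ∧ q = y i ∧ G = ∅) ∨
    (((∃ i, p = y i ∧ q = z i) ∨ T p q) ∧ G = {g | g ∈ G₀ ∨ ∃ i, g = y i})
  mvZ : ∀ {p q G}, Z.Mv p q G ↔ M p q G ∨ (∃ i, p = y' i ∧ q = z i ∧ G = ∅) ∨
    (((∃ i, p = x i ∧ q = y' i) ∨ T p q) ∧ G = {g | g ∈ G₀ ∨ ∃ i, g = x i})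
  fresh_gen : ∀ {p G i}, Y.Gen p G → (p ≠ y i ∧ p ≠ y' i) ∧ ∀ g ∈ G, g ≠ y i ∧ g ≠ y' i
  fresh_mv : ∀ {p q G i}, M p q G → (p ≠ y i ∧ p ≠ y' i) ∧ (q ≠ y i ∧ q ≠ y' i) ∧
    ∀ g ∈ G, g ≠ y i ∧ g ≠ y' i
  fresh_sync : ∀ {p q i}, T p q → (p ≠ y i ∧ p ≠ y' i) ∧ (q ≠ y i ∧ q ≠ y' i)
  fresh_guard : ∀ {g i}, g ∈ G₀ → g ≠ y i ∧ g ≠ y' i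
  fresh_left : ∀ {i j}, x i ≠ y j ∧ x i ≠ y' j
  fresh_right : ∀ {i j}, z i ≠ y j ∧ z i ≠ y' j
  fresh_final : ∀ {t i}, Final Γ t → t ≠ y i ∧ t ≠ y' i

/-- Each intermediate position stands for its neighbour on the side without synchronization: `y i`
is visited in `Y` exactly when `x i` is visited in `Z`, and `y' i` in `Z` exactly when `z i` is in
`Y`. All other positions stand for themselves. Under this dictionary the two guards of the
synchronization, over the `y i` and over the `x i`, are the same condition. -/
theorem Commute.equi {Γ : List Edge} {Y Z : Sys} {ι : Type} {x y y' z : ι → Pos}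
    {M : Pos → Pos → Set Pos → Prop} {T : Pos → Pos → Prop} {G₀ : Set Pos}
    (h : Commute Γ Y Z x y y' z M T G₀) : Equi Γ Y Z := by
  have hxy : ∀ i, Y.Mv (x i) (y i) ∅ := fun i => h.mvY.2 (.inr (.inl ⟨i, rfl, rfl, rfl⟩))
  have hyz : ∀ i, Y.Mv (y i) (z i) {g | g ∈ G₀ ∨ ∃ i, g = y i} := fun i =>
    h.mvY.2 (.inr (.inr ⟨.inl ⟨i, rfl, rfl⟩, rfl⟩))
  have hxy' : ∀ i, Z.Mv (x i) (y' i) {g | g ∈ G₀ ∨ ∃ i, g = x i} := fun i =>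
    h.mvZ.2 (.inr (.inr ⟨.inl ⟨i, rfl, rfl⟩, rfl⟩))
  have hyz' : ∀ i, Z.Mv (y' i) (z i) ∅ := fun i => h.mvZ.2 (.inr (.inl ⟨i, rfl, rfl, rfl⟩))
  let F : Pos → Prop := fun p => ∀ i, p ≠ y i ∧ p ≠ y' i
  let ρ : Pos → Pos → Prop := fun p p' => (p = p' ∧ F p) ∨ (∃ i, p = y i ∧ p' = x i) ∨
    ∃ i, p = z i ∧ p' = y' i
  have hFx : ∀ i, F (x i) := fun i j => h.fresh_left
  have hFz : ∀ i, F (z i) := fun i j => h.fresh_right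
  have hrefl : ∀ {p}, F p → ρ p p := fun hp => .inl ⟨rfl, hp⟩
  have hρy : ∀ i, ρ (y i) (x i) := fun i => .inr (.inl ⟨i, rfl, rfl⟩)
  have hρz : ∀ i, ρ (z i) (y' i) := fun i => .inr (.inr ⟨i, rfl, rfl⟩)
  have hvy : ∀ {s i}, Y.Vis s (x i) → Y.Vis s (y i) := fun hs => hs.mv (hxy _) (by simp)
  refine Equi.of_sim (ρ := ρ) (ρo := Eq) ?_ ?_
  · refine ⟨?_, ?_, ?_, ?_, ?_, ?_, ?_⟩
    · intro p G p' hg hG hp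
      rcases hp with ⟨rfl, -⟩ | ⟨i, rfl, rfl⟩ | ⟨i, rfl, rfl⟩
      · exact ⟨p, rfl, .gen (h.gen.1 hg) fun g hgG => hG g hgG g
          (hrefl fun i => (h.fresh_gen hg).2 g hgG)⟩
      · exact ((h.fresh_gen hg (i := i)).1.1 rfl).elim
      · exact (h.detY.orig hg (hyz i)).elim
    · intro p q G q' hmv hG hq
      rcases h.mvY.1 hmv with hM | ⟨i, rfl, rfl, rfl⟩ | ⟨⟨i, rfl, rfl⟩ | hT, rfl⟩
      · have hFp : F p := fun i => (h.fresh_mv hM).1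
        rcases hq with ⟨rfl, -⟩ | ⟨i, rfl, rfl⟩ | ⟨i, rfl, rfl⟩
        · exact ⟨p, hrefl hFp, fun s hs => hs.mv (h.mvZ.2 (.inl hM)) fun g hg => hG g hg g
            (hrefl fun i => (h.fresh_mv hM).2.2 g hg)⟩
        · exact ((h.fresh_mv hM (i := i)).2.1.1 rfl).elim
        -- The only movement to `z i` in `Y` comes from `y i`, which is fresh for `M`.
        · exact ((hFp i).1 (h.detY.inj hmv (hyz i))).elim
      · rcases hq with ⟨rfl, hF⟩ | ⟨j, hj, rfl⟩ | ⟨j, hj, rfl⟩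
        · exact ((hF i).1 rfl).elim
        · have := h.detY.inj (hxy i) (hj ▸ hxy j)
          exact ⟨x i, hrefl (hFx i), fun s hs => this ▸ hs⟩
        · exact ((hFz j i).1 hj.symm).elim
      · have hGZ : ∀ g ∈ {g | g ∈ G₀ ∨ ∃ i, g = x i}, Z.V g := by
          rintro g (hg | ⟨j, rfl⟩)
          · exact hG g (.inl hg) g (hrefl fun i => h.fresh_guard hg)
          · exact hG (y j) (.inr ⟨j, rfl⟩) _ (hρy j)
        rcases hq with ⟨rfl, -⟩ | ⟨j, hj, rfl⟩ | ⟨j, hj, rfl⟩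
        -- One step of `Y` becomes two in `Z`: the synchronization to `y' i`, then the free movement
        -- to `z i`.
        · exact ⟨x i, hρy i, fun s hs => (hs.mv (hxy' i) hGZ).mv (hyz' i) (by simp)⟩
        · exact ((hFz i j).1 hj).elim
        · have := h.detY.inj (hyz i) (hj ▸ hyz j)
          exact ⟨x j, this ▸ hρy j, fun s hs => hs.mv (hxy' j) hGZ⟩
      · have hGZ : ∀ g ∈ {g | g ∈ G₀ ∨ ∃ i, g = x i}, Z.V g := by
          rintro g (hg | ⟨j, rfl⟩)
          · exact hG g (.inl hg) g (hrefl fun i => h.fresh_guard hg)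
          · exact hG (y j) (.inr ⟨j, rfl⟩) _ (hρy j)
        have hFp : F p := fun i => (h.fresh_sync hT).1
        rcases hq with ⟨rfl, -⟩ | ⟨i, rfl, rfl⟩ | ⟨i, rfl, rfl⟩
        · exact ⟨p, hrefl hFp, fun s hs => hs.mv (h.mvZ.2 (.inr (.inr ⟨.inr hT, rfl⟩))) hGZ⟩
        · exact ((h.fresh_sync hT (i := i)).2.1 rfl).elim
        · exact ((hFp i).1 (h.detY.inj hmv (hyz i))).elim
    · intro s hs
      obtain ⟨G, hg, -⟩ := hs.exists_gen
      exact .inl ⟨s, hrefl fun i => (h.fresh_gen hg).1⟩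
    · rintro s _ t rfl hs ht
      exact ⟨t, ht, hrefl fun i => h.fresh_final ht⟩
    · rintro s _ _ rfl rfl; rfl
    · rintro s _ - rfl; rfl
    · intro p hp
      exact hrefl fun i => h.fresh_final (.inl hp)
  · refine ⟨?_, ?_, ?_, ?_, ?_, ?_, ?_⟩
    · intro p G p' hg hG hp
      have hv : Y.Vis p p := .gen (h.gen.2 hg) fun g hgG => hG g hgG g
          (hrefl fun i => (h.fresh_gen (h.gen.2 hg)).2 g hgG)
      rcases hp with ⟨rfl, -⟩ | ⟨i, rfl, rfl⟩ | ⟨i, rfl, rfl⟩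
      · exact ⟨_, rfl, hv⟩
      · exact ⟨_, rfl, hvy hv⟩
      · exact ((h.fresh_gen (h.gen.2 hg) (i := i)).1.2 rfl).elim
    · intro p q G r hmv hG hq
      have hGY : {g | g ∈ G₀ ∨ ∃ i, g = x i} ⊆ G → ∀ g ∈ {g | g ∈ G₀ ∨ ∃ i, g = y i}, Y.V g := by
        rintro hsub g (hg | ⟨j, rfl⟩)
        · exact hG g (hsub (.inl hg)) g (hrefl fun i => h.fresh_guard hg)
        · exact hG (x j) (hsub (.inr ⟨j, rfl⟩)) _ (hρy j)
      rcases h.mvZ.1 hmv with hM | ⟨i, rfl, rfl, rfl⟩ | ⟨⟨i, rfl, rfl⟩ | hT, rfl⟩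
      · refine ⟨p, hrefl fun i => (h.fresh_mv hM).1, fun s hs => ?_⟩
        have hv : Y.Vis s q := hs.mv (h.mvY.2 (.inl hM)) fun g hg => hG g hg g
            (hrefl fun i => (h.fresh_mv hM).2.2 g hg)
        rcases hq with ⟨rfl, -⟩ | ⟨i, rfl, rfl⟩ | ⟨i, rfl, rfl⟩
        · exact hv
        · exact hvy hv
        · exact ((h.fresh_mv hM (i := i)).2.1.2 rfl).elim
      -- The free movement of `Z` from `y' i` to `z i` is matched by no movement, since `y' i`
      -- already stands for `z i`.
      · refine ⟨z i, hρz i, fun s hs => ?_⟩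
        rcases hq with ⟨rfl, -⟩ | ⟨j, rfl, hj⟩ | ⟨j, rfl, hj⟩
        · exact hs
        · exact hvy (hj ▸ hs)
        · exact ((hFz i j).2 hj).elim
      · rcases hq with ⟨rfl, hF⟩ | ⟨j, rfl, hj⟩ | ⟨j, rfl, hj⟩
        · exact ((hF i).2 rfl).elim
        · exact ((hFx j i).2 hj.symm).elim
        · have := h.detZ.inj (hxy' i) (hj ▸ hxy' j)
          exact ⟨y j, this ▸ hρy j, fun s hs => hs.mv (hyz j) (hGY subset_rfl)⟩
      · refine ⟨p, hrefl fun i => (h.fresh_sync hT).1, fun s hs => ?_⟩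
        have hv : Y.Vis s q := hs.mv (h.mvY.2 (.inr (.inr ⟨.inr hT, rfl⟩))) (hGY subset_rfl)
        rcases hq with ⟨rfl, -⟩ | ⟨i, rfl, rfl⟩ | ⟨i, rfl, rfl⟩
        · exact hv
        · exact hvy hv
        · exact ((h.fresh_sync hT (i := i)).2.2 rfl).elim
    · intro s hs
      obtain ⟨G, hg, -⟩ := hs.exists_gen
      exact .inl ⟨s, hrefl fun i => (h.fresh_gen (h.gen.2 hg)).1⟩
    · rintro s _ t rfl hs ht
      exact ⟨t, ht, hrefl fun i => h.fresh_final ht⟩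
    · rintro s _ _ rfl rfl; rfl
    · rintro s _ - rfl; rfl
    · intro p hp
      exact hrefl fun i => h.fresh_final (.inl hp)

/-- In `Y`, tokens move freely from `x i` to `y i`, to `y' i` and to `z i`; in `Z`, they move
directly from `x i` to `z i`. -/
structure Shortcut (Γ : List Edge) (Y Z : Sys) {ι : Type} (x y y' z : ι → Pos)
    (M : Pos → Pos → Set Pos → Prop) : Prop where
  detY : Y.Det
  detZ : Z.Det
  gen : ∀ {p G}, Y.Gen p G ↔ Z.Gen p G
  mvY : ∀ {p q G}, Y.Mv p q G ↔ M p q G ∨ (∃ i, p = x i ∧ q = y i ∧ G = ∅) ∨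
    (∃ i, p = y i ∧ q = y' i ∧ G = ∅) ∨ (∃ i, p = y' i ∧ q = z i ∧ G = ∅)
  mvZ : ∀ {p q G}, Z.Mv p q G ↔ M p q G ∨ (∃ i, p = x i ∧ q = z i ∧ G = ∅)
  fresh_gen : ∀ {p G i}, Y.Gen p G → (p ≠ y i ∧ p ≠ y' i) ∧ ∀ g ∈ G, g ≠ y i ∧ g ≠ y' i
  fresh_mv : ∀ {p q G i}, M p q G → (p ≠ y i ∧ p ≠ y' i) ∧ (q ≠ y i ∧ q ≠ y' i) ∧
    ∀ g ∈ G, g ≠ y i ∧ g ≠ y' i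
  fresh_mid : ∀ {i j}, y i ≠ y' j
  fresh_left : ∀ {i j}, x i ≠ y j ∧ x i ≠ y' j
  fresh_right : ∀ {i j}, z i ≠ y j ∧ z i ≠ y' j
  fresh_final : ∀ {t i}, Final Γ t → t ≠ y i ∧ t ≠ y' i

/-- All the movements involved are free, so a visit of `x i` entails the visit of the three others:
`y i` stands for `x i`, and `y' i` for `z i`. -/
theorem Shortcut.equi {Γ : List Edge} {Y Z : Sys} {ι : Type} {x y y' z : ι → Pos}
    {M : Pos → Pos → Set Pos → Prop} (h : Shortcut Γ Y Z x y y' z M) : Equi Γ Y Z := by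
  have hxy : ∀ i, Y.Mv (x i) (y i) ∅ := fun i => h.mvY.2 (.inr (.inl ⟨i, rfl, rfl, rfl⟩))
  have hyy : ∀ i, Y.Mv (y i) (y' i) ∅ := fun i => h.mvY.2 (.inr (.inr (.inl ⟨i, rfl, rfl, rfl⟩)))
  have hyz : ∀ i, Y.Mv (y' i) (z i) ∅ := fun i => h.mvY.2 (.inr (.inr (.inr ⟨i, rfl, rfl, rfl⟩)))
  have hxz : ∀ i, Z.Mv (x i) (z i) ∅ := fun i => h.mvZ.2 (.inr ⟨i, rfl, rfl, rfl⟩)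
  let F : Pos → Prop := fun p => ∀ i, p ≠ y i ∧ p ≠ y' i
  let ρ : Pos → Pos → Prop := fun p p' => (p = p' ∧ F p) ∨ (∃ i, p = y i ∧ p' = x i) ∨
    ∃ i, p = y' i ∧ p' = z i
  have hFx : ∀ i, F (x i) := fun i j => h.fresh_left
  have hFz : ∀ i, F (z i) := fun i j => h.fresh_right
  have hrefl : ∀ {p}, F p → ρ p p := fun hp => .inl ⟨rfl, hp⟩
  have hρy : ∀ i, ρ (y i) (x i) := fun i => .inr (.inl ⟨i, rfl, rfl⟩)
  have hρy' : ∀ i, ρ (y' i) (z i) := fun i => .inr (.inr ⟨i, rfl, rfl⟩)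
  have hvy : ∀ {s i}, Y.Vis s (x i) → Y.Vis s (y i) := fun hs => hs.mv (hxy _) (by simp)
  have hvy' : ∀ {s i}, Y.Vis s (x i) → Y.Vis s (y' i) := fun hs => (hvy hs).mv (hyy _) (by simp)
  have hvz : ∀ {s i}, Y.Vis s (x i) → Y.Vis s (z i) := fun hs => (hvy' hs).mv (hyz _) (by simp)
  refine Equi.of_sim (ρ := ρ) (ρo := Eq) ?_ ?_
  · refine ⟨?_, ?_, ?_, ?_, ?_, ?_, ?_⟩
    · intro p G p' hg hG hp
      rcases hp with ⟨rfl, -⟩ | ⟨i, rfl, rfl⟩ | ⟨i, rfl, rfl⟩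
      · exact ⟨p, rfl, .gen (h.gen.1 hg) fun g hgG => hG g hgG g
          (hrefl fun i => (h.fresh_gen hg).2 g hgG)⟩
      · exact ((h.fresh_gen hg (i := i)).1.1 rfl).elim
      · exact ((h.fresh_gen hg (i := i)).1.2 rfl).elim
    · intro p q G q' hmv hG hq
      rcases h.mvY.1 hmv with hM | ⟨i, rfl, rfl, rfl⟩ | ⟨i, rfl, rfl, rfl⟩ | ⟨i, rfl, rfl, rfl⟩
      · rcases hq with ⟨rfl, -⟩ | ⟨i, rfl, rfl⟩ | ⟨i, rfl, rfl⟩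
        · exact ⟨p, hrefl fun i => (h.fresh_mv hM).1,
            fun s hs => hs.mv (h.mvZ.2 (.inl hM)) fun g hg => hG g hg g
            (hrefl fun i => (h.fresh_mv hM).2.2 g hg)⟩
        · exact ((h.fresh_mv hM (i := i)).2.1.1 rfl).elim
        · exact ((h.fresh_mv hM (i := i)).2.1.2 rfl).elim
      · rcases hq with ⟨rfl, hF⟩ | ⟨j, hj, rfl⟩ | ⟨j, hj, rfl⟩
        · exact ((hF i).1 rfl).elim
        · have := h.detY.inj (hxy i) (hj ▸ hxy j)
          exact ⟨x i, hrefl (hFx i), fun s hs => this ▸ hs⟩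
        · exact (h.fresh_mid hj).elim
      · rcases hq with ⟨rfl, hF⟩ | ⟨j, hj, rfl⟩ | ⟨j, hj, rfl⟩
        · exact ((hF i).2 rfl).elim
        · exact (h.fresh_mid hj.symm).elim
        · have := h.detY.inj (hyy i) (hj ▸ hyy j)
          exact ⟨x j, this ▸ hρy j, fun s hs => hs.mv (hxz j) (by simp)⟩
      · rcases hq with ⟨rfl, hF⟩ | ⟨j, hj, rfl⟩ | ⟨j, hj, rfl⟩
        · exact ⟨z i, hρy' i, fun s hs => hs⟩
        · exact ((hFz i j).1 hj).elim
        · exact ((hFz i j).2 hj).elim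
    · intro s hs
      obtain ⟨G, hg, -⟩ := hs.exists_gen
      exact .inl ⟨s, hrefl fun i => (h.fresh_gen hg).1⟩
    · rintro s _ t rfl hs ht
      exact ⟨t, ht, hrefl fun i => h.fresh_final ht⟩
    · rintro s _ _ rfl rfl; rfl
    · rintro s _ - rfl; rfl
    · intro p hp
      exact hrefl fun i => h.fresh_final (.inl hp)
  · refine ⟨?_, ?_, ?_, ?_, ?_, ?_, ?_⟩
    · intro p G p' hg hG hp
      have hv : Y.Vis p p := .gen (h.gen.2 hg) fun g hgG => hG g hgG g
          (hrefl fun i => (h.fresh_gen (h.gen.2 hg)).2 g hgG)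
      rcases hp with ⟨rfl, -⟩ | ⟨i, rfl, rfl⟩ | ⟨i, rfl, rfl⟩
      · exact ⟨_, rfl, hv⟩
      · exact ⟨_, rfl, hvy hv⟩
      · exact (h.detZ.orig hg (hxz i)).elim
    · intro p q G r hmv hG hq
      rcases h.mvZ.1 hmv with hM | ⟨i, rfl, rfl, rfl⟩
      · refine ⟨p, hrefl fun i => (h.fresh_mv hM).1, fun s hs => ?_⟩
        have hv : Y.Vis s q := hs.mv (h.mvY.2 (.inl hM)) fun g hg => hG g hg g
            (hrefl fun i => (h.fresh_mv hM).2.2 g hg)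
        rcases hq with ⟨rfl, -⟩ | ⟨i, rfl, rfl⟩ | ⟨i, rfl, rfl⟩
        · exact hv
        · exact hvy hv
        · exact hvy' (h.detZ.inj hmv (hxz i) ▸ hs)
      · refine ⟨x i, hrefl (hFx i), fun s hs => ?_⟩
        rcases hq with ⟨rfl, -⟩ | ⟨j, rfl, hj⟩ | ⟨j, rfl, hj⟩
        · exact hvz hs
        · exact hvy (hj ▸ hvz hs)
        · exact hvy' (h.detZ.inj (hxz i) (hj ▸ hxz j) ▸ hs)
    · intro s hs
      obtain ⟨G, hg, -⟩ := hs.exists_gen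
      exact .inl ⟨s, hrefl fun i => (h.fresh_gen (h.gen.2 hg)).1⟩
    · rintro s _ t rfl hs ht
      exact ⟨t, ht, hrefl fun i => h.fresh_final ht⟩
    · rintro s _ _ rfl rfl; rfl
    · rintro s _ - rfl; rfl
    · intro p hp
      exact hrefl fun i => h.fresh_final (.inl hp)

end SMLL

namespace SMLL

/-! ### Movements at the links -/

theorem lmv_wire_iff {l : Link} (hb : ∀ e ds C, l ≠ .box e ds C) {p q : Pos} {G : Set Pos} :
    LMv l p q G ↔ ∃ P Q m, l.Wire P Q ∧ P.Enters m ∧ p = P.pos m ∧ q = Q.pos m ∧ G = l.guard := by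
  constructor
  · intro h
    cases h with
    | wire h hm => exact ⟨_, _, _, h, hm, rfl, rfl, rfl⟩
    | lock h => exact (hb _ _ _ h).elim
  · rintro ⟨P, Q, m, h, hm, rfl, rfl, rfl⟩
    exact .wire h hm

/-- The position of address `m` above a tensor or par link of premisses `a` and `b`. -/
def multPos (a b : Edge) : List Dir → Pos
  -- A default value: a compound formula has no atom at the empty address.
  | [] => .atom a []
  | .l :: m => .atom a m
  | .r :: m => .atom b m

theorem ax_lmv {x : Link} {e f : Edge} (hx : IsAx x e f) {p q : Pos} {G : Set Pos} :
    LMv x p q G ↔ ∃ m, ((e.ty.polarity m = some false ∧ p = .atom e m ∧ q = .atom f m) ∨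
      (f.ty.polarity m = some false ∧ p = .atom f m ∧ q = .atom e m)) ∧ G = ∅ := by
  rw [lmv_wire_iff (by rcases hx with rfl | rfl <;> simp)]
  constructor
  · rintro ⟨P, Q, m, h, hm, rfl, rfl, rfl⟩
    refine ⟨m, ?_, by rcases hx with rfl | rfl <;> rfl⟩
    rcases hx with rfl | rfl <;>
    · simp only [Link.Wire, Link.wires, List.mem_cons, List.not_mem_nil, or_false,
        Prod.mk.injEq] at h
      rcases h with ⟨rfl, rfl⟩ | ⟨rfl, rfl⟩
      · first | exact .inl ⟨hm, rfl, rfl⟩ | exact .inr ⟨hm, rfl, rfl⟩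
      · first | exact .inr ⟨hm, rfl, rfl⟩ | exact .inl ⟨hm, rfl, rfl⟩
  · rintro ⟨m, ⟨hm, rfl, rfl⟩ | ⟨hm, rfl, rfl⟩, rfl⟩
    · exact ⟨⟨e, false, []⟩, ⟨f, false, []⟩, m,
        by rcases hx with rfl | rfl <;> simp [Link.Wire, Link.wires], hm, rfl, rfl,
        by rcases hx with rfl | rfl <;> rfl⟩
    · exact ⟨⟨f, false, []⟩, ⟨e, false, []⟩, m,
        by rcases hx with rfl | rfl <;> simp [Link.Wire, Link.wires], hm, rfl, rfl,
        by rcases hx with rfl | rfl <;> rfl⟩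

theorem cut_lmv {y : Link} {e f : Edge} (hy : IsCut y e f) {p q : Pos} {G : Set Pos} :
    LMv y p q G ↔ ∃ m, ((e.ty.polarity m = some true ∧ p = .atom e m ∧ q = .atom f m) ∨
      (f.ty.polarity m = some true ∧ p = .atom f m ∧ q = .atom e m)) ∧ G = ∅ := by
  rw [lmv_wire_iff (by rcases hy with rfl | rfl <;> simp)]
  constructor
  · rintro ⟨P, Q, m, h, hm, rfl, rfl, rfl⟩
    refine ⟨m, ?_, by rcases hy with rfl | rfl <;> rfl⟩
    rcases hy with rfl | rfl <;>
    · simp only [Link.Wire, Link.wires, List.mem_cons, List.not_mem_nil, or_false,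
        Prod.mk.injEq] at h
      rcases h with ⟨rfl, rfl⟩ | ⟨rfl, rfl⟩
      · first | exact .inl ⟨hm, rfl, rfl⟩ | exact .inr ⟨hm, rfl, rfl⟩
      · first | exact .inr ⟨hm, rfl, rfl⟩ | exact .inl ⟨hm, rfl, rfl⟩
  · rintro ⟨m, ⟨hm, rfl, rfl⟩ | ⟨hm, rfl, rfl⟩, rfl⟩
    · exact ⟨⟨e, true, []⟩, ⟨f, true, []⟩, m,
        by rcases hy with rfl | rfl <;> simp [Link.Wire, Link.wires], hm, rfl, rfl,
        by rcases hy with rfl | rfl <;> rfl⟩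
    · exact ⟨⟨f, true, []⟩, ⟨e, true, []⟩, m,
        by rcases hy with rfl | rfl <;> simp [Link.Wire, Link.wires], hm, rfl, rfl,
        by rcases hy with rfl | rfl <;> rfl⟩

/-- `x` is a tensor or a par link. -/
def IsMult (x : Link) (a b c : Edge) : Prop := x = .tensor a b c ∨ x = .par a b c

theorem IsMult.polarity {x : Link} {a b c : Edge} (hx : IsMult x a b c) (ht : x.Typed) :
    c.ty.polarity [] = none ∧ ∀ m, c.ty.polarity (.l :: m) = a.ty.polarity m ∧
      c.ty.polarity (.r :: m) = b.ty.polarity m := by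
  rcases hx with rfl | rfl <;> simp only [Link.Typed] at ht <;> simp [ht, Formula.polarity]

/-- Indexing by the addresses in the conclusion `c` treats the two premisses as one family of
positions, as the commutation lemmas require. -/
theorem mult_lmv {x : Link} {a b c : Edge} (hx : IsMult x a b c) (ht : x.Typed) {p q : Pos}
    {G : Set Pos} : LMv x p q G ↔
      ∃ m, ((c.ty.polarity m = some true ∧ p = multPos a b m ∧ q = .atom c m) ∨
        (c.ty.polarity m = some false ∧ p = .atom c m ∧ q = multPos a b m)) ∧ G = ∅ := by
  obtain ⟨h0, hp⟩ := hx.polarity ht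
  rw [lmv_wire_iff (by rcases hx with rfl | rfl <;> simp)]
  have hw : ∀ P Q, x.Wire P Q ↔ ((P = ⟨a, true, []⟩ ∧ Q = ⟨c, false, [.l]⟩) ∨
      (P = ⟨b, true, []⟩ ∧ Q = ⟨c, false, [.r]⟩)) ∨ ((Q = ⟨a, true, []⟩ ∧ P = ⟨c, false, [.l]⟩) ∨
      (Q = ⟨b, true, []⟩ ∧ P = ⟨c, false, [.r]⟩)) := by
    intro P Q
    rcases hx with rfl | rfl <;> simp [Link.Wire, Link.wires]
  have hg : x.guard = ∅ := by rcases hx with rfl | rfl <;> rfl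
  simp only [hw, hg]
  constructor
  · rintro ⟨P, Q, m, (⟨rfl, rfl⟩ | ⟨rfl, rfl⟩) | (⟨rfl, rfl⟩ | ⟨rfl, rfl⟩), hm, rfl, rfl, rfl⟩
    · exact ⟨.l :: m, .inl ⟨(hp m).1.trans hm, rfl, rfl⟩, rfl⟩
    · exact ⟨.r :: m, .inl ⟨(hp m).2.trans hm, rfl, rfl⟩, rfl⟩
    · exact ⟨.l :: m, .inr ⟨hm, rfl, rfl⟩, rfl⟩
    · exact ⟨.r :: m, .inr ⟨hm, rfl, rfl⟩, rfl⟩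
  · rintro ⟨_ | ⟨_ | _, m⟩, ⟨hm, rfl, rfl⟩ | ⟨hm, rfl, rfl⟩, rfl⟩
    · simp [h0] at hm
    · simp [h0] at hm
    · exact ⟨_, _, m, .inl (.inl ⟨rfl, rfl⟩), (hp m).1.symm.trans hm, rfl, rfl, rfl⟩
    · exact ⟨_, _, m, .inr (.inl ⟨rfl, rfl⟩), hm, rfl, rfl, rfl⟩
    · exact ⟨_, _, m, .inl (.inr ⟨rfl, rfl⟩), (hp m).2.symm.trans hm, rfl, rfl, rfl⟩
    · exact ⟨_, _, m, .inr (.inr ⟨rfl, rfl⟩), hm, rfl, rfl, rfl⟩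

/-- The movements from and to the corresponding edges `a` and `b` of a sync link. -/
def PairMv (a b : Edge) (p q : Pos) : Prop :=
  ∃ m, (a.ty.polarity m = some true ∧ p = .atom a m ∧ q = .atom b m) ∨
    (b.ty.polarity m = some false ∧ p = .atom b m ∧ q = .atom a m)

/-- The movements through a sync link. -/
def SyncMv (ps : List (Edge × Edge)) (p q : Pos) : Prop := ∃ w ∈ ps, PairMv w.1 w.2 p q

/-- The guard is the set of the entries of all the pairs; in this form both the movements and the
guard split along the list of pairs. -/
theorem sync_lmv {ps : List (Edge × Edge)} {p q : Pos} {G : Set Pos} :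
    LMv (.sync ps) p q G ↔ SyncMv ps p q ∧ G = {g | ∃ q, SyncMv ps g q} := by
  have key : ∀ {p q}, (∃ G, LMv (.sync ps) p q G) ↔ SyncMv ps p q := by
    intro p q
    simp only [lmv_wire_iff (l := .sync ps) (by simp), Link.Wire, Link.wires, List.mem_map,
      Prod.mk.injEq]
    constructor
    · rintro ⟨G, P, Q, m, ⟨w, hw, rfl, rfl⟩ | ⟨w, hw, rfl, rfl⟩, hm, rfl, rfl, rfl⟩
      · exact ⟨w, hw, m, .inl ⟨hm, rfl, rfl⟩⟩
      · exact ⟨w, hw, m, .inr ⟨hm, rfl, rfl⟩⟩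
    · rintro ⟨w, hw, m, ⟨hm, rfl, rfl⟩ | ⟨hm, rfl, rfl⟩⟩
      · exact ⟨_, _, _, m, .inl ⟨w, hw, rfl, rfl⟩, hm, rfl, rfl, rfl⟩
      · exact ⟨_, _, _, m, .inr ⟨w, hw, rfl, rfl⟩, hm, rfl, rfl, rfl⟩
  have hg : (Link.sync ps).guard = {g | ∃ q, SyncMv ps g q} := by
    ext g
    rw [mem_sync_guard, Set.mem_ofPred_eq]
    exact exists_congr fun q => key
  constructor
  · intro h
    exact ⟨key.1 ⟨G, h⟩, (sync_guard_eq h).trans hg⟩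
  · rintro ⟨h, rfl⟩
    obtain ⟨G, h⟩ := key.2 h
    rwa [← hg, ← sync_guard_eq h]

theorem syncMv_split {ps qs rs : List (Edge × Edge)} {p q : Pos} :
    SyncMv (ps ++ (rs ++ qs)) p q ↔ SyncMv rs p q ∨ SyncMv (ps ++ qs) p q := by
  simp only [SyncMv, List.mem_append]
  constructor
  · rintro ⟨w, h | h | h, hw⟩
    · exact .inr ⟨w, .inl h, hw⟩
    · exact .inl ⟨w, h, hw⟩
    · exact .inr ⟨w, .inr h, hw⟩
  · rintro (⟨w, h, hw⟩ | ⟨w, h | h, hw⟩)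
    · exact ⟨w, .inr (.inl h), hw⟩
    · exact ⟨w, .inl h, hw⟩
    · exact ⟨w, .inr (.inr h), hw⟩

theorem pairMv_pos {a b : Edge} (ha : a.ty.Positive) (hab : a.ty = b.ty) {p q : Pos} :
    PairMv a b p q ↔ ∃ m, a.ty.polarity m ≠ none ∧ p = .atom a m ∧ q = .atom b m := by
  constructor
  · rintro ⟨m, ⟨hm, rfl, rfl⟩ | ⟨hm, rfl, rfl⟩⟩
    · exact ⟨m, by simp [hm], rfl, rfl⟩
    · rw [← hab] at hm
      have := ha.polarity (m := m) (by simp [hm])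
      rw [hm] at this; cases this
  · rintro ⟨m, hm, rfl, rfl⟩
    exact ⟨m, .inl ⟨ha.polarity hm, rfl, rfl⟩⟩

theorem pairMv_neg {a b : Edge} (ha : a.ty.Negative) (hab : a.ty = b.ty) {p q : Pos} :
    PairMv a b p q ↔ ∃ m, a.ty.polarity m ≠ none ∧ p = .atom b m ∧ q = .atom a m := by
  constructor
  · rintro ⟨m, ⟨hm, rfl, rfl⟩ | ⟨hm, rfl, rfl⟩⟩
    · have := ha.polarity (m := m) (by simp [hm])
      rw [hm] at this; cases this
    · exact ⟨m, by simp [hab, hm], rfl, rfl⟩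
  · rintro ⟨m, hm, rfl, rfl⟩
    exact ⟨m, .inr ⟨hab ▸ ha.polarity hm, rfl, rfl⟩⟩

/-- A position on an edge of the link `l`, or on a lock. -/
def Link.Touches (l : Link) (p : Pos) : Prop :=
  ∀ e m, p = .atom e m → e ∈ l.concls ∨ e ∈ l.targets

theorem Link.Wire.touches {l : Link} {P Q : Port} (h : l.Wire P Q) (m : List Dir) :
    l.Touches (P.pos m) := by
  rintro e m' he
  simp only [Port.pos, Pos.atom.injEq] at he
  obtain ⟨rfl, -⟩ := he
  exact h.mem.symm.imp And.right And.right

theorem Link.guard_touches {l : Link} {g : Pos} (hg : g ∈ l.guard) : l.Touches g := by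
  cases l with
  | sync ps => obtain ⟨P, Q, m, h, -, rfl⟩ := hg; exact h.touches m
  | box e ds C => obtain rfl : g = _ := hg; rintro e m ⟨⟩
  | _ => exact hg.elim

theorem LMv.touches {l : Link} {p q : Pos} {G : Set Pos} (h : LMv l p q G) :
    l.Touches p ∧ l.Touches q ∧ ∀ g ∈ G, l.Touches g := by
  cases h with
  | wire h hm => exact ⟨h.touches _, h.symm.touches _, fun g => Link.guard_touches⟩
  | lock hb =>
    subst hb
    refine ⟨?_, by rintro e m ⟨⟩, fun g hg => hg.elim⟩
    rintro e m ⟨⟩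
    exact .inl (.head _)

/-! ### Commutation of sync links with other links -/

theorem sys_congr {Λ Λ' : List (Option Edge × Link)} (h : Λ.Perm Λ') (Γ : List Edge) :
    sys Λ Γ = sys Λ' Γ := by
  simp only [sys, h.mem_iff]

/-- An edge has one source and at most one target; if both lie in `A`, it occurs nowhere else. -/
theorem Flat.outside {A Λ : List (Option Edge × Link)} {Γ : List Edge} (h : Flat (A ++ Λ) Γ)
    {e : Edge} (hc : e ∈ A.flatMap fun x => x.2.concls) (ht : e ∈ A.flatMap fun x => x.2.targets) :
    e ∉ Γ ∧ ∀ l ∈ Λ, e ∉ l.2.concls ∧ e ∉ l.2.targets := by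
  have h1 := h.nodup
  have h2 := h.targets_nodup
  rw [List.flatMap_append, List.nodup_append] at h1
  rw [List.flatMap_append, List.append_assoc, List.nodup_append] at h2
  refine ⟨fun he => h2.2.2 e ht e (List.mem_append_right _ he) rfl, fun l hl => ⟨fun he => ?_, fun he => ?_⟩⟩
  · exact h1.2.2 e hc e (List.mem_flatMap.2 ⟨l, hl, he⟩) rfl
  · exact h2.2.2 e ht e (List.mem_append_left _ (List.mem_flatMap.2 ⟨l, hl, he⟩)) rfl

theorem Flat.left_nodup {A Λ : List (Option Edge × Link)} {Γ : List Edge} (h : Flat (A ++ Λ) Γ) :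
    (A.flatMap fun x => x.2.concls).Nodup ∧ (A.flatMap fun x => x.2.targets).Nodup := by
  have h1 := h.nodup
  have h2 := h.targets_nodup
  rw [List.flatMap_append, List.nodup_append] at h1
  rw [List.flatMap_append, List.append_assoc, List.nodup_append] at h2
  exact ⟨h1.1, h2.1⟩

/-- The position `p` is not on one of the edges `E`. -/
def Avoids (E : Edge → Prop) (p : Pos) : Prop := ∀ e m, p = .atom e m → ¬ E e

theorem Link.Touches.avoids {E : Edge → Prop} {l : Link} {p : Pos} (h : l.Touches p)
    (hl : ∀ e, E e → e ∉ l.concls ∧ e ∉ l.targets) : Avoids E p := by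
  intro e m hp he
  rcases h e m hp with h | h
  · exact (hl e he).1 h
  · exact (hl e he).2 h

theorem Final.avoids {E : Edge → Prop} {Γ : List Edge} {t : Pos} (h : Final Γ t)
    (hE : ∀ e, E e → e ∉ Γ) : Avoids E t := by
  rintro e m rfl he
  rcases h with ⟨e', h, m', -, hp⟩ | ⟨e', h⟩
  · cases hp; exact hE e he h
  · cases h

theorem gen_avoids {E : Edge → Prop} {A Λ : List (Option Edge × Link)} {Γ : List Edge} {p : Pos}
    {G : Set Pos} (h : (sys (A ++ Λ) Γ).Gen p G) (hA : ∀ x ∈ A, ∀ e, x.2 ≠ .one e)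
    (hΛ : ∀ l ∈ Λ, ∀ e, E e → e ∉ l.2.concls) (hΓ : ∀ e, E e → e ∉ Γ) :
    Avoids E p ∧ ∀ g ∈ G, Avoids E g := by
  rcases h with ⟨⟨e, he, m, -, rfl⟩, rfl⟩ | ⟨b, e, hl, rfl, rfl⟩
  · refine ⟨?_, by simp⟩
    rintro e' m' ⟨⟩ h
    exact hΓ e h he
  · refine ⟨?_, ?_⟩
    · rintro e' m' ⟨⟩ h
      rcases List.mem_append.1 hl with hl | hl
      · exact hA _ hl e rfl
      · exact hΛ _ hl e h (.head _)
    · rintro g ⟨e', -, rfl⟩ e m ⟨⟩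

theorem gen_congr {A A' Λ : List (Option Edge × Link)} {Γ : List Edge} {p : Pos} {G : Set Pos}
    (hA : ∀ x ∈ A, ∀ e, x.2 ≠ .one e) (hA' : ∀ x ∈ A', ∀ e, x.2 ≠ .one e) :
    (sys (A ++ Λ) Γ).Gen p G ↔ (sys (A' ++ Λ) Γ).Gen p G := by
  have : ∀ b e, (b, Link.one e) ∈ A ++ Λ ↔ (b, Link.one e) ∈ A' ++ Λ := by
    intro b e
    simp only [List.mem_append]
    exact or_congr_left ⟨fun h => (hA _ h e rfl).elim, fun h => (hA' _ h e rfl).elim⟩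
  simp only [sys, this]

/-- Here `ps` collects the pairs of the sync link that the step leaves alone, `X` and `W` are the
other link before and after, and `E` holds of the edges lying between that link and the sync link.
These edges are internal to the redex or to its reduct, whence all the freshness conditions of
`Commute`. -/
theorem commute_links {Λ : List (Option Edge × Link)} {Γ : List Edge}
    {PY PZ ps : List (Edge × Edge)} {X W : Link} {ι : Type} {x y y' z : ι → Pos} (E : Edge → Prop)
    (hY : Flat ([(none, .sync PY), (none, X)] ++ Λ) Γ)
    (hZ : Flat ([(none, .sync PZ), (none, W)] ++ Λ) Γ)
    (hX : ∀ p q G, LMv X p q G ↔ ∃ i, p = x i ∧ q = y i ∧ G = ∅)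
    (hW : ∀ p q G, LMv W p q G ↔ ∃ i, p = y' i ∧ q = z i ∧ G = ∅)
    (hPY : ∀ p q, SyncMv PY p q ↔ (∃ i, p = y i ∧ q = z i) ∨ SyncMv ps p q)
    (hPZ : ∀ p q, SyncMv PZ p q ↔ (∃ i, p = x i ∧ q = y' i) ∨ SyncMv ps p q)
    (oneX : ∀ e, X ≠ .one e) (oneW : ∀ e, W ≠ .one e)
    (hy : ∀ i, ∃ e m, y i = .atom e m ∧ E e) (hy' : ∀ i, ∃ e m, y' i = .atom e m ∧ E e)
    (hx : ∀ i, Avoids E (x i)) (hz : ∀ i, Avoids E (z i))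
    (hE : ∀ e, E e → (e ∉ Γ ∧ ∀ l ∈ Λ, e ∉ l.2.concls ∧ e ∉ l.2.targets) ∧
      ∀ w ∈ ps, e ≠ w.1 ∧ e ≠ w.2) :
    Equi Γ (sys ([(none, .sync PY), (none, X)] ++ Λ) Γ)
      (sys ([(none, .sync PZ), (none, W)] ++ Λ) Γ) := by
  have hav : ∀ {p i}, Avoids E p → p ≠ y i ∧ p ≠ y' i := by
    intro p i hp
    obtain ⟨e, m, he, hE⟩ := hy i
    obtain ⟨e', m', he', hE'⟩ := hy' i
    exact ⟨fun h => hp _ _ (h.trans he) hE, fun h => hp _ _ (h.trans he') hE'⟩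
  have hone : ∀ (P : List (Edge × Edge)) (X : Link), (∀ e, X ≠ .one e) →
      ∀ x ∈ ([(none, Link.sync P), (none, X)] : List (Option Edge × Link)), ∀ e, x.2 ≠ .one e := by
    intro P X hX x hx e
    simp only [List.mem_cons, List.not_mem_nil, or_false] at hx
    rcases hx with rfl | rfl
    · simp
    · exact hX e
  have hmv : ∀ (P : List (Edge × Edge)) (X : Link) {p q G},
      (sys ([(none, .sync P), (none, X)] ++ Λ) Γ).Mv p q G ↔
        (∃ b l, (b, l) ∈ Λ ∧ LMv l p q G) ∨ LMv X p q G ∨ LMv (.sync P) p q G := by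
    intro P X p q G
    simp only [sys, List.mem_append, List.mem_cons, List.not_mem_nil, or_false, Prod.mk.injEq]
    constructor
    · rintro ⟨b, l, (⟨rfl, rfl⟩ | ⟨rfl, rfl⟩) | hl, h⟩
      · exact .inr (.inr h)
      · exact .inr (.inl h)
      · exact .inl ⟨b, l, hl, h⟩
    · rintro (⟨b, l, hl, h⟩ | h | h)
      · exact ⟨b, l, .inr hl, h⟩
      · exact ⟨_, _, .inl (.inr ⟨rfl, rfl⟩), h⟩
      · exact ⟨_, _, .inl (.inl ⟨rfl, rfl⟩), h⟩
  have hsync : ∀ {p q}, SyncMv ps p q → Avoids E p ∧ Avoids E q := by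
    rintro p q ⟨w, hw, m, ⟨-, rfl, rfl⟩ | ⟨-, rfl, rfl⟩⟩ <;> constructor <;>
    · rintro e m' h he
      cases h
      have := (hE _ he).2 w hw
      simp at this
  refine Commute.equi (x := x) (y := y) (y' := y') (z := z) (T := SyncMv ps)
    (M := fun p q G => ∃ b l, (b, l) ∈ Λ ∧ LMv l p q G) (G₀ := {g | ∃ q, SyncMv ps g q})
    ⟨hY.det, hZ.det, gen_congr (hone _ _ oneX) (hone _ _ oneW), ?_, ?_, ?_, ?_, ?_, ?_,
      hav (hx _), hav (hz _), ?_⟩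
  · intro p q G
    rw [hmv, hX, sync_lmv, hPY]
    have : {g | ∃ q, SyncMv PY g q} = {g | g ∈ {g | ∃ q, SyncMv ps g q} ∨ ∃ i, g = y i} := by
      ext g
      simp only [hPY, Set.mem_ofPred_eq]
      constructor
      · rintro ⟨q, ⟨i, h, -⟩ | h⟩
        · exact .inr ⟨i, h⟩
        · exact .inl ⟨q, h⟩
      · rintro (⟨q, h⟩ | ⟨i, h⟩)
        · exact ⟨q, .inr h⟩
        · exact ⟨z i, .inl ⟨i, h, rfl⟩⟩
    rw [this]
  · intro p q G
    rw [hmv, hW, sync_lmv, hPZ]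
    have : {g | ∃ q, SyncMv PZ g q} = {g | g ∈ {g | ∃ q, SyncMv ps g q} ∨ ∃ i, g = x i} := by
      ext g
      simp only [hPZ, Set.mem_ofPred_eq]
      constructor
      · rintro ⟨q, ⟨i, h, -⟩ | h⟩
        · exact .inr ⟨i, h⟩
        · exact .inl ⟨q, h⟩
      · rintro (⟨q, h⟩ | ⟨i, h⟩)
        · exact ⟨q, .inr h⟩
        · exact ⟨y' i, .inl ⟨i, h, rfl⟩⟩
    rw [this]
  · intro p G i h
    obtain ⟨h1, h2⟩ := gen_avoids (E := E) h (hone _ _ oneX) (fun l hl e he => ((hE e he).1.2 l hl).1)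
      (fun e he => (hE e he).1.1)
    exact ⟨hav h1, fun g hg => hav (h2 g hg)⟩
  · rintro p q G i ⟨b, l, hl, h⟩
    obtain ⟨h1, h2, h3⟩ := h.touches
    have : ∀ e, E e → e ∉ l.concls ∧ e ∉ l.targets := fun e he => (hE e he).1.2 _ hl
    exact ⟨hav (h1.avoids this), hav (h2.avoids this), fun g hg => hav ((h3 g hg).avoids this)⟩
  · intro p q i h
    exact ⟨hav (hsync h).1, hav (hsync h).2⟩
  · rintro g i ⟨q, h⟩
    exact hav (hsync h).1
  · intro t i ht
    exact hav (ht.avoids fun e he => (hE e he).1.1)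

end SMLL

namespace SMLL

-- The edges between a sync link and its neighbour

section SyncLink
variable {Λ : List (Option Edge × Link)} {Γ : List Edge} {ps rs qs : List (Edge × Edge)} {X : Link}
  (h : Flat ([(none, .sync (ps ++ (rs ++ qs))), (none, X)] ++ Λ) Γ)
include h

theorem Flat.sync_ne {e e' : Edge} (he : (e ∈ rs.map Prod.fst ∧ e' ∈ X.targets) ∨
    (e ∈ rs.map Prod.snd ∧ e' ∈ X.concls)) : e ≠ e' := by
  obtain ⟨hc, ht⟩ := h.left_nodup
  simp only [List.flatMap_cons, List.flatMap_nil, List.append_nil, Link.concls, Link.targets,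
    Link.prems, List.map_append] at hc ht
  rcases he with ⟨h1, h2⟩ | ⟨h1, h2⟩
  · exact (List.nodup_append.1 ht).2.2 e (by simp only [List.mem_append]; tauto) e' h2
  · exact (List.nodup_append.1 hc).2.2 e (by simp only [List.mem_append]; tauto) e' h2

theorem Flat.sync_outside {e : Edge} (he : (e ∈ rs.map Prod.fst ∧ e ∈ X.concls) ∨
    (e ∈ rs.map Prod.snd ∧ e ∈ X.targets)) :
    (e ∉ Γ ∧ ∀ l ∈ Λ, e ∉ l.2.concls ∧ e ∉ l.2.targets) ∧ ∀ w ∈ ps ++ qs, e ≠ w.1 ∧ e ≠ w.2 := by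
  obtain ⟨hc, ht⟩ := h.left_nodup
  simp only [List.flatMap_cons, List.flatMap_nil, List.append_nil, Link.concls, Link.targets,
    Link.prems, List.map_append] at hc ht
  have hw : ∀ w ∈ ps ++ qs, (w.1 ∈ ps.map Prod.fst ++ qs.map Prod.fst) ∧
      (w.2 ∈ ps.map Prod.snd ++ qs.map Prod.snd) := by
    intro w hw
    rw [← List.map_append, ← List.map_append]
    exact ⟨List.mem_map_of_mem hw, List.mem_map_of_mem hw⟩
  have aux : ∀ {A B C : List Edge}, (A ++ (B ++ C)).Nodup → ∀ e ∈ B, ∀ w ∈ A ++ C, e ≠ w := by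
    intro A B C hn e he w hw
    have : (B ++ (A ++ C)).Nodup := by
      refine (List.Perm.nodup_iff ?_).1 hn
      rw [List.perm_iff_count]; intro x; simp only [List.count_append]; omega
    exact (List.nodup_append.1 this).2.2 e he w hw
  have hsub : ∀ {A B C : List Edge} {w : Edge}, w ∈ A ++ C → w ∈ A ++ (B ++ C) := by
    intro A B C w; simp only [List.mem_append]; tauto
  have hmid : ∀ {A B C : List Edge} {w : Edge}, w ∈ B → w ∈ A ++ (B ++ C) := by
    intro A B C w; simp only [List.mem_append]; tauto
  rcases he with ⟨h1, h2⟩ | ⟨h1, h2⟩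
  · refine ⟨h.outside (e := e) ?_ ?_, fun w hw' => ⟨?_, ?_⟩⟩
    · simp only [List.flatMap_cons, List.mem_append]; exact .inr (.inl h2)
    · simp only [List.flatMap_cons, List.mem_append, Link.targets, Link.prems, List.map_append]
      exact .inl (.inr (.inl h1))
    · exact aux (List.nodup_append.1 ht).1 e h1 _ (hw w hw').1
    · exact ((List.nodup_append.1 hc).2.2 _ (hsub (hw w hw').2) _ h2).symm
  · refine ⟨h.outside (e := e) ?_ ?_, fun w hw' => ⟨?_, ?_⟩⟩
    · simp only [List.flatMap_cons, List.mem_append, Link.concls, List.map_append]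
      exact .inl (.inr (.inl h1))
    · simp only [List.flatMap_cons, List.mem_append]; exact .inr (.inl h2)
    · exact ((List.nodup_append.1 ht).2.2 _ (hsub (hw w hw').1) _ h2).symm
    · exact aux (List.nodup_append.1 hc).1 e h1 _ (hw w hw').2

theorem Flat.sync_typed {w : Edge × Edge} (hw : w ∈ rs) :
    w.1.ty = w.2.ty ∧ (w.1.ty.Positive ∨ w.1.ty.Negative) :=
  (h.typed (none, .sync (ps ++ (rs ++ qs))) (by simp)).2 w (by simp [hw])

theorem Flat.link_typed : X.Typed := h.typed (none, X) (by simp)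

end SyncLink

-- The commuting steps and the tensor/par step, at the level of systems

section
variable {Λ : List (Option Edge × Link)} {Γ : List Edge} {ps qs : List (Edge × Edge)}

theorem multPos_cases {u v : Edge} (C : Pos → Prop) (hu : ∀ m, C (.atom u m))
    (hv : ∀ m, C (.atom v m)) (m : List Dir) : C (multPos u v m) := by
  rcases m with _ | ⟨_ | _, m⟩
  · exact hu _
  · exact hu _
  · exact hv _

theorem syncMv_mult_pos {a b a' b' : Edge} {A : Formula}
    (hAp : A.polarity [] = none ∧ ∀ m, A.polarity (.l :: m) = a.ty.polarity m ∧
      A.polarity (.r :: m) = b.ty.polarity m)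
    (ha : a.ty = a'.ty) (hb : b.ty = b'.ty) (hap : a.ty.Positive) (hbp : b.ty.Positive) {p q : Pos} :
    SyncMv [(a, a'), (b, b')] p q ↔ ∃ i : {m // A.polarity m ≠ none},
      p = multPos a b i ∧ q = multPos a' b' i := by
  simp only [SyncMv, List.mem_cons, List.not_mem_nil, or_false, exists_eq_or_imp, exists_eq_left,
    pairMv_pos hap ha, pairMv_pos hbp hb]
  constructor
  · rintro (⟨m, hm, rfl, rfl⟩ | ⟨m, hm, rfl, rfl⟩)
    · exact ⟨⟨.l :: m, by rwa [(hAp.2 m).1]⟩, rfl, rfl⟩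
    · exact ⟨⟨.r :: m, by rwa [(hAp.2 m).2]⟩, rfl, rfl⟩
  · rintro ⟨⟨_ | ⟨_ | _, m⟩, hm⟩, rfl, rfl⟩
    · exact (hm hAp.1).elim
    · exact .inl ⟨m, by rwa [(hAp.2 m).1] at hm, rfl, rfl⟩
    · exact .inr ⟨m, by rwa [(hAp.2 m).2] at hm, rfl, rfl⟩

theorem syncMv_mult_neg {a b a' b' : Edge} {A : Formula}
    (hAp : A.polarity [] = none ∧ ∀ m, A.polarity (.l :: m) = a.ty.polarity m ∧
      A.polarity (.r :: m) = b.ty.polarity m)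
    (ha : a.ty = a'.ty) (hb : b.ty = b'.ty) (hap : a.ty.Negative) (hbp : b.ty.Negative) {p q : Pos} :
    SyncMv [(a, a'), (b, b')] p q ↔ ∃ i : {m // A.polarity m ≠ none},
      p = multPos a' b' i ∧ q = multPos a b i := by
  simp only [SyncMv, List.mem_cons, List.not_mem_nil, or_false, exists_eq_or_imp, exists_eq_left,
    pairMv_neg hap ha, pairMv_neg hbp hb]
  constructor
  · rintro (⟨m, hm, rfl, rfl⟩ | ⟨m, hm, rfl, rfl⟩)
    · exact ⟨⟨.l :: m, by rwa [(hAp.2 m).1]⟩, rfl, rfl⟩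
    · exact ⟨⟨.r :: m, by rwa [(hAp.2 m).2]⟩, rfl, rfl⟩
  · rintro ⟨⟨_ | ⟨_ | _, m⟩, hm⟩, rfl, rfl⟩
    · exact (hm hAp.1).elim
    · exact .inl ⟨m, by rwa [(hAp.2 m).1] at hm, rfl, rfl⟩
    · exact .inr ⟨m, by rwa [(hAp.2 m).2] at hm, rfl, rfl⟩

theorem mult_lmv_pos {x : Link} {a b c : Edge} (hx : IsMult x a b c) (ht : x.Typed)
    {A : Formula} (hcA : c.ty = A) (hA : A.Positive) {p q : Pos} {G : Set Pos} :
    LMv x p q G ↔ ∃ i : {m // A.polarity m ≠ none}, p = multPos a b i ∧ q = .atom c i ∧ G = ∅ := by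
  subst hcA
  rw [mult_lmv hx ht]
  constructor
  · rintro ⟨m, ⟨hm, rfl, rfl⟩ | ⟨hm, rfl, rfl⟩, rfl⟩
    · exact ⟨⟨m, by simp [hm]⟩, rfl, rfl, rfl⟩
    · have := hA.polarity (m := m) (by simp [hm])
      rw [hm] at this; cases this
  · rintro ⟨⟨m, hm⟩, rfl, rfl, rfl⟩
    exact ⟨m, .inl ⟨hA.polarity hm, rfl, rfl⟩, rfl⟩

theorem mult_lmv_neg {x : Link} {a b c : Edge} (hx : IsMult x a b c) (ht : x.Typed)
    {A : Formula} (hcA : c.ty = A) (hA : A.Negative) {p q : Pos} {G : Set Pos} :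
    LMv x p q G ↔ ∃ i : {m // A.polarity m ≠ none}, p = .atom c i ∧ q = multPos a b i ∧ G = ∅ := by
  subst hcA
  rw [mult_lmv hx ht]
  constructor
  · rintro ⟨m, ⟨hm, rfl, rfl⟩ | ⟨hm, rfl, rfl⟩, rfl⟩
    · have := hA.polarity (m := m) (by simp [hm])
      rw [hm] at this; cases this
    · exact ⟨⟨m, by simp [hm]⟩, rfl, rfl, rfl⟩
  · rintro ⟨⟨m, hm⟩, rfl, rfl, rfl⟩
    exact ⟨m, .inr ⟨hA.polarity hm, rfl, rfl⟩, rfl⟩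

theorem avoids_atom {E : Edge → Prop} {e : Edge} (he : ¬ E e) (m : List Dir) :
    Avoids E (.atom e m) := by
  rintro e' m' ⟨⟩; exact he

/-- Tokens go down. Before the step: from `a`, `b` freely to `c`, then synchronized to `d`. After
it: synchronized to `a'`, `b'`, then freely to `d`. -/
theorem equi_sync_tensor {a b c d a' b' : Edge}
    (hR : Flat ([(none, .sync (ps ++ (c, d) :: qs)), (none, .tensor a b c)] ++ Λ) Γ)
    (hS : Flat ([(none, .sync (ps ++ (a, a') :: (b, b') :: qs)), (none, .tensor a' b' d)] ++ Λ) Γ) :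
    Equi Γ (sys ([(none, .sync (ps ++ (c, d) :: qs)), (none, .tensor a b c)] ++ Λ) Γ)
      (sys ([(none, .sync (ps ++ (a, a') :: (b, b') :: qs)), (none, .tensor a' b' d)] ++ Λ) Γ) := by
  have hR' : Flat ([(none, .sync (ps ++ ([(c, d)] ++ qs))), (none, .tensor a b c)] ++ Λ) Γ := hR
  have hS' : Flat ([(none, .sync (ps ++ ([(a, a'), (b, b')] ++ qs))), (none, .tensor a' b' d)] ++ Λ)
    Γ := hS
  have hc := hR'.sync_typed (w := (c, d)) (by simp)
  have ha := hS'.sync_typed (w := (a, a')) (by simp)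
  have hb := hS'.sync_typed (w := (b, b')) (by simp)
  have hcpos : c.ty.Positive := by
    -- A tensor formula is never negative, so the pair `(c, d)` must be positive.
    refine hc.2.resolve_right fun hn => ?_
    rw [show c.ty = _ from hR'.link_typed] at hn
    exact hn
  have habpos : a.ty.Positive ∧ b.ty.Positive := by
    have := hcpos; rwa [show c.ty = _ from hR'.link_typed] at this
  refine commute_links (ps := ps ++ qs) (ι := {m // c.ty.polarity m ≠ none})
    (x := fun i => multPos a b i)
    (y := fun i => .atom c i) (y' := fun i => multPos a' b' i) (z := fun i => .atom d i)
    (fun e => e = c ∨ e = a' ∨ e = b') hR hS ?_ ?_ ?_ ?_ (by simp) (by simp) ?_ ?_ ?_ ?_ ?_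
  · exact fun p q G => mult_lmv_pos (.inl rfl) hR'.link_typed rfl hcpos
  · exact fun p q G => mult_lmv_pos (.inl rfl) hS'.link_typed hc.1.symm hcpos
  · intro p q
    rw [show ps ++ (c, d) :: qs = ps ++ ([(c, d)] ++ qs) from rfl, syncMv_split]
    refine or_congr_left ?_
    simp only [SyncMv, List.mem_singleton, exists_eq_left, pairMv_pos hcpos hc.1, Subtype.exists,
      exists_prop]
  · intro p q
    rw [show ps ++ (a, a') :: (b, b') :: qs = ps ++ ([(a, a'), (b, b')] ++ qs) from rfl, syncMv_split]
    exact or_congr_left (syncMv_mult_pos (IsMult.polarity (.inl rfl) hR'.link_typed) ha.1 hb.1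
      habpos.1 habpos.2)
  · exact fun i => ⟨_, _, rfl, .inl rfl⟩
  · exact fun i => multPos_cases (fun p => ∃ e m, p = .atom e m ∧ (e = c ∨ e = a' ∨ e = b'))
      (fun m => ⟨_, _, rfl, .inr (.inl rfl)⟩) (fun m => ⟨_, _, rfl, .inr (.inr rfl)⟩) _
  · intro i
    refine multPos_cases _ (avoids_atom ?_) (avoids_atom ?_) _
    · rintro (h | h | h)
      · exact hR'.sync_ne (.inl ⟨by simp, by simp [Link.targets, Link.prems]⟩) h.symm
      · exact hS'.sync_ne (.inl ⟨by simp, by simp [Link.targets, Link.prems]⟩) h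
      · exact hS'.sync_ne (.inl ⟨by simp, by simp [Link.targets, Link.prems]⟩) h
    · rintro (h | h | h)
      · exact hR'.sync_ne (.inl ⟨by simp, by simp [Link.targets, Link.prems]⟩) h.symm
      · exact hS'.sync_ne (.inl ⟨by simp, by simp [Link.targets, Link.prems]⟩) h
      · exact hS'.sync_ne (.inl ⟨by simp, by simp [Link.targets, Link.prems]⟩) h
  · intro i
    refine avoids_atom ?_ _
    rintro (h | h | h)
    · exact hR'.sync_ne (.inr ⟨by simp, by simp [Link.concls]⟩) h
    · exact hS'.sync_ne (.inr ⟨by simp, by simp [Link.concls]⟩) h.symm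
    · exact hS'.sync_ne (.inr ⟨by simp, by simp [Link.concls]⟩) h.symm
  · rintro e (rfl | rfl | rfl)
    · exact hR'.sync_outside (.inl ⟨by simp, by simp [Link.concls]⟩)
    · exact hS'.sync_outside (.inr ⟨by simp, by simp [Link.targets, Link.prems]⟩)
    · exact hS'.sync_outside (.inr ⟨by simp, by simp [Link.targets, Link.prems]⟩)

/-- Tokens now go up, from `d` to `a`, `b`. The free movement comes first after the step, so the two
structures exchange their roles in `commute_links`. -/
theorem equi_sync_par {a b c d a' b' : Edge}
    (hR : Flat ([(none, .sync (ps ++ (c, d) :: qs)), (none, .par a b c)] ++ Λ) Γ)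
    (hS : Flat ([(none, .sync (ps ++ (a, a') :: (b, b') :: qs)), (none, .par a' b' d)] ++ Λ) Γ) :
    Equi Γ (sys ([(none, .sync (ps ++ (c, d) :: qs)), (none, .par a b c)] ++ Λ) Γ)
      (sys ([(none, .sync (ps ++ (a, a') :: (b, b') :: qs)), (none, .par a' b' d)] ++ Λ) Γ) := by
  have hR' : Flat ([(none, .sync (ps ++ ([(c, d)] ++ qs))), (none, .par a b c)] ++ Λ) Γ := hR
  have hS' : Flat ([(none, .sync (ps ++ ([(a, a'), (b, b')] ++ qs))), (none, .par a' b' d)] ++ Λ)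
    Γ := hS
  have hc := hR'.sync_typed (w := (c, d)) (by simp)
  have ha := hS'.sync_typed (w := (a, a')) (by simp)
  have hb := hS'.sync_typed (w := (b, b')) (by simp)
  have hcneg : c.ty.Negative := by
    refine hc.2.resolve_left fun hn => ?_
    rw [show c.ty = _ from hR'.link_typed] at hn
    exact hn
  have habneg : a.ty.Negative ∧ b.ty.Negative := by
    have := hcneg; rwa [show c.ty = _ from hR'.link_typed] at this
  refine Equi.symm (commute_links (ps := ps ++ qs) (ι := {m // c.ty.polarity m ≠ none})
    (z := fun i => multPos a b i)
    (y' := fun i => .atom c i) (y := fun i => multPos a' b' i) (x := fun i => .atom d i)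
    (fun e => e = c ∨ e = a' ∨ e = b') hS hR ?_ ?_ ?_ ?_ (by simp) (by simp) ?_ ?_ ?_ ?_ ?_)
  · exact fun p q G => mult_lmv_neg (.inr rfl) hS'.link_typed hc.1.symm hcneg
  · exact fun p q G => mult_lmv_neg (.inr rfl) hR'.link_typed rfl hcneg
  · intro p q
    rw [show ps ++ (a, a') :: (b, b') :: qs = ps ++ ([(a, a'), (b, b')] ++ qs) from rfl, syncMv_split]
    exact or_congr_left (syncMv_mult_neg (IsMult.polarity (.inr rfl) hR'.link_typed) ha.1 hb.1
      habneg.1 habneg.2)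
  · intro p q
    rw [show ps ++ (c, d) :: qs = ps ++ ([(c, d)] ++ qs) from rfl, syncMv_split]
    refine or_congr_left ?_
    simp only [SyncMv, List.mem_singleton, exists_eq_left, pairMv_neg hcneg hc.1, Subtype.exists,
      exists_prop]
  · exact fun i => multPos_cases (fun p => ∃ e m, p = .atom e m ∧ (e = c ∨ e = a' ∨ e = b'))
      (fun m => ⟨_, _, rfl, .inr (.inl rfl)⟩) (fun m => ⟨_, _, rfl, .inr (.inr rfl)⟩) _
  · exact fun i => ⟨_, _, rfl, .inl rfl⟩
  · intro i
    refine avoids_atom ?_ _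
    rintro (h | h | h)
    · exact hR'.sync_ne (.inr ⟨by simp, by simp [Link.concls]⟩) h
    · exact hS'.sync_ne (.inr ⟨by simp, by simp [Link.concls]⟩) h.symm
    · exact hS'.sync_ne (.inr ⟨by simp, by simp [Link.concls]⟩) h.symm
  · intro i
    refine multPos_cases _ (avoids_atom ?_) (avoids_atom ?_) _
    · rintro (h | h | h)
      · exact hR'.sync_ne (.inl ⟨by simp, by simp [Link.targets, Link.prems]⟩) h.symm
      · exact hS'.sync_ne (.inl ⟨by simp, by simp [Link.targets, Link.prems]⟩) h
      · exact hS'.sync_ne (.inl ⟨by simp, by simp [Link.targets, Link.prems]⟩) h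
    · rintro (h | h | h)
      · exact hR'.sync_ne (.inl ⟨by simp, by simp [Link.targets, Link.prems]⟩) h.symm
      · exact hS'.sync_ne (.inl ⟨by simp, by simp [Link.targets, Link.prems]⟩) h
      · exact hS'.sync_ne (.inl ⟨by simp, by simp [Link.targets, Link.prems]⟩) h
  · rintro e (rfl | rfl | rfl)
    · exact hR'.sync_outside (.inl ⟨by simp, by simp [Link.concls]⟩)
    · exact hS'.sync_outside (.inr ⟨by simp, by simp [Link.targets, Link.prems]⟩)
    · exact hS'.sync_outside (.inr ⟨by simp, by simp [Link.targets, Link.prems]⟩)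

theorem IsAx.mem {x : Link} {e f : Edge} (hx : IsAx x e f) : e ∈ x.concls ∧ f ∈ x.concls := by
  rcases hx with rfl | rfl <;> simp [Link.concls]

theorem IsAx.dual {x : Link} {e f : Edge} (hx : IsAx x e f) (ht : x.Typed) : f.ty = e.ty.dual := by
  rcases hx with rfl | rfl
  · exact ht
  · rw [show e.ty = _ from ht, Formula.dual_dual]

theorem IsCut.mem {y : Link} {e f : Edge} (hy : IsCut y e f) : e ∈ y.targets ∧ f ∈ y.targets := by
  rcases hy with rfl | rfl <;> simp [Link.targets, Link.prems]

theorem IsCut.dual {x : Link} {e f : Edge} (hx : IsCut x e f) (ht : x.Typed) : f.ty = e.ty.dual := by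
  rcases hx with rfl | rfl
  · exact ht
  · rw [show e.ty = _ from ht, Formula.dual_dual]

theorem ax_lmv_pos {x : Link} {e f : Edge} (hx : IsAx x e f) (ht : x.Typed) {A : Formula}
    (heA : e.ty = A) (hA : A.Positive) {p q : Pos} {G : Set Pos} :
    LMv x p q G ↔ ∃ i : {m // A.polarity m ≠ none}, p = .atom f i ∧ q = .atom e i ∧ G = ∅ := by
  subst heA
  rw [ax_lmv hx]
  simp only [hx.dual ht, Formula.polarity_dual]
  constructor
  · rintro ⟨m, ⟨hm, rfl, rfl⟩ | ⟨hm, rfl, rfl⟩, rfl⟩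
    · have := hA.polarity (m := m) (by simp [hm])
      rw [hm] at this; cases this
    · exact ⟨⟨m, by rintro h; simp [h] at hm⟩, rfl, rfl, rfl⟩
  · rintro ⟨⟨m, hm⟩, rfl, rfl, rfl⟩
    exact ⟨m, .inr ⟨by simp [hA.polarity hm], rfl, rfl⟩, rfl⟩

theorem cut_lmv_neg {x : Link} {e f : Edge} (hx : IsCut x e f) (ht : x.Typed) {A : Formula}
    (heA : e.ty = A) (hA : A.Negative) {p q : Pos} {G : Set Pos} :
    LMv x p q G ↔ ∃ i : {m // A.polarity m ≠ none}, p = .atom f i ∧ q = .atom e i ∧ G = ∅ := by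
  subst heA
  rw [cut_lmv hx]
  simp only [hx.dual ht, Formula.polarity_dual]
  constructor
  · rintro ⟨m, ⟨hm, rfl, rfl⟩ | ⟨hm, rfl, rfl⟩, rfl⟩
    · have := hA.polarity (m := m) (by simp [hm])
      rw [hm] at this; cases this
    · exact ⟨⟨m, by rintro h; simp [h] at hm⟩, rfl, rfl, rfl⟩
  · rintro ⟨⟨m, hm⟩, rfl, rfl, rfl⟩
    exact ⟨m, .inr ⟨by simp [hA.polarity hm], rfl, rfl⟩, rfl⟩

theorem Formula.Positive.dual {A : Formula} (h : A.Positive) : A.dual.Negative := by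
  induction A with
  | tensor A B hA hB => exact ⟨hA h.1, hB h.2⟩
  | one => trivial
  | _ => exact h.elim

theorem Formula.Negative.dual {A : Formula} (h : A.Negative) : A.dual.Positive := by
  induction A with
  | par A B hA hB => exact ⟨hA h.1, hB h.2⟩
  | bot => trivial
  | _ => exact h.elim

/-- Tokens go from `f` to `g`: freely to `e` and then through the sync link before the step, through
the sync link to `f'` and then freely after it. -/
theorem equi_ax_sync {x : Link} {e f g f' : Edge} (hx : IsAx x e f) (he : e.ty.Positive)
    (hR : Flat ([(none, .sync (ps ++ (e, g) :: qs)), (none, x)] ++ Λ) Γ)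
    (hS : Flat ([(none, .sync (ps ++ (f', f) :: qs)), (none, .ax g f')] ++ Λ) Γ) :
    Equi Γ (sys ([(none, .sync (ps ++ (e, g) :: qs)), (none, x)] ++ Λ) Γ)
      (sys ([(none, .sync (ps ++ (f', f) :: qs)), (none, .ax g f')] ++ Λ) Γ) := by
  have hR' : Flat ([(none, .sync (ps ++ ([(e, g)] ++ qs))), (none, x)] ++ Λ) Γ := hR
  have hS' : Flat ([(none, .sync (ps ++ ([(f', f)] ++ qs))), (none, .ax g f')] ++ Λ) Γ := hS
  have h1 := hR'.sync_typed (w := (e, g)) (by simp)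
  have h2 := hS'.sync_typed (w := (f', f)) (by simp)
  have hax : IsAx (.ax g f') g f' := .inl rfl
  have hfd : f.ty = e.ty.dual := hx.dual hR'.link_typed
  have hf'd : f'.ty.Negative := by rw [h2.1]; exact hfd ▸ he.dual
  have hxn := hR'.nodup_concls (x := (none, x)) (by simp)
  have hef : f ≠ e := by
    rintro rfl; rcases hx with rfl | rfl <;> simp [Link.concls] at hxn
  have hgf : g ≠ f' := by
    have := hS'.nodup_concls (x := (none, .ax g f')) (by simp)
    simpa [Link.concls] using this
  have hpol : ∀ m, f'.ty.polarity m ≠ none ↔ e.ty.polarity m ≠ none := by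
    intro m; rw [h2.1, hfd, Formula.polarity_dual]; simp
  refine commute_links (ps := ps ++ qs) (ι := {m // e.ty.polarity m ≠ none})
    (x := fun i => .atom f i) (y := fun i => .atom e i) (y' := fun i => .atom f' i)
    (z := fun i => .atom g i) (fun u => u = e ∨ u = f') hR hS ?_ ?_ ?_ ?_
    (by rcases hx with rfl | rfl <;> simp) (by simp) ?_ ?_ ?_ ?_ ?_
  · exact fun p q G => ax_lmv_pos hx hR'.link_typed rfl he
  · exact fun p q G => ax_lmv_pos hax hS'.link_typed h1.1.symm he
  · intro p q
    rw [show ps ++ (e, g) :: qs = ps ++ ([(e, g)] ++ qs) from rfl, syncMv_split]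
    refine or_congr_left ?_
    simp only [SyncMv, List.mem_singleton, exists_eq_left, pairMv_pos he h1.1, Subtype.exists,
      exists_prop]
  · intro p q
    rw [show ps ++ (f', f) :: qs = ps ++ ([(f', f)] ++ qs) from rfl, syncMv_split]
    refine or_congr_left ?_
    simp only [SyncMv, List.mem_singleton, exists_eq_left, pairMv_neg hf'd h2.1, Subtype.exists,
      exists_prop, hpol]
  · exact fun i => ⟨_, _, rfl, .inl rfl⟩
  · exact fun i => ⟨_, _, rfl, .inr rfl⟩
  · intro i
    refine avoids_atom ?_ _
    rintro (h | h)
    · exact hef h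
    · exact hS'.sync_ne (.inr ⟨by simp, hax.mem.2⟩) h
  · intro i
    refine avoids_atom ?_ _
    rintro (h | h)
    · exact hR'.sync_ne (.inr ⟨by simp, hx.mem.1⟩) h
    · exact hgf h
  · rintro u (rfl | rfl)
    · exact hR'.sync_outside (.inl ⟨by simp, hx.mem.1⟩)
    · exact hS'.sync_outside (.inl ⟨by simp, hax.mem.2⟩)

/-- Tokens go from `g` to `c`: through the cut to `d` and then through the sync link before the
step, through the sync link to `g'` and then through the cut after it. -/
theorem equi_cut_sync {y : Link} {c d g g' : Edge} (hy : IsCut y d g) (hd : d.ty.Negative)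
    (hR : Flat ([(none, .sync (ps ++ (c, d) :: qs)), (none, y)] ++ Λ) Γ)
    (hS : Flat ([(none, .sync (ps ++ (g, g') :: qs)), (none, .cut c g')] ++ Λ) Γ) :
    Equi Γ (sys ([(none, .sync (ps ++ (c, d) :: qs)), (none, y)] ++ Λ) Γ)
      (sys ([(none, .sync (ps ++ (g, g') :: qs)), (none, .cut c g')] ++ Λ) Γ) := by
  have hR' : Flat ([(none, .sync (ps ++ ([(c, d)] ++ qs))), (none, y)] ++ Λ) Γ := hR
  have hS' : Flat ([(none, .sync (ps ++ ([(g, g')] ++ qs))), (none, .cut c g')] ++ Λ) Γ := hS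
  have h1 := hR'.sync_typed (w := (c, d)) (by simp)
  have h2 := hS'.sync_typed (w := (g, g')) (by simp)
  have hcut : IsCut (.cut c g') c g' := .inl rfl
  have hgd : g.ty = d.ty.dual := hy.dual hR'.link_typed
  have hgp : g.ty.Positive := hgd ▸ hd.dual
  have hcn : c.ty.Negative := by rw [h1.1]; exact hd
  have hyn := hR'.nodup_targets (x := (none, y)) (by simp)
  have hgd' : g ≠ d := by
    rintro rfl; rcases hy with rfl | rfl <;> simp [Link.targets, Link.prems] at hyn
  have hcg : c ≠ g' := by
    have := hS'.nodup_targets (x := (none, .cut c g')) (by simp)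
    simpa [Link.targets, Link.prems] using this
  have hpol : ∀ m, g.ty.polarity m ≠ none ↔ d.ty.polarity m ≠ none := by
    intro m; rw [hgd, Formula.polarity_dual]; simp
  have hpol' : ∀ m, c.ty.polarity m ≠ none ↔ d.ty.polarity m ≠ none := by
    intro m; rw [h1.1]
  refine commute_links (ps := ps ++ qs) (ι := {m // d.ty.polarity m ≠ none})
    (x := fun i => .atom g i) (y := fun i => .atom d i) (y' := fun i => .atom g' i)
    (z := fun i => .atom c i) (fun u => u = d ∨ u = g') hR hS ?_ ?_ ?_ ?_
    (by rcases hy with rfl | rfl <;> simp) (by simp) ?_ ?_ ?_ ?_ ?_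
  · exact fun p q G => cut_lmv_neg hy hR'.link_typed rfl hd
  · exact fun p q G => cut_lmv_neg hcut hS'.link_typed h1.1 hd
  · intro p q
    rw [show ps ++ (c, d) :: qs = ps ++ ([(c, d)] ++ qs) from rfl, syncMv_split]
    refine or_congr_left ?_
    simp only [SyncMv, List.mem_singleton, exists_eq_left, pairMv_neg hcn h1.1, Subtype.exists,
      exists_prop, hpol']
  · intro p q
    rw [show ps ++ (g, g') :: qs = ps ++ ([(g, g')] ++ qs) from rfl, syncMv_split]
    refine or_congr_left ?_
    simp only [SyncMv, List.mem_singleton, exists_eq_left, pairMv_pos hgp h2.1, Subtype.exists,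
      exists_prop, hpol]
  · exact fun i => ⟨_, _, rfl, .inl rfl⟩
  · exact fun i => ⟨_, _, rfl, .inr rfl⟩
  · intro i
    refine avoids_atom ?_ _
    rintro (h | h)
    · exact hgd' h
    · exact hS'.sync_ne (.inl ⟨by simp, hcut.mem.2⟩) h
  · intro i
    refine avoids_atom ?_ _
    rintro (h | h)
    · exact hR'.sync_ne (.inl ⟨by simp, hy.mem.1⟩) h
    · exact hcg h
  · rintro u (rfl | rfl)
    · exact hR'.sync_outside (.inr ⟨by simp, hy.mem.1⟩)
    · exact hS'.sync_outside (.inr ⟨by simp, hcut.mem.2⟩)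

/-- A positive occurrence of `c` goes down the tensor, through the cut, and up the par; a negative
one makes the same journey in the opposite direction. After the step only the cut between the
corresponding premisses is left. -/
theorem equi_tensor_par {y : Link} {a b c a' b' c' : Edge} (hy : IsCut y c c')
    (hR : Flat ([(none, .tensor a b c), (none, .par a' b' c'), (none, y)] ++ Λ) Γ)
    (hS : Flat ([(none, .cut a a'), (none, .cut b b')] ++ Λ) Γ) :
    Equi Γ (sys ([(none, .tensor a b c), (none, .par a' b' c'), (none, y)] ++ Λ) Γ)
      (sys ([(none, .cut a a'), (none, .cut b b')] ++ Λ) Γ) := by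
  have ht1 := hR.typed (none, .tensor a b c) (by simp)
  have ht2 := hR.typed (none, .par a' b' c') (by simp)
  have ht3 := hR.typed (none, y) (by simp)
  have hpol := IsMult.polarity (.inl rfl) ht1
  have ha : a'.ty = a.ty.dual := hS.typed (none, .cut a a') (by simp)
  have hb : b'.ty = b.ty.dual := hS.typed (none, .cut b b') (by simp)
  have hcd : c'.ty = c.ty.dual := hy.dual ht3
  have hne : y ≠ .tensor a b c ∧ y ≠ .par a' b' c' := by rcases hy with rfl | rfl <;> simp
  have hT : ∀ e e', (e = a ∨ e = b ∨ e = a' ∨ e = b') → (e' = c ∨ e' = c') → e ≠ e' := by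
    obtain ⟨-, hn⟩ := hR.left_nodup
    have hyt : y.targets = [c, c'] ∨ y.targets = [c', c] := by
      rcases hy with rfl | rfl <;> simp [Link.targets, Link.prems]
    intro e e' he he' h
    subst h
    simp only [List.flatMap_cons, List.flatMap_nil, List.append_nil, ← List.append_assoc] at hn
    refine (List.nodup_append.1 hn).2.2 e ?_ e ?_ rfl
    · simp only [Link.targets, Link.prems, List.mem_append, List.mem_cons, List.not_mem_nil, or_false]
      tauto
    · rcases hyt with h | h <;> rw [h] <;> simp only [List.mem_cons, List.not_mem_nil, or_false] <;>
        tauto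
  have hcc : c ≠ c' := by
    obtain ⟨hn, -⟩ := hR.left_nodup
    simp only [List.flatMap_cons, Link.concls, List.cons_append, List.nodup_cons] at hn
    exact fun h => hn.1 (by rw [h]; simp)
  have hE : ∀ e, (e = c ∨ e = c') → e ∉ Γ ∧ ∀ l ∈ Λ, e ∉ l.2.concls ∧ e ∉ l.2.targets := by
    intro e he
    refine hR.outside (e := e) ?_ ?_
    · simp only [List.flatMap_cons, Link.concls, List.mem_append, List.mem_cons, List.not_mem_nil,
        or_false]
      tauto
    · simp only [List.flatMap_cons, List.mem_append]
      rcases he with rfl | rfl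
      · exact .inr (.inr (.inl hy.mem.1))
      · exact .inr (.inr (.inl hy.mem.2))
  let E : Edge → Prop := fun e => e = c ∨ e = c'
  -- The journeys are indexed by the addresses of the atoms of `c`, and the polarity at the address
  -- gives the direction. `x`, `u`, `v`, `z` are its successive stages.
  let x : {m // c.ty.polarity m ≠ none} → Pos := fun i =>
    if c.ty.polarity i = some true then multPos a b i else multPos a' b' i
  let u : {m // c.ty.polarity m ≠ none} → Pos := fun i =>
    if c.ty.polarity i = some true then .atom c i else .atom c' i
  let v : {m // c.ty.polarity m ≠ none} → Pos := fun i =>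
    if c.ty.polarity i = some true then .atom c' i else .atom c i
  let z : {m // c.ty.polarity m ≠ none} → Pos := fun i =>
    if c.ty.polarity i = some true then multPos a' b' i else multPos a b i
  have hav : ∀ {p i}, Avoids E p → p ≠ u i ∧ p ≠ v i := by
    intro p i hp
    refine ⟨?_, ?_⟩
    · intro h; simp only [u] at h; split at h
      · exact hp _ _ h (.inl rfl)
      · exact hp _ _ h (.inr rfl)
    · intro h; simp only [v] at h; split at h
      · exact hp _ _ h (.inr rfl)
      · exact hp _ _ h (.inl rfl)
  have hmp : ∀ m, Avoids E (multPos a b m) := multPos_cases _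
    (avoids_atom fun h => hT a _ (by simp) h rfl) (avoids_atom fun h => hT b _ (by simp) h rfl)
  have hmp' : ∀ m, Avoids E (multPos a' b' m) := multPos_cases _
    (avoids_atom fun h => hT a' _ (by simp) h rfl) (avoids_atom fun h => hT b' _ (by simp) h rfl)
  have hone : ∀ w ∈ ([(none, .tensor a b c), (none, .par a' b' c'), (none, y)] :
      List (Option Edge × Link)), ∀ e, w.2 ≠ .one e := by
    intro w hw e
    simp only [List.mem_cons, List.not_mem_nil, or_false] at hw
    rcases hw with rfl | rfl | rfl
    · simp
    · simp
    · rcases hy with rfl | rfl <;> simp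
  have hone' : ∀ w ∈ ([(none, .cut a a'), (none, .cut b b')] :
      List (Option Edge × Link)), ∀ e, w.2 ≠ .one e := by
    intro w hw e
    simp only [List.mem_cons, List.not_mem_nil, or_false] at hw
    rcases hw with rfl | rfl <;> simp
  have htf : ∀ {m}, c.ty.polarity m ≠ none → c.ty.polarity m ≠ some true →
      c.ty.polarity m = some false := by
    intro m h1 h2
    cases h : c.ty.polarity m with
    | none => exact (h1 h).elim
    | some b => cases b <;> simp_all
  refine Shortcut.equi (x := x) (y := u) (y' := v) (z := z)
    (M := fun p q G => ∃ b l, (b, l) ∈ Λ ∧ LMv l p q G)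
    ⟨hR.det, hS.det, gen_congr hone hone', ?_, ?_, ?_, ?_, ?_, ?_, ?_, ?_⟩
  · intro p q G
    have : (sys ([(none, .tensor a b c), (none, .par a' b' c'), (none, y)] ++ Λ) Γ).Mv p q G ↔
        (∃ b l, (b, l) ∈ Λ ∧ LMv l p q G) ∨ LMv (.tensor a b c) p q G ∨ LMv y p q G ∨
          LMv (.par a' b' c') p q G := by
      simp only [sys, List.mem_append, List.mem_cons, List.not_mem_nil, or_false, Prod.mk.injEq]
      constructor
      · rintro ⟨b, l, (⟨rfl, rfl⟩ | ⟨rfl, rfl⟩ | ⟨rfl, rfl⟩) | hl, h⟩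
        · exact .inr (.inl h)
        · exact .inr (.inr (.inr h))
        · exact .inr (.inr (.inl h))
        · exact .inl ⟨b, l, hl, h⟩
      · rintro (⟨b, l, hl, h⟩ | h | h | h)
        · exact ⟨b, l, .inr hl, h⟩
        · exact ⟨_, _, .inl (.inl ⟨rfl, rfl⟩), h⟩
        · exact ⟨_, _, .inl (.inr (.inr ⟨rfl, rfl⟩)), h⟩
        · exact ⟨_, _, .inl (.inr (.inl ⟨rfl, rfl⟩)), h⟩
    rw [this]
    refine or_congr_right ?_
    rw [mult_lmv (.inl rfl) ht1, mult_lmv (.inr rfl) ht2, cut_lmv hy]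
    simp only [hcd, Formula.polarity_dual, Option.map_eq_some_iff, Bool.not_eq_true',
      Bool.not_eq_false']
    constructor
    · rintro (⟨m, ⟨hm, rfl, rfl⟩ | ⟨hm, rfl, rfl⟩, rfl⟩ | ⟨m, ⟨hm, rfl, rfl⟩ | ⟨⟨_, hm, rfl⟩, rfl, rfl⟩, rfl⟩ |
        ⟨m, ⟨⟨_, hm, rfl⟩, rfl, rfl⟩ | ⟨⟨_, hm, rfl⟩, rfl, rfl⟩, rfl⟩)
      · exact .inl ⟨⟨m, by simp [hm]⟩, by simp [x, hm], by simp [u, hm], rfl⟩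
      · exact .inr (.inr ⟨⟨m, by simp [hm]⟩, by simp [v, hm], by simp [z, hm], rfl⟩)
      · exact .inr (.inl ⟨⟨m, by simp [hm]⟩, by simp [u, hm], by simp [v, hm], rfl⟩)
      · exact .inr (.inl ⟨⟨m, by simp [hm]⟩, by simp [u, hm], by simp [v, hm], rfl⟩)
      · exact .inl ⟨⟨m, by simp [hm]⟩, by simp [x, hm], by simp [u, hm], rfl⟩
      · exact .inr (.inr ⟨⟨m, by simp [hm]⟩, by simp [v, hm], by simp [z, hm], rfl⟩)
    · rintro (⟨⟨m, hm⟩, rfl, rfl, rfl⟩ | ⟨⟨m, hm⟩, rfl, rfl, rfl⟩ | ⟨⟨m, hm⟩, rfl, rfl, rfl⟩) <;>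
        by_cases hp : c.ty.polarity m = some true
      · exact .inl ⟨m, .inl ⟨hp, by simp [x, hp], by simp [u, hp]⟩, rfl⟩
      · exact .inr (.inr ⟨m, .inl ⟨⟨_, htf hm hp, rfl⟩, by simp [x, hp], by simp [u, hp]⟩, rfl⟩)
      · exact .inr (.inl ⟨m, .inl ⟨hp, by simp [u, hp], by simp [v, hp]⟩, rfl⟩)
      · exact .inr (.inl ⟨m, .inr ⟨⟨_, htf hm hp, rfl⟩, by simp [u, hp], by simp [v, hp]⟩, rfl⟩)
      · exact .inr (.inr ⟨m, .inr ⟨⟨_, hp, rfl⟩, by simp [v, hp], by simp [z, hp]⟩, rfl⟩)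
      · exact .inl ⟨m, .inr ⟨htf hm hp, by simp [v, hp], by simp [z, hp]⟩, rfl⟩
  · intro p q G
    have : (sys ([(none, .cut a a'), (none, .cut b b')] ++ Λ) Γ).Mv p q G ↔
        (∃ b l, (b, l) ∈ Λ ∧ LMv l p q G) ∨ LMv (.cut a a') p q G ∨ LMv (.cut b b') p q G := by
      simp only [sys, List.mem_append, List.mem_cons, List.not_mem_nil, or_false, Prod.mk.injEq]
      constructor
      · rintro ⟨b, l, (⟨rfl, rfl⟩ | ⟨rfl, rfl⟩) | hl, h⟩
        · exact .inr (.inl h)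
        · exact .inr (.inr h)
        · exact .inl ⟨b, l, hl, h⟩
      · rintro (⟨b, l, hl, h⟩ | h | h)
        · exact ⟨b, l, .inr hl, h⟩
        · exact ⟨_, _, .inl (.inl ⟨rfl, rfl⟩), h⟩
        · exact ⟨_, _, .inl (.inr ⟨rfl, rfl⟩), h⟩
    rw [this]
    refine or_congr_right ?_
    rw [cut_lmv (.inl rfl), cut_lmv (.inl rfl)]
    simp only [ha, hb, Formula.polarity_dual, Option.map_eq_some_iff, Bool.not_eq_true']
    constructor
    · rintro (⟨m, ⟨hm, rfl, rfl⟩ | ⟨⟨_, hm, rfl⟩, rfl, rfl⟩, rfl⟩ |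
        ⟨m, ⟨hm, rfl, rfl⟩ | ⟨⟨_, hm, rfl⟩, rfl, rfl⟩, rfl⟩)
      · have := (hpol.2 m).1.trans hm
        exact ⟨⟨.l :: m, by simp [this]⟩, by simp [x, this, multPos], by simp [z, this, multPos], rfl⟩
      · have := (hpol.2 m).1.trans hm
        exact ⟨⟨.l :: m, by simp [this]⟩, by simp [x, this, multPos], by simp [z, this, multPos], rfl⟩
      · have := (hpol.2 m).2.trans hm
        exact ⟨⟨.r :: m, by simp [this]⟩, by simp [x, this, multPos], by simp [z, this, multPos], rfl⟩
      · have := (hpol.2 m).2.trans hm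
        exact ⟨⟨.r :: m, by simp [this]⟩, by simp [x, this, multPos], by simp [z, this, multPos], rfl⟩
    · rintro ⟨⟨m, hm⟩, rfl, rfl, rfl⟩
      rcases m with _ | ⟨_ | _, m⟩
      · exact (hm hpol.1).elim
      · by_cases hp : c.ty.polarity (.l :: m) = some true
        · exact .inl ⟨m, .inl ⟨(hpol.2 m).1 ▸ hp, by simp [x, hp, multPos], by simp [z, hp, multPos]⟩, rfl⟩
        · exact .inl ⟨m, .inr ⟨⟨_, (hpol.2 m).1 ▸ htf hm hp, rfl⟩, by simp [x, hp, multPos],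
            by simp [z, hp, multPos]⟩, rfl⟩
      · by_cases hp : c.ty.polarity (.r :: m) = some true
        · exact .inr ⟨m, .inl ⟨(hpol.2 m).2 ▸ hp, by simp [x, hp, multPos], by simp [z, hp, multPos]⟩, rfl⟩
        · exact .inr ⟨m, .inr ⟨⟨_, (hpol.2 m).2 ▸ htf hm hp, rfl⟩, by simp [x, hp, multPos],
            by simp [z, hp, multPos]⟩, rfl⟩
  · intro p G i h
    obtain ⟨h1, h2⟩ := gen_avoids (E := E) h hone (fun l hl e he => ((hE e he).2 l hl).1)
      (fun e he => (hE e he).1)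
    exact ⟨hav h1, fun g hg => hav (h2 g hg)⟩
  · rintro p q G i ⟨b, l, hl, h⟩
    obtain ⟨h1, h2, h3⟩ := h.touches
    have : ∀ e, E e → e ∉ l.concls ∧ e ∉ l.targets := fun e he => (hE e he).2 _ hl
    exact ⟨hav (h1.avoids this), hav (h2.avoids this), fun g hg => hav ((h3 g hg).avoids this)⟩
  -- A coincidence of a second stage with a third stage would make one occurrence of atom both
  -- positive and negative, because `c ≠ c'`.
  · rintro ⟨m, hm⟩ ⟨m', hm'⟩ h
    by_cases h1 : c.ty.polarity m = some true <;> by_cases h2 : c.ty.polarity m' = some true <;>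
      simp [u, v, h1, h2, hcc, hcc.symm] at h
    · subst h; exact h2 h1
    · subst h; exact h1 h2
  · intro i j
    refine hav ?_
    simp only [x]; split
    · exact hmp _
    · exact hmp' _
  · intro i j
    refine hav ?_
    simp only [z]; split
    · exact hmp' _
    · exact hmp _
  · intro t i ht
    exact hav (ht.avoids fun e he => (hE e he).1)

end
end SMLL

namespace SMLL

/-! ### Contraction of wires -/

/-- Renaming the edges of a link, including the conclusions of the content of a box. -/
def Link.mapEdges (σ : Edge → Edge) : Link → Link
  | .box e ds C => .box (σ e) (ds.map fun p => (σ p.1, σ p.2)) C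
  | l => l.rename σ

/-- Renaming the edge of a position. -/
def Pos.map (σ : Edge → Edge) : Pos → Pos
  | .atom e m => .atom (σ e) m
  | .lock e i => .lock (σ e) i

/-- Renaming the edge of a port. -/
def Port.map (σ : Edge → Edge) (P : Port) : Port := ⟨σ P.edge, P.side, P.path⟩

theorem Link.concls_mapEdges (σ : Edge → Edge) (l : Link) :
    (l.mapEdges σ).concls = l.concls.map σ := by
  cases l <;> simp [Link.mapEdges, Link.rename, Link.concls]

theorem Link.mapEdges_eq_one {σ : Edge → Edge} {l : Link} {e : Edge} (h : l.mapEdges σ = .one e) :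
    ∃ z, l = .one z ∧ e = σ z := by
  cases l <;> simp only [Link.mapEdges, Link.rename, reduceCtorEq, Link.one.injEq] at h
  exact ⟨_, rfl, h.symm⟩

theorem Link.mapEdges_eq_box {σ : Edge → Edge} {l : Link} {e : Edge} {ds : List (Edge × Edge)}
    {C : List Link} (h : l.mapEdges σ = .box e ds C) : ∃ z ds' C', l = .box z ds' C' ∧ e = σ z := by
  cases l <;> simp only [Link.mapEdges, Link.rename, reduceCtorEq, Link.box.injEq] at h
  exact ⟨_, _, _, rfl, h.1.symm⟩

theorem Link.wires_mapEdges (σ : Edge → Edge) (l : Link) :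
    (l.mapEdges σ).wires = l.wires.map fun w => (w.1.map σ, w.2.map σ) := by
  cases l <;> simp [Link.mapEdges, Link.rename, Link.wires, Port.map]

theorem Link.wire_mapEdges {σ : Edge → Edge} {l : Link} {P' Q' : Port} :
    (l.mapEdges σ).Wire P' Q' ↔ ∃ P Q, l.Wire P Q ∧ P' = P.map σ ∧ Q' = Q.map σ := by
  simp only [Link.Wire, Link.wires_mapEdges, List.mem_map, Prod.mk.injEq]
  constructor
  · rintro (⟨w, hw, rfl, rfl⟩ | ⟨w, hw, rfl, rfl⟩)
    · exact ⟨_, _, .inl hw, rfl, rfl⟩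
    · exact ⟨_, _, .inr hw, rfl, rfl⟩
  · rintro ⟨P, Q, h | h, rfl, rfl⟩
    · exact .inl ⟨_, h, rfl, rfl⟩
    · exact .inr ⟨_, h, rfl, rfl⟩

theorem Link.Wire.map_enters {σ : Edge → Edge} {l : Link} {P Q : Port} (h : l.Wire P Q)
    (hty : ∀ e, e ∈ l.concls ∨ e ∈ l.targets → (σ e).ty = e.ty) {m : List Dir} :
    (P.map σ).Enters m ↔ P.Enters m := by
  simp only [Port.Enters, Port.map, hty P.edge (h.mem.symm.imp And.right And.right)]

theorem Link.guard_mapEdges {σ : Edge → Edge} {l : Link}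
    (hty : ∀ e, e ∈ l.concls ∨ e ∈ l.targets → (σ e).ty = e.ty) :
    (l.mapEdges σ).guard = Pos.map σ '' l.guard := by
  cases l with
  | sync ps =>
    ext g
    constructor
    · rintro ⟨P', Q', m, h, hm, rfl⟩
      obtain ⟨P, Q, hw, rfl, rfl⟩ := (Link.wire_mapEdges (l := .sync ps)).1 h
      exact ⟨P.pos m, ⟨P, Q, m, hw, (hw.map_enters hty).1 hm, rfl⟩, rfl⟩
    · rintro ⟨_, ⟨P, Q, m, h, hm, rfl⟩, rfl⟩
      exact ⟨P.map σ, Q.map σ, m, (Link.wire_mapEdges (l := .sync ps)).2 ⟨P, Q, h, rfl, rfl⟩,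
        (h.map_enters hty).2 hm, rfl⟩
  | box e ds C => simp [Link.mapEdges, Link.guard, Pos.map]
  | _ => simp [Link.mapEdges, Link.rename, Link.guard]

theorem lmv_mapEdges {σ : Edge → Edge} {l : Link}
    (hty : ∀ e, e ∈ l.concls ∨ e ∈ l.targets → (σ e).ty = e.ty) {p' q' : Pos} {G' : Set Pos} :
    LMv (l.mapEdges σ) p' q' G' ↔
      ∃ p q G, LMv l p q G ∧ p' = p.map σ ∧ q' = q.map σ ∧ G' = Pos.map σ '' G := by
  constructor
  · intro h
    cases h with
    | wire h hm =>
      obtain ⟨P, Q, hw, rfl, rfl⟩ := Link.wire_mapEdges.1 h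
      exact ⟨_, _, _, .wire hw ((hw.map_enters hty).1 hm), rfl, rfl, Link.guard_mapEdges hty⟩
    | lock hb =>
      obtain ⟨z, ds, C, rfl, rfl⟩ := Link.mapEdges_eq_box hb
      exact ⟨_, _, _, .lock rfl, rfl, rfl, by simp⟩
  · rintro ⟨p, q, G, h, rfl, rfl, rfl⟩
    cases h with
    | wire h hm =>
      rw [← Link.guard_mapEdges hty]
      exact .wire (Link.wire_mapEdges.2 ⟨_, _, h, rfl, rfl⟩) ((h.map_enters hty).2 hm)
    | lock hb =>
      subst hb
      rw [Set.image_empty]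
      exact .lock rfl

/-- The structure of located links `Λ₀.map (mapLocated σ τ)` results from that of `A ++ Λ₀` by
contracting the links `A`; `D` are the edges which are not removed. -/
structure Contraction (A Λ₀ : List (Option Edge × Link)) (Γ : List Edge) (σ : Edge → Edge)
    (τ : Option Edge → Option Edge) (D : Edge → Prop) : Prop where
  flat : Flat (A ++ Λ₀) Γ
  flat' : Flat (Λ₀.map fun x => (τ x.1, x.2.mapEdges σ)) Γ
  edges : ∀ x ∈ Λ₀, ∀ e, e ∈ x.2.concls ∨ e ∈ x.2.targets → (σ e).ty = e.ty ∧ D e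
  pending : ∀ e ∈ Γ, σ e = e ∧ D e
  located : ∀ x ∈ Λ₀, ∀ e, τ x.1 = some e → ∃ z, x.1 = some z ∧ σ z = e ∧ ∃ x' ∈ Λ₀, z ∈ x'.2.concls
  located' : ∀ x ∈ Λ₀, ∀ z, x.1 = some z → (sys (A ++ Λ₀) Γ).V (.lock z 0) ∨
    (τ x.1 = some (σ z) ∧ ∃ x' ∈ Λ₀, z ∈ x'.2.concls)
  mv : ∀ x ∈ A, ∀ e m q G, LMv x.2 q (.atom e m) G → D e → ∃ e', q = .atom e' m ∧ D e' ∧ σ e' = σ e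
  one : ∀ b e, (b, Link.one e) ∈ A → ∃ t, Final Γ t ∧ (sys (A ++ Λ₀) Γ).Vis (.atom e []) t
  one' : ∀ b e, (b, Link.one e) ∈ A → ¬ D e
  box : ∀ b e ds C, (b, Link.box e ds C) ∈ A → ∀ s, (sys (A ++ Λ₀) Γ).Vis s (.lock e 0) →
    ∃ b z, (b, Link.one z) ∈ A ∧ s = .atom z []
  fill : ∀ s e m, (sys (A ++ Λ₀) Γ).Vis s (.atom e m) →
    ((∃ x ∈ Λ₀, e ∈ x.2.concls) ∧ e.ty.polarity m = some true) ∨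
    (((∃ x ∈ Λ₀, e ∈ x.2.targets) ∨ e ∈ Γ) ∧ e.ty.polarity m = some false) →
    ∀ w, D w → σ w = σ e → (sys (A ++ Λ₀) Γ).Vis s (.atom w m)

/-- A position of the contracted structure stands for all the retained positions that `σ` sends to
it. A movement inside `A` between retained edges stays in one class and becomes no movement at all
(`mv`). Conversely, a token emitted into a class by a surviving link or a conclusion goes through
the whole class in the original structure (`fill`). The guards attached to `A` never hold a token
back there, and removed `one` links only feed final places. -/
theorem Contraction.equi {A Λ₀ : List (Option Edge × Link)} {Γ : List Edge} {σ : Edge → Edge}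
    {τ : Option Edge → Option Edge} {D : Edge → Prop} (h : Contraction A Λ₀ Γ σ τ D) :
    Equi Γ (sys (A ++ Λ₀) Γ) (sys (Λ₀.map fun x => (τ x.1, x.2.mapEdges σ)) Γ) := by
  set Y := sys (A ++ Λ₀) Γ with hY
  set Z := sys (Λ₀.map fun x => (τ x.1, x.2.mapEdges σ)) Γ with hZ
  let C : Edge → Prop := fun e => ∃ x ∈ Λ₀, e ∈ x.2.concls
  -- The conclusions of the surviving links remain distinct after renaming, as the result is again a
  -- structure: a class contains at most one of them.
  have hinj : ∀ {e e'}, C e → C e' → σ e = σ e' → e = e' := by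
    rintro e e' ⟨x, hx, hex⟩ ⟨x', hx', hex'⟩ he
    have := h.flat'.nodup
    have hm : ((Λ₀.map fun x => (τ x.1, x.2.mapEdges σ)).flatMap fun x => x.2.concls) =
        (Λ₀.flatMap fun x => x.2.concls).map σ := by
      simp only [List.flatMap_map, List.map_flatMap, Link.concls_mapEdges]
    rw [hm] at this
    exact List.inj_on_of_nodup_map this (List.mem_flatMap.2 ⟨x, hx, hex⟩)
      (List.mem_flatMap.2 ⟨x', hx', hex'⟩) he
  let Dom : Pos → Prop := fun p => (∀ e m, p = .atom e m → D e) ∧ (∀ e i, p = .lock e i → C e)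
  have domA : ∀ {e m}, Dom (.atom e m) ↔ D e := by
    intro e m
    exact ⟨fun h => h.1 e m rfl, fun h => ⟨by rintro _ _ ⟨⟩; exact h, by rintro _ _ ⟨⟩⟩⟩
  have domL : ∀ {e i}, Dom (.lock e i) ↔ C e := by
    intro e i
    exact ⟨fun h => h.2 e i rfl, fun h => ⟨by rintro _ _ ⟨⟩, by rintro _ _ ⟨⟩; exact h⟩⟩
  let ρ : Pos → Pos → Prop := fun p p' => Dom p ∧ p' = p.map σ
  -- Origins are matched more strictly than positions, one to one: a class may contain several
  -- positions, but at most one of them is the origin of a surviving token.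
  let ρo : Pos → Pos → Prop := fun s s' => (IsInit Γ s ∧ s' = s) ∨
    ∃ b z, (b, Link.one z) ∈ Λ₀ ∧ s = .atom z [] ∧ s' = .atom (σ z) []
  have hD : ∀ {x}, x ∈ Λ₀ → ∀ e, e ∈ x.2.concls ∨ e ∈ x.2.targets → D e := fun hx e he =>
    (h.edges _ hx e he).2
  have hty : ∀ {x}, x ∈ Λ₀ → ∀ e, e ∈ x.2.concls ∨ e ∈ x.2.targets → (σ e).ty = e.ty :=
    fun hx e he => (h.edges _ hx e he).1
  have touchDom : ∀ {x : Option Edge × Link} {p : Pos}, x ∈ Λ₀ → x.2.Touches p →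
      (∀ e i, p = .lock e i → C e) → Dom p := fun hx hp hl =>
    ⟨fun e m he => hD hx e (hp e m he), hl⟩
  have boxDom : ∀ {x : Option Edge × Link} {p q : Pos} {G : Set Pos}, x ∈ Λ₀ → LMv x.2 p q G →
      Dom p ∧ Dom q ∧ ∀ g ∈ G, Dom g := by
    intro x p q G hx hmv
    obtain ⟨h1, h2, h3⟩ := hmv.touches
    refine ⟨touchDom hx h1 ?_, touchDom hx h2 ?_, fun g hg => touchDom hx (h3 g hg) ?_⟩
    · rintro e i rfl
      exact (lock_stuck (Λ := [x]) (Γ := Γ) ⟨x.1, x.2, by simp, hmv⟩).elim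
    · rintro e i rfl
      generalize hq : Pos.lock e i = q at hmv
      cases hmv with
      | lock hb => cases hq; exact ⟨x, hx, by rw [hb]; exact .head _⟩
      | wire => simp [Port.pos] at hq
    · rintro e i rfl
      cases hmv with
      | lock hb => exact hg.elim
      | wire =>
        obtain ⟨b, l⟩ := x
        cases l with
        | sync ps => obtain ⟨P, Q, m, -, -, h⟩ := hg; cases h
        | box e' ds C' =>
          have : Pos.lock e i = .lock e' 0 := hg
          cases this
          exact ⟨_, hx, .head _⟩
        | _ => exact hg.elim
  have memS : ∀ {x}, x ∈ Λ₀ → (τ x.1, x.2.mapEdges σ) ∈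
      Λ₀.map fun x => (τ x.1, x.2.mapEdges σ) := fun hx => List.mem_map.2 ⟨_, hx, rfl⟩
  have memR : ∀ {x}, x ∈ Λ₀ → x ∈ A ++ Λ₀ := fun hx => List.mem_append_right _ hx
  have one_pol : ∀ {b z}, (b, Link.one z) ∈ Λ₀ → z.ty = .one ∧ (σ z).ty = .one := by
    intro b z hz
    have h1 : z.ty = .one := h.flat.typed _ (memR hz)
    exact ⟨h1, (hty hz z (.inl (.head _))).trans h1⟩
  have init_one : ∀ {e}, e.ty = .one → ¬ IsInit Γ (.atom e []) := by
    rintro e he ⟨e', -, m, hm, hp⟩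
    cases hp
    simp [he, Formula.polarity] at hm
  have fin_map : ∀ {t}, IsFin Γ t → ρ t t := by
    rintro t ⟨e, he, m, -, rfl⟩
    exact ⟨domA.2 (h.pending e he).2, by simp [Pos.map, (h.pending e he).1]⟩
  refine Equi.of_sim (ρ := ρ) (ρo := ρo) ?_ ?_
  · refine ⟨?_, ?_, ?_, ?_, ?_, ?_, fin_map⟩
    · rintro p G p' hg hG ⟨hp, rfl⟩
      rcases hg with ⟨hi, rfl⟩ | ⟨b, e, hl, rfl, rfl⟩
      · have hpp : p.map σ = p := by
          obtain ⟨e, he, m, -, rfl⟩ := hi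
          simp [Pos.map, (h.pending e he).1]
        rw [hpp]
        exact ⟨p, .inl ⟨hi, rfl⟩, .gen (G := ∅) (.inl ⟨hi, rfl⟩) (by simp)⟩
      · rcases List.mem_append.1 hl with hl | hl
        · exact (h.one' b e hl (domA.1 hp)).elim
        · refine ⟨.atom (σ e) [], .inr ⟨b, e, hl, rfl, rfl⟩,
            .gen (G := boxGuard (τ b)) (.inr ⟨τ b, σ e, memS hl, rfl, rfl⟩) ?_⟩
          rintro g ⟨e', he', rfl⟩
          obtain ⟨z, hz, rfl, hz'⟩ := h.located _ hl e' he'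
          exact hG (.lock z 0) ⟨z, hz, rfl⟩ _ ⟨domL.2 hz', rfl⟩
    · rintro p q G q' ⟨b, l, hl, hmv⟩ hG ⟨hq, rfl⟩
      rcases List.mem_append.1 hl with hl | hl
      · rcases q with ⟨e, m⟩ | ⟨e, i⟩
        -- A movement inside `A` does not change the image under `σ`.
        · obtain ⟨e', rfl, hD', he⟩ := h.mv _ hl e m p G hmv (domA.1 hq)
          refine ⟨_, ⟨domA.2 hD', rfl⟩, fun s hs => ?_⟩
          simpa only [Pos.map, he] using hs
        · obtain ⟨x, hx, hex⟩ := domL.1 hq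
          generalize hqq : Pos.lock e i = q at hmv
          cases hmv with
          | wire => simp [Port.pos] at hqq
          | lock hb =>
            cases hqq
            have hn := h.flat.nodup
            rw [List.flatMap_append, List.nodup_append] at hn
            refine (hn.2.2 e (List.mem_flatMap.2 ⟨_, hl, ?_⟩) e (List.mem_flatMap.2 ⟨x, hx, hex⟩) rfl).elim
            simp only [hb]; exact .head _
      · obtain ⟨h1, h2, h3⟩ := boxDom hl hmv
        refine ⟨_, ⟨h1, rfl⟩, fun s hs => ?_⟩
        refine hs.mv ⟨τ b, _, memS hl, (lmv_mapEdges (hty hl)).2 ⟨p, q, G, hmv, rfl, rfl, rfl⟩⟩ ?_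
        rintro _ ⟨g, hg, rfl⟩
        exact hG g hg _ ⟨h3 g hg, rfl⟩
    · intro s hs
      obtain ⟨G, hg, -⟩ := hs.exists_gen
      rcases hg with ⟨⟨e, he, m, hm, rfl⟩, rfl⟩ | ⟨b, e, hl, rfl, rfl⟩
      · exact .inl ⟨_, domA.2 (h.pending e he).2, rfl⟩
      · rcases List.mem_append.1 hl with hl | hl
        -- The token of a removed `one` link has no counterpart, but it is known to reach a final
        -- place.
        · exact .inr (h.one b e hl)
        · exact .inl ⟨_, domA.2 (hD hl e (.inl (.head _))), rfl⟩
    · rintro s s' t hss hs (ht | ⟨e, rfl⟩)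
      · exact ⟨t, .inl ht, fin_map ht⟩
      · obtain ⟨-, b, ds, C', hb⟩ := valid_lock hs
        rcases List.mem_append.1 hb with hb | hb
        · exfalso
          -- A token on the lock of a removed box comes from a removed `one` link, so it is not
          -- among the tokens that `ρo` matches.
          obtain ⟨b', z, hz, rfl⟩ := h.box b e ds C' hb s hs
          have hz1 : z.ty = .one := h.flat.typed _ (List.mem_append_left _ hz)
          rcases hss with ⟨hi, -⟩ | ⟨b'', z', hz', h', -⟩
          · exact init_one hz1 hi
          · cases h'
            exact h.one' b' z hz (hD hz' z (.inl (.head _)))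
        · exact ⟨.lock (σ e) 0, .inr ⟨_, rfl⟩, domL.2 ⟨_, hb, .head _⟩, rfl⟩
    · rintro s s1 s2 (⟨h1, rfl⟩ | ⟨b, z, hz, rfl, rfl⟩) (⟨h2, rfl⟩ | ⟨b', z', hz', h2, rfl⟩)
      · rfl
      · exact (init_one (one_pol hz').1 (h2 ▸ h1)).elim
      · exact (init_one (one_pol hz).1 h2).elim
      · cases h2; rfl
    · rintro s s' hs (⟨-, rfl⟩ | ⟨b, z, hz, rfl, rfl⟩)
      · rfl
      · exact (init_one (one_pol hz).1 hs).elim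
  · refine ⟨?_, ?_, ?_, ?_, ?_, ?_, fin_map⟩
    · rintro p' G w hg hG ⟨hw, rfl⟩
      rcases hg with ⟨hi, rfl⟩ | ⟨b, e, hl, hp, rfl⟩
      · refine ⟨_, .inl ⟨hi, rfl⟩, ?_⟩
        have hv : Y.Vis (w.map σ) (w.map σ) := .gen (G := ∅) (.inl ⟨hi, rfl⟩) (by simp)
        rcases w with ⟨w, m⟩ | ⟨w, i⟩
        · obtain ⟨e, he, m', hm, hp⟩ := hi
          cases hp
          exact h.fill _ _ _ hv (.inr ⟨.inr he, hm⟩) w (domA.1 hw) (h.pending _ he).1.symm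
        · obtain ⟨e, he, m', hm, hp⟩ := hi; cases hp
      · obtain ⟨⟨b₀, l⟩, hx, hxe⟩ := List.mem_map.1 hl
        simp only [Prod.mk.injEq] at hxe
        obtain ⟨rfl, hxe⟩ := hxe
        obtain ⟨z, rfl, rfl⟩ := Link.mapEdges_eq_one hxe
        refine ⟨.atom z [], .inr ⟨b₀, z, hx, rfl, hp⟩, ?_⟩
        have hv : Y.Vis (.atom z []) (.atom z []) := by
          refine .gen (G := boxGuard b₀) (.inr ⟨b₀, z, memR hx, rfl, rfl⟩) ?_
          rintro g ⟨e', rfl, rfl⟩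
          -- If the box around the `one` link is removed, its guard has disappeared in the
          -- contracted structure but is met by other means in the original one.
          rcases h.located' _ hx e' rfl with h1 | ⟨h1, h2⟩
          · exact h1
          · exact hG _ ⟨_, h1, rfl⟩ _ ⟨domL.2 h2, rfl⟩
        rcases w with ⟨w, m⟩ | ⟨w, i⟩
        · simp only [Pos.map, Pos.atom.injEq] at hp
          obtain ⟨hp, rfl⟩ := hp
          exact h.fill _ _ _ hv (.inl ⟨⟨_, hx, .head _⟩, by simp [(one_pol hx).1, Formula.polarity]⟩)
            w (domA.1 hw) hp
        · cases hp
    · rintro p' q' G' w ⟨b, l', hl, hmv'⟩ hG ⟨hw, rfl⟩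
      obtain ⟨⟨b₀, l⟩, hx, hxe⟩ := List.mem_map.1 hl
      simp only [Prod.mk.injEq] at hxe
      obtain ⟨rfl, rfl⟩ := hxe
      obtain ⟨p, q, G, hmv, rfl, hq, rfl⟩ := (lmv_mapEdges (hty hx)).1 hmv'
      clear hmv'
      obtain ⟨h1, h2, h3⟩ := boxDom hx hmv
      refine ⟨p, ⟨h1, rfl⟩, fun s hs => ?_⟩
      have hv : Y.Vis s q := hs.mv ⟨b₀, l, memR hx, hmv⟩ fun g hg =>
        hG _ ⟨g, hg, rfl⟩ g ⟨h3 g hg, rfl⟩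
      cases hmv with
      | lock hb =>
        rcases w with ⟨w, m⟩ | ⟨w, i⟩
        · cases hq
        · simp only [Pos.map, Pos.lock.injEq] at hq
          obtain ⟨hq, rfl⟩ := hq
          rw [hinj (domL.1 hw) (domL.1 h2) hq]
          exact hv
      | @wire P Q m hPQ hm =>
        rcases w with ⟨w, m'⟩ | ⟨w, i⟩
        · simp only [Pos.map, Port.pos, Pos.atom.injEq] at hq
          obtain ⟨hq, rfl⟩ := hq
          have hex := hPQ.exits (h.flat.typed _ (memR hx)) hm
          -- The token has just left a surviving link, and the side on which it left fixes the
          -- polarity; it then reaches every retained edge of the class.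
          refine h.fill _ _ _ hv ?_ w (domA.1 hw) hq
          rcases hPQ.symm.mem with ⟨h4, h5⟩ | ⟨h4, h5⟩
          · exact .inr ⟨.inl ⟨_, hx, h5⟩, by simpa [h4] using hex⟩
          · exact .inl ⟨⟨_, hx, h5⟩, by simpa [h4] using hex⟩
        · cases hq
    · intro s' hs'
      obtain ⟨G, hg, -⟩ := hs'.exists_gen
      refine .inl ?_
      rcases hg with ⟨⟨e, he, m, hm, rfl⟩, rfl⟩ | ⟨b, e, hl, rfl, rfl⟩
      · exact ⟨.atom e m, domA.2 (h.pending e he).2, by simp [Pos.map, (h.pending e he).1]⟩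
      · obtain ⟨⟨b₀, l⟩, hx, hxe⟩ := List.mem_map.1 hl
        simp only [Prod.mk.injEq] at hxe
        obtain ⟨rfl, hxe⟩ := hxe
        obtain ⟨z, rfl, rfl⟩ := Link.mapEdges_eq_one hxe
        exact ⟨_, domA.2 (hD hx z (.inl (.head _))), rfl⟩
    · rintro s' s t hss hs (ht | ⟨e, rfl⟩)
      · exact ⟨t, .inl ht, fin_map ht⟩
      · obtain ⟨-, b, ds, C', hb⟩ := valid_lock hs
        obtain ⟨⟨b₀, l⟩, hx, hxe⟩ := List.mem_map.1 hb
        simp only [Prod.mk.injEq] at hxe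
        obtain ⟨rfl, hxe⟩ := hxe
        obtain ⟨z, ds', C'', rfl, rfl⟩ := Link.mapEdges_eq_box hxe
        exact ⟨.lock z 0, .inr ⟨_, rfl⟩, domL.2 ⟨_, hx, .head _⟩, rfl⟩
    · rintro s s1 s2 (⟨h1, rfl⟩ | ⟨b, z, hz, rfl, rfl⟩) (⟨h2, h3⟩ | ⟨b', z', hz', rfl, h3⟩)
      · exact h3
      · exact (init_one (one_pol hz').2 (h3 ▸ h1)).elim
      · exact (init_one (one_pol hz).2 (h3 ▸ h2)).elim
      · simp only [Pos.atom.injEq, and_true] at h3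
        rw [hinj ⟨_, hz, .head _⟩ ⟨_, hz', .head _⟩ h3]
    · rintro s' s hs (⟨-, rfl⟩ | ⟨b, z, hz, rfl, rfl⟩)
      · rfl
      · exact (init_one (one_pol hz).2 hs).elim

end SMLL

namespace SMLL

/-! ### Renaming and located links -/

/-- The edges inside a box. -/
def Link.inner : Link → List Edge
  | .box _ _ C => allEdges C
  | _ => []

theorem Link.deepConcls_eq_append (l : Link) : l.deepConcls = l.concls ++ l.inner := by
  cases l <;> simp [Link.deepConcls, Link.concls, Link.inner]

theorem allEdges_perm_append (L : List Link) :
    (allEdges L).Perm (L.flatMap Link.concls ++ L.flatMap Link.inner) := by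
  rw [allEdges_eq_flatMap]
  rw [show Link.deepConcls = fun l => l.concls ++ l.inner from
    funext Link.deepConcls_eq_append]
  exact (List.flatMap_append_perm L Link.concls Link.inner).symm

theorem mem_allEdges_of_concls {L : List Link} {l : Link} {e : Edge} (hl : l ∈ L)
    (he : e ∈ l.concls) : e ∈ allEdges L := by
  rw [(allEdges_perm_append L).mem_iff]
  exact List.mem_append_left _ (List.mem_flatMap.2 ⟨l, hl, he⟩)

theorem mem_allEdges_of_box {L : List Link} {e : Edge} {ds : List (Edge × Edge)} {C : List Link}
    {z : Edge} (hl : Link.box e ds C ∈ L) (hz : z ∈ allEdges C) : z ∈ allEdges L := by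
  rw [(allEdges_perm_append L).mem_iff]
  exact List.mem_append_right _ (List.mem_flatMap.2 ⟨_, hl, hz⟩)

theorem Link.mapEdges_of_fixed {σ : Edge → Edge} {l : Link}
    (h : ∀ e, e ∈ l.concls ∨ e ∈ l.targets → σ e = e) : l.mapEdges σ = l := by
  have pairs : ∀ ds : List (Edge × Edge), (∀ e, e ∈ ds.map Prod.snd ∨ e ∈ ds.map Prod.fst → σ e = e) →
      (ds.map fun p => (σ p.1, σ p.2)) = ds := by
    intro ds hds
    conv_rhs => rw [← List.map_id ds]
    refine List.map_congr_left fun p hp => ?_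
    rw [hds p.1 (.inr (List.mem_map_of_mem hp)), hds p.2 (.inl (List.mem_map_of_mem hp))]
    rfl
  cases l with
  | sync ps => simpa [Link.mapEdges, Link.rename] using pairs ps h
  | box e ds C =>
    simp only [Link.mapEdges, Link.box.injEq, and_true]
    refine ⟨h e (.inl (.head _)), pairs ds fun z hz => h z ?_⟩
    exact hz.imp_left fun hz => List.mem_cons_of_mem _ hz
  | _ =>
    simp only [Link.concls, Link.targets, Link.prems, List.mem_cons, List.not_mem_nil, or_false,
      false_or, or_imp, forall_and, forall_eq] at h
    simp [Link.mapEdges, Link.rename, h]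

theorem Link.rename_congr {σ σ' : Edge → Edge} {l : Link}
    (h : ∀ e, e ∈ l.concls ∨ e ∈ l.prems → σ e = σ' e) : l.rename σ = l.rename σ' := by
  cases l with
  | sync ps =>
    simp only [Link.rename, Link.sync.injEq]
    refine List.map_congr_left fun p hp => ?_
    rw [h p.1 (.inr (List.mem_map_of_mem hp)), h p.2 (.inl (List.mem_map_of_mem hp))]
  | box e ds C =>
    simp only [Link.rename, Link.box.injEq, and_true]
    refine ⟨h e (.inl (.head _)), List.map_congr_left fun p hp => ?_⟩
    rw [h p.2 (.inl (List.mem_cons_of_mem _ (List.mem_map_of_mem hp)))]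
  | _ =>
    simp only [Link.concls, Link.prems, List.mem_cons, List.not_mem_nil, or_false,
      false_or, or_imp, forall_and, forall_eq] at h
    simp [Link.rename, h]

theorem Link.rename_id (l : Link) : l.rename id = l := by
  cases l <;> simp [Link.rename]

theorem Link.rename_of_fixed {σ : Edge → Edge} {l : Link}
    (h : ∀ e, e ∈ l.concls ∨ e ∈ l.prems → σ e = e) : l.rename σ = l :=
  (Link.rename_congr h).trans l.rename_id

theorem map_rename_of_fixed {σ : Edge → Edge} {L : List Link}
    (h : ∀ l ∈ L, ∀ e, e ∈ l.concls ∨ e ∈ l.prems → σ e = e) : L.map (Link.rename σ) = L := by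
  conv_rhs => rw [← List.map_id L]
  exact List.map_congr_left fun l hl => Link.rename_of_fixed (h l hl)

/-- Renaming of edges and of boxes in located links. -/
abbrev mapLocated (σ : Edge → Edge) (τ : Option Edge → Option Edge) (x : Option Edge × Link) :
    Option Edge × Link := (τ x.1, x.2.mapEdges σ)

mutual
theorem Link.flat_of_fixed {σ : Edge → Edge} {τ : Option Edge → Option Edge} (l : Link)
    {b b' : Option Edge} (hb : τ b = b')
    (hσ : ∀ x ∈ l.flat b, ∀ e, e ∈ x.2.concls ∨ e ∈ x.2.targets → σ e = e)
    (hτ : ∀ e ∈ l.deepConcls, τ (some e) = some e) :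
    (l.flat b).map (mapLocated σ τ) = l.flat b' := by
  cases l with
  | box e ds C =>
    simp only [Link.flat, List.map_cons, List.cons.injEq]
    refine ⟨?_, ?_⟩
    · rw [mapLocated, hb, Link.mapEdges_of_fixed (hσ _ (mem_flat_box.2 (.inl rfl)))]
    · refine flatten_of_fixed C (hτ e (by simp [Link.deepConcls])) ?_ ?_
      · exact fun x hx => hσ x (mem_flat_box.2 (.inr hx))
      · exact fun z hz => hτ z (by simp [Link.deepConcls, hz])
  | _ =>
    simp only [Link.flat, List.map_cons, List.map_nil, List.cons.injEq, and_true]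
    rw [mapLocated, hb, Link.mapEdges_of_fixed (hσ _ (by simp [Link.flat]))]

theorem flatten_of_fixed {σ : Edge → Edge} {τ : Option Edge → Option Edge} (L : List Link)
    {b b' : Option Edge} (hb : τ b = b')
    (hσ : ∀ x ∈ flatten L b, ∀ e, e ∈ x.2.concls ∨ e ∈ x.2.targets → σ e = e)
    (hτ : ∀ e ∈ allEdges L, τ (some e) = some e) :
    (flatten L b).map (mapLocated σ τ) = flatten L b' := by
  cases L with
  | nil => rfl
  | cons l L =>
    simp only [flatten, List.map_append]
    rw [Link.flat_of_fixed l hb (fun x hx => hσ x (by simp [flatten, hx]))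
        (fun e he => hτ e (by simp [allEdges, he])),
      flatten_of_fixed L hb (fun x hx => hσ x (by simp [flatten, hx]))
        (fun e he => hτ e (by simp [allEdges, he]))]
end

theorem WellFormed.mem_allEdges {C : List Link} {Δ : List Edge} (h : WellFormed C Δ) :
    (∀ b, ∀ x ∈ flatten C b, ∀ e, e ∈ x.2.concls ∨ e ∈ x.2.targets → e ∈ allEdges C) ∧
      ∀ e ∈ Δ, e ∈ allEdges C := by
  refine ⟨?_, fun e he => ?_⟩
  · rintro b x hx e (he | he)
    · rw [allEdges_eq_flatten C b]; exact List.mem_flatMap.2 ⟨x, hx, he⟩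
    · rw [← (h.flat_edges b).mem_iff]
      exact List.mem_append_left _ (List.mem_flatMap.2 ⟨x, hx, he⟩)
  · rw [← (h.flat_edges none).mem_iff]
    exact List.mem_append_right _ he

/-- `Link.rename` ignores the content of a box and its inner doors, whereas `mapEdges` in the flat
view renames every occurrence. They agree because the edges inside the box are fixed, the inner
doors being among them. -/
theorem Link.flat_rename {σ : Edge → Edge} {τ : Option Edge → Option Edge} {l : Link}
    {b b' : Option Edge} (hb : τ b = b')
    (h : ∀ e ds C, l = .box e ds C → WellFormed C (ds.map Prod.fst) ∧ τ (some e) = some (σ e) ∧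
      ∀ z ∈ allEdges C, σ z = z ∧ τ (some z) = some z) :
    (l.flat b).map (mapLocated σ τ) = (l.rename σ).flat b' := by
  cases l with
  | box e ds C =>
    obtain ⟨hC, he, hz⟩ := h e ds C rfl
    obtain ⟨h1, h2⟩ := hC.mem_allEdges
    simp only [Link.flat, List.map_cons, List.cons.injEq, Link.rename]
    refine ⟨?_, flatten_of_fixed C he (fun x hx z hzx => (hz z (h1 _ x hx z hzx)).1)
      fun z hzC => (hz z hzC).2⟩
    simp only [mapLocated, hb, Link.mapEdges, Prod.mk.injEq, Link.box.injEq, true_and, and_true]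
    refine List.map_congr_left fun p hp => ?_
    rw [(hz p.1 (h2 _ (List.mem_map_of_mem hp))).1]
  | _ => simp [Link.flat, Link.rename, mapLocated, Link.mapEdges, hb]

theorem flatten_rename {σ : Edge → Edge} {τ : Option Edge → Option Edge} {L : List Link}
    {b b' : Option Edge} (hb : τ b = b')
    (h : ∀ e ds C, .box e ds C ∈ L → WellFormed C (ds.map Prod.fst) ∧ τ (some e) = some (σ e) ∧
      ∀ z ∈ allEdges C, σ z = z ∧ τ (some z) = some z) :
    (flatten L b).map (mapLocated σ τ) = flatten (L.map (Link.rename σ)) b' := by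
  induction L with
  | nil => rfl
  | cons l L ih =>
    simp only [flatten, List.map_append, List.map_cons]
    rw [Link.flat_rename hb fun e ds C hl => h e ds C (by simp [hl]),
      ih fun e ds C hl => h e ds C (by simp [hl])]

/-! ### Preservation of structures -/

theorem WellFormed.perm {L L' : List Link} {Γ : List Edge} (h : WellFormed L Γ) (hp : L.Perm L') :
    WellFormed L' Γ := by
  obtain ⟨_, _, typed, edges, boxes⟩ := h
  exact ⟨_, _, fun l hl => typed l (hp.mem_iff.2 hl),
    ((hp.symm.flatMap_right _).append_right Γ).trans (edges.trans (hp.flatMap_right _)),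
    fun e ds C hl => boxes e ds C (hp.mem_iff.2 hl)⟩

theorem IsStructure.perm {L L' : List Link} {Γ : List Edge} (h : IsStructure L Γ)
    (hp : L.Perm L') : IsStructure L' Γ :=
  ⟨h.1.perm hp, (allEdges_perm hp).nodup_iff.1 h.2⟩

/-- A local replacement keeps the balance of edges if `A` and `A'` have the same surplus of
premisses over conclusions. `N` lists the new edges, and `M` the conclusions inherited from `A`. -/
theorem IsStructure.replace {A A' K : List Link} {Γ N M : List Edge} (h : IsStructure (A ++ K) Γ)
    (hA : ∀ l ∈ A, ∀ e ds C, l ≠ .box e ds C) (hA' : ∀ l ∈ A', ∀ e ds C, l ≠ .box e ds C)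
    (typed : ∀ l ∈ A', l.Typed)
    (edges : (A'.flatMap Link.prems ++ A.flatMap Link.concls).Perm
      (A.flatMap Link.prems ++ A'.flatMap Link.concls))
    (hNM : (A'.flatMap Link.concls).Perm (N ++ M)) (hM : M.Subperm (A.flatMap Link.concls))
    (hN : N.Nodup) (hfresh : ∀ e ∈ N, e ∉ allEdges (A ++ K)) : IsStructure (A' ++ K) Γ := by
  obtain ⟨⟨_, _, typed', edges', boxes'⟩, hn⟩ := h
  refine ⟨⟨_, _, ?_, ?_, ?_⟩, ?_⟩
  · intro l hl
    rcases List.mem_append.1 hl with hl | hl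
    · exact typed l hl
    · exact typed' l (List.mem_append_right _ hl)
  · rw [List.perm_iff_count] at edges edges' ⊢
    intro x
    have h1 := edges x
    have h2 := edges' x
    simp only [List.flatMap_append, List.count_append] at h1 h2 ⊢
    omega
  · intro e ds C hl
    rcases List.mem_append.1 hl with hl | hl
    · exact (hA' _ hl e ds C rfl).elim
    · exact boxes' e ds C (List.mem_append_right _ hl)
  · have hall : ∀ B : List Link, (∀ l ∈ B, ∀ e ds C, l ≠ .box e ds C) →
        allEdges B = B.flatMap Link.concls := by
      intro B hB
      rw [allEdges_eq_flatMap, List.flatMap_def, List.flatMap_def]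
      congr 1
      refine List.map_congr_left fun l hl => ?_
      cases l with
      | box e ds C => exact (hB _ hl e ds C rfl).elim
      | _ => simp [Link.deepConcls, Link.concls]
    rw [allEdges_append, hall _ hA'] at *
    rw [hall _ hA] at hn hfresh
    rw [(hNM.append_right _).nodup_iff, List.append_assoc, List.nodup_append]
    have hsub : ∀ x, (M ++ allEdges K).count x ≤ (A.flatMap Link.concls ++ allEdges K).count x := by
      intro x
      simp only [List.count_append]
      have := hM.count_le x
      omega
    refine ⟨hN, ?_, ?_⟩
    · rw [List.nodup_iff_count_le_one] at hn ⊢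
      exact fun x => (hsub x).trans (hn x)
    · rintro x hx y hy rfl
      refine hfresh x hx ?_
      have h1 := List.count_pos_iff.2 hy
      exact List.count_pos_iff.1 (h1.trans_le (hsub x))

theorem IsStructure.rename {L : List Link} {Γ : List Edge} {σ : Edge → Edge}
    (typed : ∀ l ∈ L, l.Typed)
    (boxes : ∀ e ds C, Link.box e ds C ∈ L → WellFormed C (ds.map Prod.fst))
    (hty : ∀ l ∈ L, ∀ e, e ∈ l.prems ∨ e ∈ l.concls → (σ e).ty = e.ty)
    (edges : ((L.flatMap Link.prems).map σ ++ Γ).Perm ((L.flatMap Link.concls).map σ))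
    (hσ : ∀ e ds C, Link.box e ds C ∈ L → ∀ z ∈ allEdges C, σ z = z)
    (hn : (allEdges L).Nodup) (hinj : ∀ z ∈ allEdges L, ∀ w ∈ allEdges L, σ z = σ w → z = w) :
    IsStructure (L.map (Link.rename σ)) Γ := by
  have hprems : (L.map (Link.rename σ)).flatMap Link.prems = (L.flatMap Link.prems).map σ := by
    rw [List.flatMap_map, List.map_flatMap]
    congr 1; funext l
    cases l <;> simp [Link.rename, Link.prems]
  have hconcls : (L.map (Link.rename σ)).flatMap Link.concls = (L.flatMap Link.concls).map σ := by
    rw [List.flatMap_map, List.map_flatMap]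
    congr 1; funext l
    cases l <;> simp [Link.rename, Link.concls]
  have hinner : (L.map (Link.rename σ)).flatMap Link.inner = L.flatMap Link.inner := by
    rw [List.flatMap_map]
    congr 1; funext l
    cases l <;> simp [Link.rename, Link.inner]
  refine ⟨⟨_, _, ?_, ?_, ?_⟩, ?_⟩
  · intro l' hl'
    obtain ⟨l, hl, rfl⟩ := List.mem_map.1 hl'
    have ht := typed l hl
    have he := hty l hl
    cases l with
    | sync ps =>
      simp only [Link.rename, Link.Typed, ne_eq, List.map_eq_nil_iff, List.mem_map,
        forall_exists_index, and_imp, forall_apply_eq_imp_iff₂] at ht ⊢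
      refine ⟨ht.1, fun p hp => ?_⟩
      rw [he p.1 (.inl (List.mem_map_of_mem hp)), he p.2 (.inr (List.mem_map_of_mem hp))]
      exact ht.2 p hp
    | box e ds C =>
      simp only [Link.rename, Link.Typed, List.mem_map, forall_exists_index, and_imp,
        forall_apply_eq_imp_iff₂] at ht ⊢
      refine ⟨(he e (.inr (.head _))).trans ht.1, fun p hp => ?_⟩
      rw [he p.2 (.inr (List.mem_cons_of_mem _ (List.mem_map_of_mem hp)))]
      exact ht.2 p hp
    | _ =>
      simp only [Link.concls, Link.prems, List.mem_cons, List.not_mem_nil, or_false,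
        false_or, or_imp, forall_and, forall_eq] at he
      simpa [Link.rename, Link.Typed, he] using ht
  · rw [hprems, hconcls]; exact edges
  · intro e ds C hl
    obtain ⟨l, hl', hle⟩ := List.mem_map.1 hl
    cases l <;> simp only [Link.rename, reduceCtorEq, Link.box.injEq] at hle
    obtain ⟨-, rfl, rfl⟩ := hle
    simpa [Function.comp_def] using boxes _ _ _ hl'
  · rw [(allEdges_perm_append _).nodup_iff, hconcls, hinner]
    -- The edges inside the boxes are fixed by `σ`, so the list of all edges is renamed as a whole
    -- and injectivity applies to it.
    have hid : L.flatMap Link.inner = (L.flatMap Link.inner).map σ := by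
      conv_lhs => rw [← List.map_id (L.flatMap Link.inner)]
      refine List.map_congr_left fun z hz => ?_
      obtain ⟨l, hl, hz⟩ := List.mem_flatMap.1 hz
      cases l <;> simp only [Link.inner, List.not_mem_nil] at hz
      exact (hσ _ _ _ hl z hz).symm
    rw [hid, ← List.map_append]
    have hp := allEdges_perm_append L
    refine List.Nodup.map_on (fun z hz w hw => ?_) (hp.nodup_iff.1 hn)
    exact hinj z (hp.mem_iff.2 hz) w (hp.mem_iff.2 hw)

/-! ### Doors -/

theorem exitDoor_cons (i o : Edge) (ds : List (Edge × Edge)) (x : Edge) :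
    exitDoor ((i, o) :: ds) x = if x = i then o else exitDoor ds x := by
  simp only [exitDoor, List.lookup_cons]
  by_cases h : x = i
  · simp [h]
  · simp [h, beq_eq_false_iff_ne.2 h]

theorem exitDoor_of_not_mem {ds : List (Edge × Edge)} {x : Edge} (h : x ∉ ds.map Prod.fst) :
    exitDoor ds x = x := by
  induction ds with
  | nil => rfl
  | cons p ds ih =>
    obtain ⟨i, o⟩ := p
    simp only [List.map_cons, List.mem_cons, not_or] at h
    rw [exitDoor_cons, if_neg h.1, ih h.2]

theorem exitDoor_of_mem {ds : List (Edge × Edge)} (hn : (ds.map Prod.fst).Nodup) {i o : Edge}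
    (h : (i, o) ∈ ds) : exitDoor ds i = o := by
  induction ds with
  | nil => simp at h
  | cons p ds ih =>
    obtain ⟨i', o'⟩ := p
    simp only [List.map_cons, List.nodup_cons] at hn
    rw [exitDoor_cons]
    rcases List.mem_cons.1 h with h' | h'
    · cases h'; simp
    · rw [if_neg, ih hn.2 h']
      rintro rfl
      exact hn.1 (List.mem_map.2 ⟨(_, o), h', rfl⟩)

theorem exitDoor_cases {ds : List (Edge × Edge)} (hn : (ds.map Prod.fst).Nodup) (x : Edge) :
    (x ∉ ds.map Prod.fst ∧ exitDoor ds x = x) ∨ (x, exitDoor ds x) ∈ ds := by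
  by_cases h : x ∈ ds.map Prod.fst
  · obtain ⟨⟨i, o⟩, hp, rfl⟩ := List.mem_map.1 h
    exact .inr (by rwa [exitDoor_of_mem hn hp])
  · exact .inl ⟨h, exitDoor_of_not_mem h⟩

theorem exitDoor_ty {ds : List (Edge × Edge)} (hn : (ds.map Prod.fst).Nodup)
    (ht : ∀ p ∈ ds, p.1.ty = p.2.ty) (x : Edge) : (exitDoor ds x).ty = x.ty := by
  rcases exitDoor_cases hn x with h | h
  · rw [h.2]
  · exact (ht _ h).symm

theorem map_exitDoor_fst {ds : List (Edge × Edge)} (hn : (ds.map Prod.fst).Nodup) :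
    (ds.map Prod.fst).map (exitDoor ds) = ds.map Prod.snd := by
  rw [List.map_map]
  exact List.map_congr_left fun p hp => exitDoor_of_mem hn hp

/-- `exitDoor` merges an inner door only with its outer door; once the outer doors are set aside,
nothing is identified. -/
theorem exitDoor_inj {ds : List (Edge × Edge)} (h1 : (ds.map Prod.fst).Nodup)
    (h2 : (ds.map Prod.snd).Nodup) {z w : Edge} (hz : z ∉ ds.map Prod.snd)
    (hw : w ∉ ds.map Prod.snd) (h : exitDoor ds z = exitDoor ds w) : z = w := by
  rcases exitDoor_cases h1 z with ⟨-, h3⟩ | h3 <;> rcases exitDoor_cases h1 w with ⟨-, h4⟩ | h4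
  · rw [← h3, h, h4]
  · rw [← h, h3] at h4
    exact (hz (List.mem_map_of_mem h4)).elim
  · rw [h, h4] at h3
    exact (hw (List.mem_map_of_mem h3)).elim
  · rw [h] at h3
    have := List.inj_on_of_nodup_map h2 h3 h4 rfl
    exact congrArg Prod.fst this

theorem Flat.not_concl_right {A Λ : List (Option Edge × Link)} {Γ : List Edge}
    (h : Flat (A ++ Λ) Γ) {x : Option Edge × Link} (hx : x ∈ A) {e : Edge} (he : e ∈ x.2.concls)
    {l : Option Edge × Link} (hl : l ∈ Λ) : e ∉ l.2.concls := by
  intro hle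
  have hn := h.nodup
  rw [List.flatMap_append, List.nodup_append] at hn
  exact hn.2.2 e (List.mem_flatMap.2 ⟨_, hx, he⟩) e (List.mem_flatMap.2 ⟨_, hl, hle⟩) rfl

theorem Flat.not_target_right {A Λ : List (Option Edge × Link)} {Γ : List Edge}
    (h : Flat (A ++ Λ) Γ) {x : Option Edge × Link} (hx : x ∈ A) {e : Edge} (he : e ∈ x.2.targets)
    {l : Option Edge × Link} (hl : l ∈ Λ) : e ∉ l.2.targets := by
  intro hle
  have hn := h.targets_nodup
  rw [List.flatMap_append, List.append_assoc, List.nodup_append] at hn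
  exact hn.2.2 e (List.mem_flatMap.2 ⟨_, hx, he⟩) e
    (List.mem_append_left _ (List.mem_flatMap.2 ⟨_, hl, hle⟩)) rfl

section Doors
variable {A Λ₀ : List (Option Edge × Link)} {Γ : List Edge} (hR : Flat (A ++ Λ₀) Γ)
  {b : Option Edge} {l : Link} {ds : List (Edge × Edge)} (hl : (b, l) ∈ A)
  (hw : l.wires = ds.map fun p => (⟨p.1, true, []⟩, ⟨p.2, false, []⟩))
  (h1 : l.targets = ds.map Prod.fst) (h2 : (ds.map Prod.snd).Sublist l.concls)
include hR hl hw h1 h2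

/-- A class of merged edges is a door pair or a single edge. A token emitted by a surviving link
with positive polarity is on the inner side and goes out; one of negative polarity is on the outer
side and goes in. The guard being visited, the crossing is possible. The lemma serves both a box and
an erased sync link, whose pairs play the part of doors. -/
theorem fill_doors (hg : ∀ g ∈ l.guard, (sys (A ++ Λ₀) Γ).V g) (s : Pos) (e : Edge) (m : List Dir)
    (hs : (sys (A ++ Λ₀) Γ).Vis s (.atom e m))
    (he : ((∃ x ∈ Λ₀, e ∈ x.2.concls) ∧ e.ty.polarity m = some true) ∨
      (((∃ x ∈ Λ₀, e ∈ x.2.targets) ∨ e ∈ Γ) ∧ e.ty.polarity m = some false))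
    (w : Edge) (hwe : exitDoor ds w = exitDoor ds e) : (sys (A ++ Λ₀) Γ).Vis s (.atom w m) := by
  have hl' : (b, l) ∈ A ++ Λ₀ := List.mem_append_left _ hl
  have hn1 : (ds.map Prod.fst).Nodup := h1 ▸ hR.nodup_targets hl'
  have hn2 : (ds.map Prod.snd).Nodup := h2.nodup (hR.nodup_concls hl')
  rcases he with ⟨⟨x, hx, hex⟩, hm⟩ | ⟨he, hm⟩
  · have hes : e ∉ ds.map Prod.snd :=
      fun he => hR.not_concl_right hl (h2.subset he) hx hex
    by_cases hws : w ∈ ds.map Prod.snd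
    · rcases exitDoor_cases hn1 e with ⟨-, h3⟩ | h3
      · rcases exitDoor_cases hn1 w with ⟨-, h4⟩ | h4
        · rw [← h4, hwe, h3] at hws; exact (hes hws).elim
        · rw [hwe, h3] at h4; exact (hes (List.mem_map_of_mem h4)).elim
      · have hv : (sys (A ++ Λ₀) Γ).Vis s (.atom (exitDoor ds e) m) :=
          hs.mv ⟨b, l, hl', .wire (P := ⟨e, true, []⟩) (Q := ⟨exitDoor ds e, false, []⟩) (m := m)
            (.inl (by rw [hw]; exact List.mem_map.2 ⟨_, h3, rfl⟩)) hm⟩ hg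
        rcases exitDoor_cases hn1 w with ⟨-, h4⟩ | h4
        · rwa [← h4, hwe]
        · rw [hwe] at h4
          have := List.inj_on_of_nodup_map hn2 h3 h4 rfl
          obtain rfl : e = w := congrArg Prod.fst this
          exact hs
    · rw [exitDoor_inj hn1 hn2 hws hes hwe]; exact hs
  · have hef : e ∉ ds.map Prod.fst := by
      rw [← h1]
      intro hel
      rcases he with ⟨x, hx, hex⟩ | he
      · exact hR.not_target_right hl hel hx hex
      · exact hR.not_target hl' hel he
    rw [exitDoor_of_not_mem hef] at hwe
    rcases exitDoor_cases hn1 w with ⟨-, h4⟩ | h4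
    · rw [← h4, hwe]; exact hs
    · rw [hwe] at h4
      exact hs.mv ⟨b, l, hl', .wire (P := ⟨e, false, []⟩) (Q := ⟨w, true, []⟩) (m := m)
            (.inr (by rw [hw]; exact List.mem_map.2 ⟨_, h4, rfl⟩)) hm⟩ hg

end Doors

theorem mv_doors {A Λ₀ : List (Option Edge × Link)} {Γ : List Edge} (hR : Flat (A ++ Λ₀) Γ)
    {b : Option Edge} {l : Link} {ds : List (Edge × Edge)} (hl : (b, l) ∈ A)
    (hw : l.wires = ds.map fun p => (⟨p.1, true, []⟩, ⟨p.2, false, []⟩))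
    (h1 : l.targets = ds.map Prod.fst) (hd : ∀ o ∈ ds.map Prod.snd, o ∉ ds.map Prod.fst) {q : Pos} {e : Edge}
    {m : List Dir} {G : Set Pos} (h : LMv l q (.atom e m) G) :
    ∃ e', q = .atom e' m ∧ (∃ p ∈ ds, e' = p.1 ∨ e' = p.2) ∧ exitDoor ds e' = exitDoor ds e := by
  have hl' : (b, l) ∈ A ++ Λ₀ := List.mem_append_left _ hl
  have hn1 : (ds.map Prod.fst).Nodup := h1 ▸ hR.nodup_targets hl'
  have hio : ∀ p ∈ ds, exitDoor ds p.1 = exitDoor ds p.2 := fun p hp => by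
    rw [exitDoor_of_mem hn1 (o := p.2) hp, exitDoor_of_not_mem (hd _ (List.mem_map_of_mem hp))]
  generalize hq : Pos.atom e m = r at h
  cases h with
  | lock => cases hq
  | wire h hm =>
    simp only [Link.Wire, hw, List.mem_map, Prod.mk.injEq] at h
    rcases h with ⟨p, hp, rfl, rfl⟩ | ⟨p, hp, rfl, rfl⟩
    · simp only [Port.pos, Pos.atom.injEq, List.nil_append] at hq
      obtain ⟨rfl, rfl⟩ := hq
      exact ⟨p.1, rfl, ⟨p, hp, .inl rfl⟩, hio p hp⟩
    · simp only [Port.pos, Pos.atom.injEq, List.nil_append] at hq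
      obtain ⟨rfl, rfl⟩ := hq
      exact ⟨p.2, rfl, ⟨p, hp, .inr rfl⟩, (hio p hp).symm⟩

end SMLL

namespace SMLL

/-! ### Preservation by reduction: commutations -/

/-- The structures `L` and `L'` have the same conclusions `Γ`, and equivalent machines. -/
def Preserved (Γ : List Edge) (L L' : List Link) : Prop :=
  IsStructure L' Γ ∧ Equi Γ (sys (flatten L none) Γ) (sys (flatten L' none) Γ)

theorem Preserved.perm {Γ : List Edge} {L L' M M' : List Link} (h : Preserved Γ M M')
    (hL : L.Perm M) (hL' : L'.Perm M') : Preserved Γ L L' := by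
  refine ⟨h.1.perm hL'.symm, ?_⟩
  rw [sys_congr (flatten_perm hL none), sys_congr (flatten_perm hL' none)]
  exact h.2

theorem Fresh.perm {L L' : List Link} {x : Edge} {A : Formula} (h : Fresh L x A) (hL : L.Perm L') :
    x ∉ allEdges L' ∧ x.ty = A :=
  ⟨fun hx => h.1 ((allEdges_perm hL).mem_iff.2 hx), h.2⟩

theorem IsStructure.typed {L : List Link} {Γ : List Edge} (h : IsStructure L Γ) {l : Link}
    (hl : l ∈ L) : l.Typed := by
  obtain ⟨⟨_, _, typed, _, _⟩, _⟩ := h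
  exact typed l hl

theorem Link.Typed.sync_split {ps qs : List (Edge × Edge)} {p : Edge × Edge}
    (h : (Link.sync (ps ++ p :: qs)).Typed) :
    (p.1.ty = p.2.ty ∧ (p.1.ty.Positive ∨ p.1.ty.Negative)) ∧
    ∀ rs : List (Edge × Edge), rs ≠ [] →
      (∀ r ∈ rs, r.1.ty = r.2.ty ∧ (r.1.ty.Positive ∨ r.1.ty.Negative)) →
      (Link.sync (ps ++ (rs ++ qs))).Typed := by
  refine ⟨h.2 p (by simp), fun rs hne hrs => ⟨by simp [hne], fun r hr => ?_⟩⟩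
  simp only [List.mem_append] at hr
  rcases hr with hr | hr | hr
  · exact h.2 r (by simp [hr])
  · exact hrs r hr
  · exact h.2 r (by simp [hr])

section Commute
variable {K : List Link} {Γ : List Edge} {ps qs : List (Edge × Edge)}

theorem preserved_sync_tensor {a b c d a' b' : Edge}
    (h : IsStructure (.sync (ps ++ (c, d) :: qs) :: .tensor a b c :: K) Γ)
    (ha : a' ∉ allEdges (.sync (ps ++ (c, d) :: qs) :: .tensor a b c :: K)) (hat : a'.ty = a.ty)
    (hb : b' ∉ allEdges (.sync (ps ++ (c, d) :: qs) :: .tensor a b c :: K)) (hbt : b'.ty = b.ty)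
    (hab : a' ≠ b') :
    Preserved Γ (.sync (ps ++ (c, d) :: qs) :: .tensor a b c :: K)
      (.sync (ps ++ (a, a') :: (b, b') :: qs) :: .tensor a' b' d :: K) := by
  obtain ⟨⟨hcd, hpol⟩, hs⟩ := (h.typed (l := .sync (ps ++ (c, d) :: qs)) (by simp)).sync_split
  have ht : c.ty = .tensor a.ty b.ty := h.typed (l := .tensor a b c) (by simp)
  simp only [ht, Formula.Positive, Formula.Negative, or_false] at hpol hcd
  have hst : IsStructure ([.sync (ps ++ (a, a') :: (b, b') :: qs), .tensor a' b' d] ++ K) Γ := by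
    -- The edge `c` disappears, `d` becomes the conclusion of the new tensor, and the conclusions of
    -- the untouched pairs stay.
    refine IsStructure.replace (A := [.sync (ps ++ (c, d) :: qs), .tensor a b c]) (N := [a', b'])
      (M := ps.map Prod.snd ++ qs.map Prod.snd ++ [d]) h (by simp) (by simp) ?_ ?_ ?_ ?_
      (by simpa using hab) ?_
    · simp only [List.mem_cons, List.not_mem_nil, or_false, forall_eq_or_imp, forall_eq]
      refine ⟨hs [(a, a'), (b, b')] (by simp) ?_, ?_⟩
      · simp [hat, hbt, hpol]
      · simp [Link.Typed, hat, hbt, ← hcd]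
    · rw [List.perm_iff_count]; intro x
      simp [Link.prems, Link.concls, List.count_cons]; omega
    · rw [List.perm_iff_count]; intro x
      simp [Link.concls, List.count_cons]; omega
    · rw [List.subperm_iff_count]; intro x
      simp [Link.concls, List.count_cons]
    · rintro e he
      simp only [List.mem_cons, List.not_mem_nil, or_false] at he
      rcases he with rfl | rfl
      exacts [ha, hb]
  exact ⟨hst, equi_sync_tensor h.flat hst.flat⟩

theorem preserved_sync_par {a b c d a' b' : Edge}
    (h : IsStructure (.sync (ps ++ (c, d) :: qs) :: .par a b c :: K) Γ)
    (ha : a' ∉ allEdges (.sync (ps ++ (c, d) :: qs) :: .par a b c :: K)) (hat : a'.ty = a.ty)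
    (hb : b' ∉ allEdges (.sync (ps ++ (c, d) :: qs) :: .par a b c :: K)) (hbt : b'.ty = b.ty)
    (hab : a' ≠ b') :
    Preserved Γ (.sync (ps ++ (c, d) :: qs) :: .par a b c :: K)
      (.sync (ps ++ (a, a') :: (b, b') :: qs) :: .par a' b' d :: K) := by
  obtain ⟨⟨hcd, hpol⟩, hs⟩ := (h.typed (l := .sync (ps ++ (c, d) :: qs)) (by simp)).sync_split
  have ht : c.ty = .par a.ty b.ty := h.typed (l := .par a b c) (by simp)
  simp only [ht, Formula.Positive, Formula.Negative, false_or] at hpol hcd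
  have hst : IsStructure ([.sync (ps ++ (a, a') :: (b, b') :: qs), .par a' b' d] ++ K) Γ := by
    refine IsStructure.replace (A := [.sync (ps ++ (c, d) :: qs), .par a b c]) (N := [a', b'])
      (M := ps.map Prod.snd ++ qs.map Prod.snd ++ [d]) h (by simp) (by simp) ?_ ?_ ?_ ?_
      (by simpa using hab) ?_
    · simp only [List.mem_cons, List.not_mem_nil, or_false, forall_eq_or_imp, forall_eq]
      refine ⟨hs [(a, a'), (b, b')] (by simp) ?_, ?_⟩
      · simp [hat, hbt, hpol]
      · simp [Link.Typed, hat, hbt, ← hcd]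
    · rw [List.perm_iff_count]; intro x
      simp [Link.prems, Link.concls, List.count_cons]; omega
    · rw [List.perm_iff_count]; intro x
      simp [Link.concls, List.count_cons]; omega
    · rw [List.subperm_iff_count]; intro x
      simp [Link.concls, List.count_cons]
    · rintro e he
      simp only [List.mem_cons, List.not_mem_nil, or_false] at he
      rcases he with rfl | rfl
      exacts [ha, hb]
  exact ⟨hst, equi_sync_par h.flat hst.flat⟩

theorem preserved_ax_sync {x : Link} {e f g f' : Edge} (hx : IsAx x e f) (hp : e.ty.Positive)
    (h : IsStructure (.sync (ps ++ (e, g) :: qs) :: x :: K) Γ)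
    (hf : f' ∉ allEdges (.sync (ps ++ (e, g) :: qs) :: x :: K)) (hft : f'.ty = f.ty) :
    Preserved Γ (.sync (ps ++ (e, g) :: qs) :: x :: K)
      (.sync (ps ++ (f', f) :: qs) :: .ax g f' :: K) := by
  obtain ⟨⟨heg, -⟩, hs⟩ := (h.typed (l := .sync (ps ++ (e, g) :: qs)) (by simp)).sync_split
  have ht : f.ty = e.ty.dual := hx.dual (h.typed (by simp))
  have hst : IsStructure ([.sync (ps ++ (f', f) :: qs), .ax g f'] ++ K) Γ := by
    -- The edge `e` disappears; `f` and `g` remain but exchange sources, `f` now coming from the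
    -- sync link and `g` from the axiom.
    refine IsStructure.replace (A := [.sync (ps ++ (e, g) :: qs), x]) (N := [f'])
      (M := ps.map Prod.snd ++ f :: qs.map Prod.snd ++ [g]) h
      (by rcases hx with rfl | rfl <;> simp) (by simp) ?_ ?_ ?_ ?_ (by simp) (by simpa using hf)
    · simp only [List.mem_cons, List.not_mem_nil, or_false, forall_eq_or_imp, forall_eq]
      refine ⟨hs [(f', f)] (by simp) ?_, ?_⟩
      · simp [hft, ht, hp.dual]
      · simp only [Link.Typed, hft, ht]
        exact congrArg _ heg
    · rw [List.perm_iff_count]; intro z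
      rcases hx with rfl | rfl <;> simp [Link.prems, Link.concls, List.count_cons] <;> omega
    · rw [List.perm_iff_count]; intro z
      simp [Link.concls, List.count_cons]; omega
    · rw [List.subperm_iff_count]; intro z
      rcases hx with rfl | rfl <;> simp [Link.concls, List.count_cons] <;> omega
  have hfl : ∀ M : List Link, flatten (.sync (ps ++ (e, g) :: qs) :: x :: M) none =
      [(none, .sync (ps ++ (e, g) :: qs)), (none, x)] ++ flatten M none := by
    rcases hx with rfl | rfl <;> intro M <;> rfl
  have h' := h.flat
  refine ⟨hst, ?_⟩
  rw [hfl] at h' ⊢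
  exact equi_ax_sync hx hp h' hst.flat

theorem preserved_cut_sync {y : Link} {c d g g' : Edge} (hy : IsCut y d g) (hn : d.ty.Negative)
    (h : IsStructure (.sync (ps ++ (c, d) :: qs) :: y :: K) Γ)
    (hg : g' ∉ allEdges (.sync (ps ++ (c, d) :: qs) :: y :: K)) (hgt : g'.ty = g.ty) :
    Preserved Γ (.sync (ps ++ (c, d) :: qs) :: y :: K)
      (.sync (ps ++ (g, g') :: qs) :: .cut c g' :: K) := by
  obtain ⟨⟨hcd, -⟩, hs⟩ := (h.typed (l := .sync (ps ++ (c, d) :: qs)) (by simp)).sync_split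
  have ht : g.ty = d.ty.dual := hy.dual (h.typed (by simp))
  have hst : IsStructure ([.sync (ps ++ (g, g') :: qs), .cut c g'] ++ K) Γ := by
    refine IsStructure.replace (A := [.sync (ps ++ (c, d) :: qs), y]) (N := [g'])
      (M := ps.map Prod.snd ++ qs.map Prod.snd) h
      (by rcases hy with rfl | rfl <;> simp) (by simp) ?_ ?_ ?_ ?_ (by simp) (by simpa using hg)
    · simp only [List.mem_cons, List.not_mem_nil, or_false, forall_eq_or_imp, forall_eq]
      refine ⟨hs [(g, g')] (by simp) ?_, ?_⟩
      · simp [hgt, ht, hn.dual]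
      · simp only [Link.Typed, hgt, ht]
        exact congrArg _ hcd.symm
    · rw [List.perm_iff_count]; intro z
      rcases hy with rfl | rfl <;> simp [Link.prems, Link.concls, List.count_cons] <;> omega
    · rw [List.perm_iff_count]; intro z
      simp [Link.concls, List.count_cons]; omega
    · rw [List.subperm_iff_count]; intro z
      rcases hy with rfl | rfl <;> simp [Link.concls, List.count_cons]
  have hfl : ∀ M : List Link, flatten (.sync (ps ++ (c, d) :: qs) :: y :: M) none =
      [(none, .sync (ps ++ (c, d) :: qs)), (none, y)] ++ flatten M none := by
    rcases hy with rfl | rfl <;> intro M <;> rfl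
  have h' := h.flat
  refine ⟨hst, ?_⟩
  rw [hfl] at h' ⊢
  exact equi_cut_sync hy hn h' hst.flat

theorem preserved_tensor_par {y : Link} {a b c a' b' c' : Edge} (hy : IsCut y c c')
    (h : IsStructure (.tensor a b c :: .par a' b' c' :: y :: K) Γ) :
    Preserved Γ (.tensor a b c :: .par a' b' c' :: y :: K) (.cut a a' :: .cut b b' :: K) := by
  have ht1 : c.ty = .tensor a.ty b.ty := h.typed (l := .tensor a b c) (by simp)
  have ht2 : c'.ty = .par a'.ty b'.ty := h.typed (l := .par a' b' c') (by simp)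
  have ht3 : c'.ty = c.ty.dual := hy.dual (h.typed (by simp))
  rw [ht1, ht2] at ht3
  simp only [Formula.dual, Formula.par.injEq] at ht3
  have hst : IsStructure ([.cut a a', .cut b b'] ++ K) Γ := by
    refine IsStructure.replace (A := [.tensor a b c, .par a' b' c', y]) (N := [])
      (M := []) h (by rcases hy with rfl | rfl <;> simp) (by simp) ?_ ?_ ?_ ?_ (by simp) (by simp)
    · simpa [Link.Typed] using ht3
    · rw [List.perm_iff_count]; intro z
      rcases hy with rfl | rfl <;> simp [Link.prems, Link.concls, List.count_cons] <;> omega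
    · simp [Link.concls]
    · simp
  have hfl : ∀ M : List Link, flatten (.tensor a b c :: .par a' b' c' :: y :: M) none =
      [(none, .tensor a b c), (none, .par a' b' c'), (none, y)] ++ flatten M none := by
    rcases hy with rfl | rfl <;> intro M <;> rfl
  have h' := h.flat
  refine ⟨hst, ?_⟩
  rw [hfl] at h' ⊢
  exact equi_tensor_par hy h' hst.flat

end Commute
end SMLL

namespace SMLL

/-! ### Preservation by reduction: contractions -/

theorem IsStructure.boxes {L : List Link} {Γ : List Edge} (h : IsStructure L Γ) {e : Edge}
    {ds : List (Edge × Edge)} {C : List Link} (hl : Link.box e ds C ∈ L) :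
    WellFormed C (ds.map Prod.fst) := by
  obtain ⟨⟨_, _, _, _, boxes⟩, _⟩ := h
  exact boxes e ds C hl

theorem IsStructure.edges {L : List Link} {Γ : List Edge} (h : IsStructure L Γ) :
    (L.flatMap Link.prems ++ Γ).Perm (L.flatMap Link.concls) := by
  obtain ⟨⟨_, _, _, edges, _⟩, _⟩ := h
  exact edges

theorem IsStructure.not_mem_concls {L : List Link} {Γ : List Edge} (h : IsStructure L Γ) {e : Edge}
    {ds : List (Edge × Edge)} {C : List Link} (hl : Link.box e ds C ∈ L) {z : Edge}
    (hz : z ∈ allEdges C) : z ∉ L.flatMap Link.concls := by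
  have hn := (allEdges_perm_append L).nodup_iff.1 h.2
  exact fun hz' => (List.nodup_append.1 hn).2.2 z hz' z (List.mem_flatMap.2 ⟨_, hl, hz⟩) rfl

theorem mem_flatten_of_not_box {A : List Link} (hA : ∀ l ∈ A, ∀ e ds C, l ≠ .box e ds C)
    {b : Option Edge} {x : Option Edge × Link} : x ∈ flatten A b ↔ x.1 = b ∧ x.2 ∈ A := by
  rw [flatten_eq_flatMap, List.mem_flatMap]
  have hf : ∀ l ∈ A, l.flat b = [(b, l)] := fun l hl => by
    cases l with
    | box e ds C => exact (hA _ hl e ds C rfl).elim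
    | _ => rfl
  constructor
  · rintro ⟨l, hl, hx⟩
    rw [hf l hl, List.mem_singleton] at hx
    subst hx
    exact ⟨rfl, hl⟩
  · rintro ⟨rfl, hx⟩
    exact ⟨_, hx, by simp [hf _ hx]⟩

theorem shell_mem_flatten {K : List Link} {l : Link} (hl : l ∈ K) (b : Option Edge) :
    (b, l.shell) ∈ flatten K b := by
  rw [flatten_eq_flatMap]
  exact List.mem_flatMap.2 ⟨l, hl, l.shell_mem_flat b⟩

theorem Link.mem_shell_targets {l : Link} {e : Edge} (h : e ∈ l.prems) : e ∈ l.shell.targets := by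
  cases l with
  | box => cases h
  | _ => exact h

theorem Link.concls_shell (l : Link) : l.shell.concls = l.concls := by
  cases l <;> rfl

theorem Link.shell_touches {l : Link} {e : Edge} (h : e ∈ l.prems ∨ e ∈ l.concls) :
    e ∈ l.shell.concls ∨ e ∈ l.shell.targets := by
  rw [Link.concls_shell]
  exact h.symm.imp_right Link.mem_shell_targets

/-- The positions where tokens leave one of the located links `Λ₀` or start in a conclusion. -/
def Emits (Λ₀ : List (Option Edge × Link)) (Γ : List Edge) (e : Edge) (m : List Dir) : Prop :=
  ((∃ x ∈ Λ₀, e ∈ x.2.concls) ∧ e.ty.polarity m = some true) ∨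
    (((∃ x ∈ Λ₀, e ∈ x.2.targets) ∨ e ∈ Γ) ∧ e.ty.polarity m = some false)

/-- The case in which `A` contains neither box nor `one` link: no edge has to be discarded, and
boxes follow the renaming of their locks. -/
theorem preserved_contract {A K : List Link} {Γ : List Edge} {σ : Edge → Edge}
    (h : IsStructure (A ++ K) Γ) (hA : ∀ l ∈ A, ∀ e ds C, l ≠ .box e ds C)
    (hA' : ∀ l ∈ A, ∀ e, l ≠ .one e)
    (hty : ∀ x ∈ flatten K none, ∀ e, e ∈ x.2.concls ∨ e ∈ x.2.targets → (σ e).ty = e.ty)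
    (hedges : ((A.flatMap Link.prems).map σ).Perm ((A.flatMap Link.concls).map σ))
    (hΓ : ∀ e ∈ Γ, σ e = e) (hσ : ∀ z, z ∉ (A ++ K).flatMap Link.concls → σ z = z)
    (hinj : ∀ z ∈ allEdges K, ∀ w ∈ allEdges K, σ z = σ w → z = w)
    (mv : ∀ l ∈ A, ∀ e m q G, LMv l q (.atom e m) G → ∃ e', q = .atom e' m ∧ σ e' = σ e)
    (fill : ∀ s e m, (sys (flatten A none ++ flatten K none) Γ).Vis s (.atom e m) →
      Emits (flatten K none) Γ e m → ∀ w, σ w = σ e →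
        (sys (flatten A none ++ flatten K none) Γ).Vis s (.atom w m)) :
    Preserved Γ (A ++ K) (K.map (Link.rename σ)) := by
  have hfix : ∀ e ds C, Link.box e ds C ∈ K → ∀ z ∈ allEdges C, σ z = z := fun e ds C hl z hz =>
    hσ z (h.not_mem_concls (List.mem_append_right _ hl) hz)
  have hst : IsStructure (K.map (Link.rename σ)) Γ := by
    refine IsStructure.rename (fun l hl => h.typed (List.mem_append_right _ hl))
      (fun e ds C hl => h.boxes (List.mem_append_right _ hl))
      (fun l hl e he => hty _ (shell_mem_flatten hl none) e (Link.shell_touches he)) ?_ hfix ?_ hinj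
    · have hΓ' : Γ.map σ = Γ := by
        conv_rhs => rw [← List.map_id Γ]
        exact List.map_congr_left hΓ
      have := h.edges.map σ
      simp only [List.flatMap_append, List.map_append, hΓ', List.append_assoc] at this
      exact (List.perm_append_left_iff _).1 ((hedges.symm.append_right _).trans this)
    · have := h.2
      rw [allEdges_append] at this
      exact (List.nodup_append.1 this).2.1
  have hfl : (flatten K none).map (fun x => (x.1.map σ, x.2.mapEdges σ)) =
      flatten (K.map (Link.rename σ)) none :=
    flatten_rename rfl fun e ds C hl => ⟨h.boxes (List.mem_append_right _ hl), rfl,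
      fun z hz => by simp [hfix e ds C hl z hz]⟩
  have hF : Flat (flatten A none ++ flatten K none) Γ := by rw [← flatten_append]; exact h.flat
  have hloc : ∀ x ∈ flatten K none, ∀ z, x.1 = some z → ∃ x' ∈ flatten K none, z ∈ x'.2.concls := by
    intro x hx z hz
    obtain ⟨b, ds, hb⟩ := hF.located x (List.mem_append_right _ hx) z hz
    rcases List.mem_append.1 hb with hb | hb
    · exact (hA _ ((mem_flatten_of_not_box hA).1 hb).2 z ds [] rfl).elim
    · exact ⟨_, hb, .head _⟩
  refine ⟨hst, ?_⟩
  rw [flatten_append, ← hfl]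
  have hone : ∀ {b e}, (b, Link.one e) ∈ flatten A none → False := fun hl =>
    hA' _ ((mem_flatten_of_not_box hA).1 hl).2 _ rfl
  refine Contraction.equi (D := fun _ => True) ⟨hF, ?_, fun x hx e he => ⟨hty x hx e he, trivial⟩,
    fun e he => ⟨hΓ e he, trivial⟩, ?_, ?_, ?_, fun b e hl => (hone hl).elim,
    fun b e hl => (hone hl).elim, ?_, fun s e m hs he w _ hw => fill s e m hs he w hw⟩
  · rw [hfl]; exact hst.flat
  · intro x hx e he
    obtain ⟨z, hz, rfl⟩ := Option.map_eq_some_iff.1 he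
    exact ⟨z, hz, rfl, hloc x hx z hz⟩
  · intro x hx z hz
    exact .inr ⟨by simp [hz], hloc x hx z hz⟩
  · intro x hx e m q G hmv _
    obtain ⟨e', h1, h2⟩ := mv _ ((mem_flatten_of_not_box hA).1 hx).2 e m q G hmv
    exact ⟨e', h1, trivial, h2⟩
  · intro b e ds C hl
    exact (hA _ ((mem_flatten_of_not_box hA).1 hl).2 e ds C rfl).elim

/-- The edges `e`, `f`, `g` are merged into `e`. A positive token emitted on `g` goes through the
cut and then the axiom; a negative one on `e` takes the opposite way. -/
theorem preserved_ax_cut {K : List Link} {Γ : List Edge} {x y : Link} {e f g : Edge}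
    (hx : IsAx x e f) (hy : IsCut y f g) (h : IsStructure (x :: y :: K) Γ) :
    Preserved Γ (x :: y :: K) (K.map (Link.rename fun z => if z = g then e else z)) := by
  have hA : ∀ l ∈ [x, y], ∀ e ds C, l ≠ .box e ds C := by
    rcases hx with rfl | rfl <;> rcases hy with rfl | rfl <;> simp
  have h' : IsStructure ([x, y] ++ K) Γ := h
  have hF : Flat (flatten [x, y] none ++ flatten K none) Γ := by
    rw [← flatten_append]; exact h'.flat
  have hxm : (none, x) ∈ flatten [x, y] none := (mem_flatten_of_not_box hA).2 (by simp)
  have hym : (none, y) ∈ flatten [x, y] none := (mem_flatten_of_not_box hA).2 (by simp)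
  have hfe : f.ty = e.ty.dual := hx.dual (h.typed (by simp))
  have hgf : g.ty = f.ty.dual := hy.dual (h.typed (by simp))
  have hge : g.ty = e.ty := by rw [hgf, hfe, Formula.dual_dual]
  have hc : ∀ z, z = e ∨ z = f → ∀ l ∈ flatten K none, z ∉ l.2.concls := by
    intro z hz l hl
    refine hF.not_concl_right hxm ?_ hl
    rcases hz with rfl | rfl
    exacts [hx.mem.1, hx.mem.2]
  have ht : ∀ z, z = f ∨ z = g → z ∉ Γ ∧ ∀ l ∈ flatten K none, z ∉ l.2.targets := by
    intro z hz
    have hzy : z ∈ y.targets := by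
      rcases hz with rfl | rfl
      exacts [hy.mem.1, hy.mem.2]
    exact ⟨hF.not_target (List.mem_append_left _ hym) hzy, fun l hl =>
      hF.not_target_right hym hzy hl⟩
  have hnf : ∀ l ∈ K, ∀ z, z ∈ l.concls ∨ z ∈ l.prems → z ≠ f := by
    rintro l hl z hz rfl
    rcases Link.shell_touches hz.symm with hz | hz
    · exact hc z (.inr rfl) _ (shell_mem_flatten hl none) hz
    · exact (ht z (.inl rfl)).2 _ (shell_mem_flatten hl none) hz
  -- The step only sends `g` to `e`. Sending `f` there too changes nothing on `K`, where `f` does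
  -- not occur, and makes the whole redex a single class.
  set σ : Edge → Edge := fun z => if z = g ∨ z = f then e else z with hσ
  have hren : K.map (Link.rename fun z => if z = g then e else z) = K.map (Link.rename σ) := by
    refine List.map_congr_left fun l hl => Link.rename_congr fun z hz => ?_
    simp [hσ, hnf l hl z hz]
  have hσe : σ e = e := by simp [hσ]
  have hσf : σ f = e := by simp [hσ]
  have hσg : σ g = e := by simp [hσ]
  have hσz : ∀ {z}, z ≠ g → z ≠ f → σ z = z := fun h1 h2 => by simp [hσ, h1, h2]
  have hσ' : ∀ {z}, z ≠ e → z ≠ f → z ≠ g → ∀ {w}, σ w = σ z → w = z := by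
    intro z h1 h2 h3 w hw
    rw [hσz h3 h2] at hw
    by_cases hw' : w = g ∨ w = f
    · simp only [hσ, hw', if_true] at hw; exact (h1 hw.symm).elim
    · simpa only [hσ, hw', if_false] using hw
  rw [hren]
  refine preserved_contract h' hA ?_ ?_ ?_ ?_ ?_ ?_ ?_ ?_
  · rcases hx with rfl | rfl <;> rcases hy with rfl | rfl <;> simp
  · intro l hl z hz
    have hzf : z ≠ f := by
      rintro rfl
      exact hz.elim (hc z (.inr rfl) l hl) ((ht z (.inl rfl)).2 l hl)
    by_cases hzg : z = g
    · rw [hzg, hσg, hge]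
    · rw [hσz hzg hzf]
  · rcases hx with rfl | rfl <;> rcases hy with rfl | rfl <;>
      simp [Link.prems, Link.concls, hσe, hσf, hσg]
  · intro z hz
    exact hσz (fun hzg => (ht z (.inr hzg)).1 hz) fun hzf => (ht z (.inl hzf)).1 hz
  · intro z hz
    rw [← h'.edges.mem_iff] at hz
    refine hσz ?_ ?_ <;> rintro rfl <;> refine hz (List.mem_append_left _ ?_) <;>
      rcases hy with rfl | rfl <;> simp [Link.prems]
  · have hK : ∀ z ∈ allEdges K, z ≠ e ∧ z ≠ f := by
      intro z hz
      rw [allEdges_eq_flatten K none, List.mem_flatMap] at hz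
      obtain ⟨l, hl, hz⟩ := hz
      exact ⟨fun h => hc z (.inl h) l hl hz, fun h => hc z (.inr h) l hl hz⟩
    intro z hz w hw hzw
    by_cases hzg : z = g
    · by_cases hwg : w = g
      · rw [hzg, hwg]
      · exact hσ' (hK w hw).1 (hK w hw).2 hwg hzw
    · exact (hσ' (hK z hz).1 (hK z hz).2 hzg hzw.symm).symm
  · intro l hl z m q G hmv
    simp only [List.mem_cons, List.not_mem_nil, or_false] at hl
    rcases hl with rfl | rfl
    · obtain ⟨m', ⟨-, rfl, h2⟩ | ⟨-, rfl, h2⟩, -⟩ := (ax_lmv hx).1 hmv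
      all_goals cases h2
      · exact ⟨_, rfl, by rw [hσe, hσf]⟩
      · exact ⟨_, rfl, by rw [hσe, hσf]⟩
    · obtain ⟨m', ⟨-, rfl, h2⟩ | ⟨-, rfl, h2⟩, -⟩ := (cut_lmv hy).1 hmv
      all_goals cases h2
      · exact ⟨_, rfl, by rw [hσg, hσf]⟩
      · exact ⟨_, rfl, by rw [hσg, hσf]⟩
  · intro s z m hs hz w hw
    have hax : ∀ {p q}, LMv x p q ∅ → (sys (flatten [x, y] none ++ flatten K none) Γ).Mv p q ∅ :=
      fun h => ⟨none, x, List.mem_append_left _ hxm, h⟩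
    have hcut : ∀ {p q}, LMv y p q ∅ → (sys (flatten [x, y] none ++ flatten K none) Γ).Mv p q ∅ :=
      fun h => ⟨none, y, List.mem_append_left _ hym, h⟩
    have hwc : σ w = e → w = e ∨ w = f ∨ w = g := by
      intro hw
      by_cases hw' : w = g ∨ w = f
      · exact hw'.elim (.inr ∘ .inr) (.inr ∘ .inl)
      · simp only [hσ, hw', if_false] at hw; exact .inl hw
    rcases hz with ⟨⟨l, hl, hzl⟩, hm⟩ | ⟨hz, hm⟩
    · have hze : z ≠ e := fun h => hc z (.inl h) l hl hzl
      have hzf : z ≠ f := fun h => hc z (.inr h) l hl hzl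
      by_cases hzg : z = g
      · subst hzg
        have hsf := hs.mv (hcut ((cut_lmv hy).2 ⟨m, .inr ⟨hm, rfl, rfl⟩, rfl⟩)) (by simp)
        have hse := hsf.mv (hax ((ax_lmv hx).2 ⟨m, .inr ⟨?_, rfl, rfl⟩, rfl⟩)) (by simp)
        · rcases hwc (by rw [hw, hσg]) with rfl | rfl | rfl
          exacts [hse, hsf, hs]
        · rw [hfe, Formula.polarity_dual, ← hge, hm]; rfl
      · rwa [hσ' hze hzf hzg hw]
    · have hzfg : z ≠ f ∧ z ≠ g := by
        constructor <;> intro h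
        · rcases hz with ⟨l, hl, hzl⟩ | hz
          exacts [(ht z (.inl h)).2 l hl hzl, (ht z (.inl h)).1 hz]
        · rcases hz with ⟨l, hl, hzl⟩ | hz
          exacts [(ht z (.inr h)).2 l hl hzl, (ht z (.inr h)).1 hz]
      by_cases hze : z = e
      · subst hze
        have hsf := hs.mv (hax ((ax_lmv hx).2 ⟨m, .inl ⟨hm, rfl, rfl⟩, rfl⟩)) (by simp)
        have hsg := hsf.mv (hcut ((cut_lmv hy).2 ⟨m, .inl ⟨?_, rfl, rfl⟩, rfl⟩)) (by simp)
        · rcases hwc (by rw [hw, hσe]) with rfl | rfl | rfl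
          exacts [hs, hsf, hsg]
        · rw [hfe, Formula.polarity_dual, hm]; rfl
      · rwa [hσ' hze hzfg.1 hzfg.2 hw]

/-- All the entries of the sync link are visited at once, by the tokens of its `one` links, so it
never holds a token back. It is contracted, while the `one` links survive with their conclusions
renamed by `exitDoor ps`. -/
theorem preserved_sync_one {K : List Link} {Γ : List Edge} {ps : List (Edge × Edge)}
    (h : IsStructure (.sync ps :: (ps.map fun p => Link.one p.1) ++ K) Γ) :
    Preserved Γ (.sync ps :: (ps.map fun p => Link.one p.1) ++ K)
      ((ps.map fun p => Link.one p.2) ++ K) := by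
  set K' := (ps.map fun p => Link.one p.1) ++ K with hK'
  have hA : ∀ l ∈ [Link.sync ps], ∀ e ds C, l ≠ .box e ds C := by simp
  have h' : IsStructure ([Link.sync ps] ++ K') Γ := h
  have hF : Flat (flatten [Link.sync ps] none ++ flatten K' none) Γ := by
    rw [← flatten_append]; exact h'.flat
  have hm : (none, Link.sync ps) ∈ flatten [Link.sync ps] none :=
    (mem_flatten_of_not_box hA).2 (by simp)
  have hm' := List.mem_append_left (flatten K' none) hm
  have hn1 : (ps.map Prod.fst).Nodup := hF.nodup_targets hm'
  have hn2 : (ps.map Prod.snd).Nodup := hF.nodup_concls hm'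
  have htyped := (h.typed (l := .sync ps) (by simp)).2
  have hone : ∀ p ∈ ps, Link.one p.1 ∈ K' := fun p hp =>
    List.mem_append_left _ (List.mem_map.2 ⟨p, hp, rfl⟩)
  have hone1 : ∀ p ∈ ps, p.1.ty = .one := fun p hp =>
    h'.typed (l := .one p.1) (List.mem_append_right _ (hone p hp))
  have hsnd : ∀ z ∈ ps.map Prod.snd, z ∉ allEdges K' := by
    intro z hz hz'
    have hn := h'.2
    rw [allEdges_append, List.nodup_append] at hn
    exact hn.2.2 z (by simpa [allEdges, Link.deepConcls] using hz) z hz' rfl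
  have hfst : ∀ z ∈ ps.map Prod.fst, z ∈ K'.flatMap Link.concls := by
    intro z hz
    obtain ⟨p, hp, rfl⟩ := List.mem_map.1 hz
    exact List.mem_flatMap.2 ⟨_, hone p hp, .head _⟩
  have hd : ∀ z ∈ ps.map Prod.snd, z ∉ ps.map Prod.fst := fun z hz hz' =>
    hsnd z hz (by rw [(allEdges_perm_append K').mem_iff]; exact List.mem_append_left _ (hfst z hz'))
  -- The types are all `1`, so the entries are the premisses, and the `one` links at depth 0
  -- generate without condition.
  have hguard : ∀ g ∈ (Link.sync ps).guard,
      (sys (flatten [Link.sync ps] none ++ flatten K' none) Γ).V g := by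
    rintro g ⟨P, Q, m, hPQ, hP, rfl⟩
    simp only [Link.Wire, Link.wires, List.mem_map, Prod.mk.injEq] at hPQ
    rcases hPQ with ⟨p, hp, rfl, rfl⟩ | ⟨p, hp, rfl, rfl⟩
    · have hm0 : m = [] := by
        have : p.1.ty.polarity m = some true := hP
        rw [hone1 p hp] at this
        cases m <;> simp_all [Formula.polarity]
      subst hm0
      refine ⟨_, .gen (G := ∅) (.inr ⟨none, p.1, ?_, rfl, ?_⟩) (by simp)⟩
      · exact List.mem_append_right _ (shell_mem_flatten (hone p hp) none)
      · simp [boxGuard]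
    · exfalso
      have : p.2.ty.polarity m = some false := hP
      rw [← (htyped p hp).1, hone1 p hp] at this
      cases m <;> simp_all [Formula.polarity]
  have hfix : ∀ z, z ∉ K'.flatMap Link.concls → exitDoor ps z = z := fun z hz =>
    exitDoor_of_not_mem fun hz' => hz (hfst z hz')
  have hren : (ps.map fun p => Link.one p.2) ++ K = K'.map (Link.rename (exitDoor ps)) := by
    rw [hK', List.map_append, map_rename_of_fixed (L := K)]
    · simp only [List.map_map, List.append_cancel_right_eq]
      refine List.map_congr_left fun p hp => ?_
      simp [Link.rename, exitDoor_of_mem hn1 (o := p.2) hp]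
    · intro l hl z hz
      refine exitDoor_of_not_mem fun hz' => ?_
      rcases hz with hz | hz
      · have hn := (List.nodup_append.1 ((allEdges_perm_append K').nodup_iff.1
          (by have := h'.2; rw [allEdges_append] at this; exact (List.nodup_append.1 this).2.1))).1
        rw [hK', List.flatMap_append, List.nodup_append] at hn
        obtain ⟨p, hp, rfl⟩ := List.mem_map.1 hz'
        exact hn.2.2 p.1 (List.mem_flatMap.2 ⟨_, List.mem_map.2 ⟨p, hp, rfl⟩, .head _⟩) p.1
          (List.mem_flatMap.2 ⟨l, hl, hz⟩) rfl
      · exact hF.not_target_right hm hz' (shell_mem_flatten (List.mem_append_right _ hl) none)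
          (Link.mem_shell_targets hz)
  rw [hren]
  refine preserved_contract h' hA (by simp) ?_ ?_ ?_ ?_ ?_ ?_ ?_
  · intro x _ e _
    exact exitDoor_ty hn1 (fun p hp => (htyped p hp).1) e
  · simp only [List.flatMap_cons, List.flatMap_nil, List.append_nil, Link.prems, Link.concls]
    rw [map_exitDoor_fst hn1]
    conv_lhs => rw [← List.map_id (ps.map Prod.snd)]
    exact .of_eq (List.map_congr_left fun z hz => (exitDoor_of_not_mem (hd z hz)).symm)
  · intro z hz
    refine exitDoor_of_not_mem fun hz' => hF.not_target hm' hz' hz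
  · intro z hz
    refine hfix z fun hz' => hz ?_
    rw [List.flatMap_append]; exact List.mem_append_right _ hz'
  · intro z hz w hw hzw
    exact exitDoor_inj hn1 hn2 (fun hz' => hsnd z hz' hz) (fun hw' => hsnd w hw' hw) hzw
  · intro l hl e m q G hmv
    obtain rfl := List.mem_singleton.1 hl
    obtain ⟨e', h1, -, h2⟩ := mv_doors hF hm rfl rfl hd hmv
    exact ⟨e', h1, h2⟩
  · intro s e m hs he w hw
    exact fill_doors hF hm rfl rfl (List.Sublist.refl _) hguard s e m hs he w hw

end SMLL

namespace SMLL

/-! ### Preservation by reduction: opening a box -/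

/-- The token of the `one` link goes through the cut to the lock, so the box is certainly unlocked
and its border is crossed freely. The box is contracted along its doors, and its content moves to
depth 0. -/
theorem preserved_box_open {K C : List Link} {Γ : List Edge} {y : Link} {ds : List (Edge × Edge)}
    {e f : Edge} (hy : IsCut y e f) (h : IsStructure (.one e :: y :: .box f ds C :: K) Γ) :
    Preserved Γ (.one e :: y :: .box f ds C :: K) (C.map (Link.rename (exitDoor ds)) ++ K) := by
  set σ := exitDoor ds with hσ
  have hbox : Link.box f ds C ∈ Link.one e :: y :: .box f ds C :: K := by simp
  have hK : ∀ {l}, l ∈ K → l ∈ Link.one e :: y :: .box f ds C :: K := fun hl => by simp [hl]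
  have hC : WellFormed C (ds.map Prod.fst) := h.boxes hbox
  obtain ⟨hC1, hC2⟩ := hC.mem_allEdges
  have hCs : (∀ l ∈ C, l.Typed) ∧
      (C.flatMap Link.prems ++ ds.map Prod.fst).Perm (C.flatMap Link.concls) ∧
      ∀ e ds' C', Link.box e ds' C' ∈ C → WellFormed C' (ds'.map Prod.fst) := by
    cases hC with
    | mk _ _ typed edges boxes => exact ⟨typed, edges, boxes⟩
  obtain ⟨hCt, hCe, hCb⟩ := hCs
  have hbt : f.ty = .bot ∧ ∀ p ∈ ds, p.1.ty = p.2.ty := h.typed hbox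
  have he1 : e.ty = .one := h.typed (l := .one e) (by simp)
  -- distinctness of the edges
  have hnod : (e :: f :: (ds.map Prod.snd ++ (allEdges C ++ allEdges K))).Nodup := by
    have := h.2
    rcases hy with rfl | rfl <;> simpa [allEdges, Link.deepConcls] using this
  simp only [List.nodup_cons, List.mem_cons, List.mem_append, not_or] at hnod
  obtain ⟨⟨hef, hes, heC, heK⟩, ⟨hfs, hfC, hfK⟩, hnod⟩ := hnod
  rw [List.nodup_append] at hnod
  obtain ⟨hn2, hnCK, hdisj⟩ := hnod
  have hsC : ∀ z ∈ ds.map Prod.snd, z ∉ allEdges C := fun z hz hz' =>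
    hdisj z hz z (List.mem_append_left _ hz') rfl
  have hsK : ∀ z ∈ ds.map Prod.snd, z ∉ allEdges K := fun z hz hz' =>
    hdisj z hz z (List.mem_append_right _ hz') rfl
  have hCK : ∀ z ∈ allEdges C, z ∉ allEdges K := fun z hz hz' =>
    (List.nodup_append.1 hnCK).2.2 z hz z hz' rfl
  have hnC : (allEdges C).Nodup := (List.nodup_append.1 hnCK).1
  have hCstr : IsStructure C (ds.map Prod.fst) := ⟨hC, hnC⟩
  -- the flat view
  set A : List (Option Edge × Link) := [(none, .one e), (none, y), (none, .box f ds [])] with hA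
  set Λ₀ := flatten C (some f) ++ flatten K none with hΛ₀
  have hfl : flatten (.one e :: y :: .box f ds C :: K) none = A ++ Λ₀ := by
    rcases hy with rfl | rfl <;> simp [hA, hΛ₀, flatten, Link.flat]
  have hF : Flat (A ++ Λ₀) Γ := hfl ▸ h.flat
  have hyA : (none, y) ∈ A := by simp [hA]
  have hbA : (none, Link.box f ds []) ∈ A := by simp [hA]
  have hmem : ∀ {x}, x ∈ A ↔ x = (none, .one e) ∨ x = (none, y) ∨ x = (none, .box f ds []) := by
    simp [hA]
  have hn1 : (ds.map Prod.fst).Nodup := hF.nodup_targets (List.mem_append_left _ hbA)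
  have hd : ∀ z ∈ ds.map Prod.snd, z ∉ ds.map Prod.fst := fun z hz hz' => hsC z hz (hC2 z hz')
  have hfixC : ∀ e' ds' C', Link.box e' ds' C' ∈ C → ∀ z ∈ allEdges C', σ z = z := by
    intro e' ds' C' hl z hz
    refine exitDoor_of_not_mem fun hz' => hCstr.not_mem_concls hl hz ?_
    rw [← hCe.mem_iff]; exact List.mem_append_right _ hz'
  have hfixE : ∀ z ∈ allEdges K, σ z = z := fun z hz =>
    exitDoor_of_not_mem fun hz' => hCK z (hC2 z hz') hz
  have hfixK : ∀ x ∈ flatten K none, ∀ z, z ∈ x.2.concls ∨ z ∈ x.2.targets → σ z = z := by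
    rintro x hx z (hz | hz)
    · refine hfixE z ?_
      rw [allEdges_eq_flatten K none]
      exact List.mem_flatMap.2 ⟨x, hx, hz⟩
    · exact exitDoor_of_not_mem fun hz' =>
        hF.not_target_right hbA hz' (List.mem_append_right _ hx) hz
  have hfixL : ∀ l ∈ K, ∀ z, z ∈ l.concls ∨ z ∈ l.prems → σ z = z := fun l hl z hz =>
    hfixK _ (shell_mem_flatten hl none) z (Link.shell_touches hz.symm)
  have hlist : ∀ {M : List Edge}, (∀ z ∈ M, σ z = z) → M.map σ = M := fun {M} hM => by
    conv_rhs => rw [← List.map_id M]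
    exact List.map_congr_left hM
  -- The doors do not occur as inner doors in `K`, so the context may be renamed as well and the
  -- result is the renaming of a single list.
  have hren : C.map (Link.rename σ) ++ K = (C ++ K).map (Link.rename σ) := by
    rw [List.map_append, map_rename_of_fixed hfixL]
  -- the structure obtained
  have hst : IsStructure (C.map (Link.rename σ) ++ K) Γ := by
    rw [hren]
    refine IsStructure.rename ?_ ?_ (fun l _ z _ => exitDoor_ty hn1 hbt.2 z) ?_ ?_ ?_ ?_
    · intro l hl
      rcases List.mem_append.1 hl with hl | hl
      exacts [hCt l hl, h.typed (hK hl)]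
    · intro e' ds' C' hl
      rcases List.mem_append.1 hl with hl | hl
      exacts [hCb _ _ _ hl, h.boxes (hK hl)]
    · have h1 : (K.flatMap Link.prems).map σ = K.flatMap Link.prems := hlist fun z hz => by
        obtain ⟨l, hl, hz⟩ := List.mem_flatMap.1 hz
        exact hfixL l hl z (.inr hz)
      have h2 : (K.flatMap Link.concls).map σ = K.flatMap Link.concls := hlist fun z hz => by
        obtain ⟨l, hl, hz⟩ := List.mem_flatMap.1 hz
        exact hfixL l hl z (.inl hz)
      have h3 := hCe.map σ
      rw [List.map_append, map_exitDoor_fst hn1] at h3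
      have h4 := h.edges
      simp only [List.flatMap_append, List.map_append, h1, h2]
      rw [List.perm_iff_count] at h3 h4 ⊢
      intro z
      have h3 := h3 z
      have h4 := h4 z
      simp only [List.count_append] at h3 ⊢
      rcases hy with rfl | rfl <;>
        simp [Link.prems, Link.concls, List.count_cons] at h4 <;> omega
    · intro e' ds' C' hl z hz
      rcases List.mem_append.1 hl with hl | hl
      · exact hfixC _ _ _ hl z hz
      · exact hfixE z (mem_allEdges_of_box hl hz)
    · rwa [allEdges_append]
    · have hns : ∀ z ∈ allEdges (C ++ K), z ∉ ds.map Prod.snd := by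
        intro z hz hz'
        rw [allEdges_append] at hz
        exact (List.mem_append.1 hz).elim (hsC z hz') (hsK z hz')
      exact fun z hz w hw => exitDoor_inj hn1 hn2 (hns z hz) (hns w hw)
  -- The content of the opened box moves to depth 0; all other locations follow the renaming of the
  -- locks.
  set τ : Option Edge → Option Edge := fun b => if b = some f then none else b.map σ with hτ
  have hτz : ∀ {z}, z ≠ f → τ (some z) = some (σ z) := fun hz => by simp [hτ, hz]
  have hS : Λ₀.map (fun x => (τ x.1, x.2.mapEdges σ)) =
      flatten (C.map (Link.rename σ) ++ K) none := by
    rw [hΛ₀, List.map_append, flatten_append]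
    congr 1
    · refine flatten_rename (by simp [hτ]) fun e' ds' C' hl => ⟨hCb _ _ _ hl, hτz ?_, fun z hz => ?_⟩
      · rintro rfl
        exact hfC (mem_allEdges_of_concls hl (.head _))
      · have hz1 := hfixC _ _ _ hl z hz
        refine ⟨hz1, by rw [hτz, hz1]; rintro rfl; exact hfC (mem_allEdges_of_box hl hz)⟩
    · refine flatten_of_fixed K (by simp [hτ]) hfixK fun z hz => ?_
      rw [hτz, hfixE z hz]
      rintro rfl
      exact hfK hz
  -- the lock is visited by the token of `e`
  have hlock : (sys (A ++ Λ₀) Γ).Vis (.atom e []) (.lock f 0) := by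
    have v1 : (sys (A ++ Λ₀) Γ).Vis (.atom e []) (.atom e []) :=
      .gen (G := ∅) (.inr ⟨none, e, by simp [hA], rfl, by simp [boxGuard]⟩) (by simp)
    have v2 : (sys (A ++ Λ₀) Γ).Vis (.atom e []) (.atom f []) :=
      v1.mv ⟨none, y, List.mem_append_left _ hyA,
        (cut_lmv hy).2 ⟨[], .inl ⟨by simp [he1, Formula.polarity], rfl, rfl⟩, rfl⟩⟩ (by simp)
    exact v2.mv ⟨none, _, List.mem_append_left _ hbA, .lock rfl⟩ (by simp)
  have hΛc : ∀ x ∈ Λ₀, ∀ z ∈ x.2.concls, z ∈ allEdges C ∨ z ∈ allEdges K := by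
    intro x hx z hz
    rcases List.mem_append.1 hx with hx | hx
    · rw [allEdges_eq_flatten C (some f)]; exact .inl (List.mem_flatMap.2 ⟨x, hx, hz⟩)
    · rw [allEdges_eq_flatten K none]; exact .inr (List.mem_flatMap.2 ⟨x, hx, hz⟩)
  have hloc : ∀ x ∈ Λ₀, ∀ z, x.1 = some z → z ≠ f → ∃ x' ∈ Λ₀, z ∈ x'.2.concls := by
    intro x hx z hz hzf
    obtain ⟨b, ds', hb⟩ := hF.located x (List.mem_append_right _ hx) z hz
    rcases List.mem_append.1 hb with hb | hb
    · rcases hmem.1 hb with hb | hb | hb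
      · simp at hb
      · rcases hy with rfl | rfl <;> simp at hb
      · simp only [Prod.mk.injEq, Link.box.injEq] at hb
        exact (hzf hb.2.1).elim
    · exact ⟨_, hb, .head _⟩
  refine ⟨hst, ?_⟩
  rw [hfl, ← hS]
  -- The edges `e` and `f` of the cut are discarded; they carry only the token that ends on the
  -- lock.
  refine Contraction.equi (D := fun z => z ≠ e ∧ z ≠ f) ⟨hF, hS ▸ hst.flat, ?_, ?_, ?_, ?_, ?_, ?_,
    ?_, ?_, ?_⟩
  · rintro x hx z hz
    refine ⟨exitDoor_ty hn1 hbt.2 z, ?_⟩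
    rcases hz with hz | hz
    · rcases hΛc x hx z hz with hz | hz
      · exact ⟨by rintro rfl; exact heC hz, by rintro rfl; exact hfC hz⟩
      · exact ⟨by rintro rfl; exact heK hz, by rintro rfl; exact hfK hz⟩
    · exact ⟨by rintro rfl; exact hF.not_target_right hyA hy.mem.1 hx hz,
        by rintro rfl; exact hF.not_target_right hyA hy.mem.2 hx hz⟩
  · intro z hz
    have hyA' := List.mem_append_left Λ₀ hyA
    refine ⟨exitDoor_of_not_mem fun hz' => hF.not_target (List.mem_append_left _ hbA) hz' hz, ?_, ?_⟩
    · rintro rfl; exact hF.not_target hyA' hy.mem.1 hz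
    · rintro rfl; exact hF.not_target hyA' hy.mem.2 hz
  · intro x hx e' he'
    by_cases hxf : x.1 = some f
    · simp [hτ, hxf] at he'
    · simp only [hτ, hxf, if_false] at he'
      obtain ⟨z, hz, rfl⟩ := Option.map_eq_some_iff.1 he'
      exact ⟨z, hz, rfl, hloc x hx z hz (by rintro rfl; exact hxf hz)⟩
  · intro x hx z hz
    by_cases hzf : z = f
    · subst hzf; exact .inl ⟨_, hlock⟩
    · exact .inr ⟨by rw [hz, hτz hzf], hloc x hx z hz hzf⟩
  · rintro x hx e' m q G hmv ⟨hD1, hD2⟩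
    rcases hmem.1 hx with rfl | rfl | rfl
    · obtain ⟨P, Q, m, hPQ, -⟩ := (lmv_wire_iff (by simp)).1 hmv
      simp [Link.Wire, Link.wires] at hPQ
    · obtain ⟨m', ⟨-, -, h2⟩ | ⟨-, -, h2⟩, -⟩ := (cut_lmv hy).1 hmv
      · cases h2; exact (hD2 rfl).elim
      · cases h2; exact (hD1 rfl).elim
    · obtain ⟨e'', rfl, ⟨p, hp, hpe⟩, h2⟩ := mv_doors hF hbA rfl rfl hd hmv
      refine ⟨e'', rfl, ?_, h2⟩
      rcases hpe with rfl | rfl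
      · have := hC2 _ (List.mem_map_of_mem hp)
        exact ⟨fun h => heC (h ▸ this), fun h => hfC (h ▸ this)⟩
      · have := List.mem_map_of_mem (f := Prod.snd) hp
        exact ⟨fun h => hes (h ▸ this), fun h => hfs (h ▸ this)⟩
  · intro b e' hl
    have : e' = e := by
      rcases hmem.1 hl with hb | hb | hb
      · simp only [Prod.mk.injEq, Link.one.injEq] at hb; exact hb.2
      · rcases hy with rfl | rfl <;> simp at hb
      · simp at hb
    subst this
    exact ⟨_, .inr ⟨f, rfl⟩, hlock⟩
  · intro b e' hl hD
    refine hD.1 ?_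
    rcases hmem.1 hl with hb | hb | hb
    · simp only [Prod.mk.injEq, Link.one.injEq] at hb; exact hb.2
    · rcases hy with rfl | rfl <;> simp at hb
    · simp at hb
  · intro b e' ds' C' hl s hs
    have : e' = f := by
      rcases hmem.1 hl with hb | hb | hb
      · simp at hb
      · rcases hy with rfl | rfl <;> simp at hb
      · simp only [Prod.mk.injEq, Link.box.injEq] at hb; exact hb.2.1
    subst this
    exact ⟨none, e, by simp [hA], hF.det.unique hs hlock⟩
  · intro s z m hs hz w _ hw
    refine fill_doors hF hbA rfl rfl (List.sublist_cons_self _ _) ?_ s z m hs hz w hw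
    rintro g rfl
    exact ⟨_, hlock⟩

-- All reduction steps, and the theorem

theorem Step.preserved {L L' : List Link} (hs : Step L L') {Γ : List Edge} (h : IsStructure L Γ) :
    Preserved Γ L L' := by
  cases hs with
  | ax_cut hx hy hL hL' => exact (preserved_ax_cut hx hy (h.perm hL)).perm hL hL'
  | tensor_par hy hL hL' => exact (preserved_tensor_par hy (h.perm hL)).perm hL hL'
  | sync_tensor ha hb hab hL hL' =>
    exact (preserved_sync_tensor (h.perm hL) (ha.perm hL).1 ha.2 (hb.perm hL).1 hb.2 hab).perm hL hL'
  | sync_par ha hb hab hL hL' =>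
    exact (preserved_sync_par (h.perm hL) (ha.perm hL).1 ha.2 (hb.perm hL).1 hb.2 hab).perm hL hL'
  | ax_sync hx he hf hL hL' =>
    exact (preserved_ax_sync hx he (h.perm hL) (hf.perm hL).1 hf.2).perm hL hL'
  | cut_sync hy hd hg hL hL' =>
    exact (preserved_cut_sync hy hd (h.perm hL) (hg.perm hL).1 hg.2).perm hL hL'
  | sync_one hL hL' => exact (preserved_sync_one (h.perm hL)).perm hL hL'
  | box_open hy hL hL' => exact (preserved_box_open hy (h.perm hL)).perm hL hL'

theorem preserved_of_steps {R S : List Link} (hs : Relation.ReflTransGen Step R S) {Γ : List Edge}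
    (h : IsStructure R Γ) : Preserved Γ R S := by
  induction hs with
  | refl => exact ⟨h, .refl Γ _⟩
  | tail _ hs ih =>
    obtain ⟨h2, h3⟩ := hs.preserved ih.1
    exact ⟨h2, ih.2.trans h3⟩

end SMLL

theorem mainTheorem5 (Γ : List SMLL.Edge) (R S : List SMLL.Link)
    (hR : SMLL.IsNet R Γ) (hS : SMLL.IsNormalFormOf S R) :
    (∃! T, SMLL.IsRunEnd Γ R T) ∧ (∃! T, SMLL.IsRunEnd Γ S T) ∧
    SMLL.interp Γ R = SMLL.interp Γ S ∧
    (SMLL.Deadlocks Γ R ↔ SMLL.Deadlocks Γ S) := by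
  obtain ⟨h, he⟩ := SMLL.preserved_of_steps hS.1 hR.1
  exact ⟨SMLL.existsUnique_runEnd hR.1.flat, SMLL.existsUnique_runEnd h.flat,
    SMLL.Equi.interp_eq hR.1.flat h.flat he, by
      rw [SMLL.deadlocks_iff hR.1.flat, SMLL.deadlocks_iff h.flat, he.complete]⟩
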